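/- Let $n\ge 2$. A convex body is a nonempty compact convex subset of $\mathbb{R}^n$, its support function is $h(K,u)=\max\{\langle x,u\rangle: x\in K\}$, and $K$ has constant width $1$ if $h(K,u)+h(K,-u)=1$ for all unit vectors $u\in\mathbb{S}^{n-1}$. Let $\mathcal{W}^n_1$ be the space of convex bodies of constant width $1$ in $\mathbb{R}^n$ with the Hausdorff metric. Let $K\in\mathcal{W}^n_1$ and $u\in\mathbb{S}^{n-1}$. Since $K$ is strictly convex, there is a unique point $x\in K$ with $\langle x,u\rangle=h(K,u)$. For a unit vector $t\perp u$ consider the planar section $C=K\cap(x+\operatorname{lin}\{u,t\})$. For a point $z$ of the relative boundary of $C$ with $\langle z-x,t\rangle>0$, let $r(z)\in[0,\infty]$ be the radius of the circle in this plane through $x$ and $z$ with centre on the ray $\{x-su:s\ge 0\}$ (with $r(z)=\infty$ if $\langle z-x,u\rangle=0$). The radius of curvature of $K$ at $u$ in direction $t$ exists and is equal to $\varrho\in[0,\infty]$ if $$\liminf_{z\to x}r(z)=\limsup_{z\to x}r(z)=\varrho .$$ Then a typical $K\in\mathcal{W}^n_1$ (that is, every $K$ in the complement of some meagre subset of $\mathcal{W}^n_1$)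 has the following property. For $\mathcal{H}^{n-1}$-almost every $u\in\mathbb{S}^{n-1}$, either the radius of curvature of $K$ at $u$ exists and is equal to $1$ in every direction $t\in u^\perp\cap\mathbb{S}^{n-1}$, or there is at least one direction $t\in u^\perp\cap\mathbb{S}^{n-1}$ in which the radius of curvature of $K$ at $u$ exists and is equal to $0$. -/

import Mathlib

open MeasureTheory Filter Topology Set
open scoped ENNReal NNReal RealInnerProductSpace

namespace ConstWidth

noncomputable section

/-- Euclidean space `ℝⁿ`. -/
abbrev E (n : ℕ) : Type := EuclideanSpace ℝ (Fin n)

variable {n : ℕ}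

/-- The support function `h(K, u) = max {⟨x, u⟩ : x ∈ K}`. -/
def supportFun (K : ConvexBody (E n)) (u : E n) : ℝ :=
  sSup ((fun x : E n => ⟪x, u⟫) '' (K : Set (E n)))

/-- `K` is of constant width `d`: `h(K, u) + h(K, -u) = d` for all unit vectors `u`. -/
def IsOfConstantWidth (K : ConvexBody (E n)) (d : ℝ) : Prop :=
  ∀ u : E n, ‖u‖ = 1 → supportFun K u + supportFun K (-u) = d

/-- The space `𝒲ⁿ₁` of convex bodies of constant width `1`. As a subtype of Mathlib's
`ConvexBody` it carries the Hausdorff metric. -/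
abbrev ConstantWidthBody (n : ℕ) : Type :=
  {K : ConvexBody (E n) // IsOfConstantWidth K 1}

/-- The support set `F(K, u) = H(K, u) ∩ K`. -/
def supportSet (K : ConvexBody (E n)) (u : E n) : Set (E n) :=
  {x | x ∈ K ∧ ⟪x, u⟫ = supportFun K u}

/-- The radius `r(z)` of the circle with centre on the ray `{x - r u : r ≥ 0}` that passes through
`x` and through `z`. There is exactly one such circle if `⟨z - x, u⟩ < 0`; if `z ≠ x` lies on the
supporting line `⟨z - x, u⟩ = 0`, there is none and the value is `∞`. -/
def circleRadius (x u z : E n) : ℝ≥0∞ :=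
  ⨅ (r : ℝ≥0) (_ : dist z (x - (r : ℝ) • u) = r), (r : ℝ≥0∞)

/-- The filter of points `z → x` in the part of the relative boundary of the planar convex
set `C` that lies in the open half-plane `{x + λ u + μ t : μ > 0}` of its plane. -/
def boundaryApproach (C : Set (E n)) (x t : E n) : Filter (E n) :=
  𝓝[intrinsicFrontier ℝ C ∩ {z | 0 < ⟪z - x, t⟫}] x

/-- The lower radius of curvature of the two-dimensional convex set `C` (in a plane
`x + lin {u, t}`) at the support element `(x, u)` in direction `t`. -/
def planarLowerRadius (C : Set (E n)) (x u t : E n) : ℝ≥0∞ :=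
  liminf (circleRadius x u) (boundaryApproach C x t)

/-- The upper radius of curvature of the two-dimensional convex set `C` (in a plane
`x + lin {u, t}`) at the support element `(x, u)` in direction `t`. -/
def planarUpperRadius (C : Set (E n)) (x u t : E n) : ℝ≥0∞ :=
  limsup (circleRadius x u) (boundaryApproach C x t)

/-- The plane `x + lin {u, t}`. -/
def sectionPlane (x u t : E n) : AffineSubspace ℝ (E n) :=
  AffineSubspace.mk' x (Submodule.span ℝ {u, t})

/-- The planar section `K ∩ (x + lin {u, t})`. -/
def planarSection (K : ConvexBody (E n)) (x u t : E n) : Set (E n) :=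
  (K : Set (E n)) ∩ (sectionPlane x u t : Set (E n))

/-- `u` is a regular normal vector of `K`, with unique support point `x`, and the (sectional)
radius of curvature of `K` at `u` in direction `t` exists and equals `ρ`: the lower and the upper
radius of curvature of the planar section coincide and have the value `ρ`. -/
def HasRadiusOfCurvature (K : ConvexBody (E n)) (u t : E n) (ρ : ℝ≥0∞) : Prop :=
  ∃ x : E n, supportSet K u = {x} ∧
    planarLowerRadius (planarSection K x u t) x u t = ρ ∧
    planarUpperRadius (planarSection K x u t) x u t = ρ

end

end ConstWidth

/-! For a body K of constant width 1 the support point map x(v) is the gradient of the support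
function h. Since K has diameter at most 1 and contains x(v) - v/‖v‖, it lies in a unit ball
touching it at x(v). Comparing two such balls makes x firmly nonexpansive in the unit normal. By
Rademacher's theorem x is differentiable almost everywhere. At a unit normal u its derivative A is
symmetric, kills u and satisfies ‖Az‖² ≤ ⟨Az, z⟩, so the principal radii of curvature lie in [0, 1].
If equality holds for all z, then A is an orthogonal projection: either it is the identity on u^⊥,
and every radius is 1, or it kills a direction of u^⊥, in which the radius is 0
(`IsOfConstantWidth.curvature_alternative`). It remains to prove equality almost everywhere for
typical K.

In a gnomonic chart v = e + y, and for a fixed direction z, the defect ⟨Az, z⟩ - ‖v‖‖Az‖² is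
nonnegative. Its integral over a ball is a limit of functionals continuous in K, namely those with
difference quotients in place of derivatives. If bodies with small integral are dense
(`exists_integral_defect_lt`), a category argument gives integral zero for typical K.

Density follows from maximizing the bounded energy ∫⟨Az, z⟩². The vector t = Az - ‖v‖A²z has ⟨t, z⟩
equal to the defect, and t⊗t lies below both A and D²‖·‖ - A (`IsOfConstantWidth.rankOne_le`,
`IsOfConstantWidth.rankOne_le_compl`). A rapidly oscillating term ½cos(k⟨t, y⟩ + α) t⊗t can
therefore be added to the Hessian without violating either convexity constraint, while h moves
arbitrarily little. Squaring turns the oscillation into a gain of energy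
(`exists_isLocalPerturbation`). A Besicovitch covering yields a total gain that depends only on a
threshold c0 and the measure of the set where the defect is at least c0 (`exists_energy_gain`). A
body of almost maximal energy near a given one must hence have small total defect.

The gluing errors need some room in the constraints. It comes from mixing K with a small ball, and
the gain does not depend on how much room there is. A chart perturbation is extended to an odd
1-homogeneous function, which keeps the width. The two-sided convexity bounds keep h sublinear
(`exists_body_of_perturbation`). -/

namespace ConstWidth

/-! ### Gradients, convexity and Taylor expansion -/

section Gradient

variable {F : Type*} [NormedAddCommGroup F] [InnerProductSpace ℝ F]

/-- Continuous induction along an interval. Each s has its own δ and is compared only with points to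
its right, so a condition anchored at one point suffices; no uniform neighbourhood is needed. -/
theorem monotone_of_forall_exists_right {φ : ℝ → ℝ} (hc : Continuous φ)
    (h : ∀ s, ∃ δ > 0, ∀ s' ∈ Ioo s (s + δ), φ s ≤ φ s') : Monotone φ := by
  intro a b hab
  have key : Icc a b ⊆ {t | φ a ≤ φ t} := by
    apply IsClosed.Icc_subset_of_forall_exists_gt
    · exact (isClosed_le continuous_const hc).inter isClosed_Icc
    · exact le_refl (φ a)
    · rintro x ⟨hx, -⟩ y hy
      obtain ⟨δ, hδ, h'⟩ := h x
      have hxy : x < y := hy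
      refine ⟨min y (x + δ / 2), ?_, ?_, min_le_left _ _⟩
      · refine le_trans hx (h' _ ⟨lt_min hxy (by linarith), ?_⟩)
        exact lt_of_le_of_lt (min_le_right _ _) (by linarith)
      · exact lt_min hxy (by linarith)
  exact key ⟨hab, le_refl _⟩

theorem convexOn_univ_of_lines {f : F → ℝ}
    (h : ∀ a b : F, ConvexOn ℝ univ fun s : ℝ => f (a + s • b)) : ConvexOn ℝ univ f := by
  refine ⟨convex_univ, fun a _ b _ p q hp hq hpq => ?_⟩
  have := (h a (b - a)).2 (mem_univ 0) (mem_univ 1) hp hq hpq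
  simp only [smul_eq_mul, mul_zero, mul_one, zero_add, zero_smul, add_zero, one_smul,
    add_sub_cancel] at this
  simp only [smul_eq_mul]
  convert this using 2
  rw [← eq_sub_iff_add_eq] at hpq
  rw [hpq, sub_smul, one_smul, smul_sub]
  abel

theorem hasDerivAt_line {f : F → ℝ} {g a b : F} {s : ℝ}
    (hf : HasFDerivAt f (innerSL ℝ g) (a + s • b)) :
    HasDerivAt (fun s : ℝ => f (a + s • b)) ⟪g, b⟫ s := by
  have h1 : HasDerivAt (fun s : ℝ => a + s • b) b s := by
    simpa using ((hasDerivAt_id s).smul_const b).const_add a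
  exact hf.comp_hasDerivAt s h1

/-- A function with continuous, locally monotone gradient is convex. -/
theorem convexOn_univ_of_gradient {f : F → ℝ} {G : F → F}
    (hf : ∀ y, HasFDerivAt f (innerSL ℝ (G y)) y) (hG : Continuous G)
    (hloc : ∀ y, ∃ r > 0, ∀ w ∈ Metric.ball y r, 0 ≤ ⟪G w - G y, w - y⟫) :
    ConvexOn ℝ univ f := by
  refine convexOn_univ_of_lines fun a b => ?_
  have hd : ∀ s : ℝ, HasDerivAt (fun s : ℝ => f (a + s • b)) ⟪G (a + s • b), b⟫ s :=
    fun s => hasDerivAt_line (hf _)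
  refine Monotone.convexOn_univ_of_deriv (fun s => (hd s).differentiableAt) ?_
  have : deriv (fun s : ℝ => f (a + s • b)) = fun s => ⟪G (a + s • b), b⟫ :=
    funext fun s => (hd s).deriv
  rw [this]
  refine monotone_of_forall_exists_right (by fun_prop) fun s => ?_
  obtain ⟨r, hr, h⟩ := hloc (a + s • b)
  refine ⟨r / (‖b‖ + 1), by positivity, fun s' hs' => ?_⟩
  have hpos : 0 < s' - s := sub_pos.2 hs'.1
  have hs2 : s' - s < r / (‖b‖ + 1) := by linarith [hs'.2]
  have h1 := h (a + s' • b) ?_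
  · have h2 : a + s' • b - (a + s • b) = (s' - s) • b := by rw [sub_smul]; abel
    rw [h2, inner_smul_right, inner_sub_left] at h1
    have := nonneg_of_mul_nonneg_right h1 hpos
    linarith
  · rw [mem_ball_iff_norm]
    have h2 : a + s' • b - (a + s • b) = (s' - s) • b := by rw [sub_smul]; abel
    rw [h2, norm_smul, Real.norm_eq_abs, abs_of_pos hpos]
    rw [lt_div_iff₀ (by positivity)] at hs2
    nlinarith [norm_nonneg b]

/-- Restriction to the segment from v to w reduces this to the slope inequality in one variable. The
point v may lie on the boundary of s, which is used later for half-spaces. -/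
theorem ConvexOn.add_inner_gradient_le {s : Set F} {f : F → ℝ} (hc : ConvexOn ℝ s f) {g v w : F}
    (hv : v ∈ s) (hw : w ∈ s) (hf : HasFDerivAt f (innerSL ℝ g) v) :
    f v + ⟪g, w - v⟫ ≤ f w := by
  have hl : ConvexOn ℝ (Icc (0 : ℝ) 1) fun r : ℝ => f (v + r • (w - v)) := by
    refine ⟨convex_Icc 0 1, fun a ha b hb p q hp hq hpq => ?_⟩
    have hm : ∀ c ∈ Icc (0 : ℝ) 1, v + c • (w - v) ∈ s := fun c hc' =>
      hc.1.add_smul_sub_mem hv hw hc'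
    have := hc.2 (hm a ha) (hm b hb) hp hq hpq
    simp only [smul_eq_mul] at this ⊢
    convert this using 2
    have : v = (p + q) • v := by rw [hpq, one_smul]
    nth_rewrite 1 [this]
    simp only [smul_add, add_smul, smul_smul]
    abel
  have hd : HasDerivAt (fun r : ℝ => f (v + r • (w - v))) ⟪g, w - v⟫ 0 :=
    hasDerivAt_line (by simpa using hf)
  have := hl.le_slope_of_hasDerivAt (left_mem_Icc.2 zero_le_one) (right_mem_Icc.2 zero_le_one)
    zero_lt_one hd
  simp [slope_def_field] at this
  linarith

theorem ConvexOn.inner_gradient_sub_nonneg {s : Set F} {f : F → ℝ} (hc : ConvexOn ℝ s f)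
    {g g' v w : F} (hv : v ∈ s) (hw : w ∈ s) (hf : HasFDerivAt f (innerSL ℝ g) v)
    (hf' : HasFDerivAt f (innerSL ℝ g') w) : 0 ≤ ⟪g - g', v - w⟫ := by
  have h1 := ConvexOn.add_inner_gradient_le hc hv hw hf
  have h2 := ConvexOn.add_inner_gradient_le hc hw hv hf'
  have h3 : ⟪g, w - v⟫ = -⟪g, v - w⟫ := by rw [← inner_neg_right, neg_sub]
  rw [inner_sub_left]
  linarith

theorem hasFDerivAt_quadratic (c : ℝ) (g0 y0 : F) (H : F →L[ℝ] F)
    (hsym : ∀ a b, ⟪H a, b⟫ = ⟪a, H b⟫) (y : F) :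
    HasFDerivAt (fun y => c + ⟪g0, y - y0⟫ + 1 / 2 * ⟪H (y - y0), y - y0⟫)
      (innerSL ℝ (g0 + H (y - y0))) y := by
  have hs : HasFDerivAt (fun y : F => y - y0) (ContinuousLinearMap.id ℝ F) y :=
    (hasFDerivAt_id y).sub_const y0
  have h1 : HasFDerivAt (fun y => ⟪g0, y - y0⟫) (innerSL ℝ g0) y := by
    exact (innerSL ℝ g0).hasFDerivAt (x := y - y0) |>.comp y hs
  have h2 := ((H.hasFDerivAt (x := y - y0)).comp y hs).inner ℝ hs
  have h3 := (h1.const_add c).add (h2.const_mul (1 / 2))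
  refine h3.congr_fderiv ?_
  ext d
  simp only [add_apply, smul_apply, innerSL_apply_apply,
    ContinuousLinearMap.comp_apply, ContinuousLinearMap.prod_apply, ContinuousLinearMap.id_apply,
    fderivInnerCLM_apply, smul_eq_mul, inner_add_left, Function.comp]
  have e1 : ⟪H d, y - y0⟫ = ⟪H (y - y0), d⟫ := by rw [hsym, real_inner_comm]
  rw [e1]
  ring

/-- Second order Taylor expansion at a point of differentiability of the gradient. -/
theorem taylor_of_gradient {f : F → ℝ} {g : F → F} {y0 : F} {H : F →L[ℝ] F}
    (hf : ∀ᶠ y in 𝓝 y0, HasFDerivAt f (innerSL ℝ (g y)) y) (hg : HasFDerivAt g H y0)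
    (hsym : ∀ a b, ⟪H a, b⟫ = ⟪a, H b⟫) {η : ℝ} (hη : 0 < η) :
    ∃ ρ > 0, ∀ y ∈ Metric.ball y0 ρ, ‖g y - (g y0 + H (y - y0))‖ ≤ η * ‖y - y0‖ ∧
      |f y - (f y0 + ⟪g y0, y - y0⟫ + 1 / 2 * ⟪H (y - y0), y - y0⟫)| ≤ η * ‖y - y0‖ ^ 2 := by
  have h1 : ∀ᶠ y in 𝓝 y0, ‖g y - g y0 - H (y - y0)‖ ≤ η * ‖y - y0‖ :=
    (hasFDerivAt_iff_isLittleO.1 hg).def hη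
  obtain ⟨ρ, hρ, h⟩ := Metric.eventually_nhds_iff_ball.1 (hf.and h1)
  have hg' : ∀ y ∈ Metric.ball y0 ρ, ‖g y - (g y0 + H (y - y0))‖ ≤ η * ‖y - y0‖ := fun y hy => by
    rw [← sub_sub]; exact (h y hy).2
  refine ⟨ρ, hρ, fun y hy => ⟨hg' y hy, ?_⟩⟩
  set T : F → ℝ := fun y => f y0 + ⟪g y0, y - y0⟫ + 1 / 2 * ⟪H (y - y0), y - y0⟫ with hT
  have hsub : Metric.closedBall y0 ‖y - y0‖ ⊆ Metric.ball y0 ρ := by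
    apply Metric.closedBall_subset_ball
    rwa [← mem_ball_iff_norm]
  -- Mean value inequality for f - T on the closed ball of radius ‖y - y0‖, where the gradient of
  -- the difference is at most η‖y - y0‖.
  have := Convex.norm_image_sub_le_of_norm_hasFDerivWithin_le (𝕜 := ℝ)
    (f := fun y => f y - T y) (s := Metric.closedBall y0 ‖y - y0‖) (x := y0) (y := y)
    (C := η * ‖y - y0‖) (f' := fun y => innerSL ℝ (g y - (g y0 + H (y - y0))))
    (fun w hw => by
      have hd := ((h w (hsub hw)).1.sub (hasFDerivAt_quadratic (f y0) (g y0) y0 H hsym w))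
      rw [map_sub]
      exact hd.hasFDerivWithinAt)
    (fun w hw => by
      rw [innerSL_apply_norm]
      refine (hg' w (hsub hw)).trans ?_
      gcongr
      rwa [← mem_closedBall_iff_norm])
    (convex_closedBall _ _) (Metric.mem_closedBall_self (norm_nonneg _))
    (by rw [mem_closedBall_iff_norm])
  have h0 : f y0 - T y0 = 0 := by simp [hT]
  rw [h0, sub_zero, Real.norm_eq_abs] at this
  calc _ ≤ _ := this
    _ = _ := by ring

/-- Gluing two functions with a cutoff function keeps gradient monotonicity up to an error
controlled by the distance of the two functions. -/
theorem inner_gradient_cutoff {f P χ : F → ℝ} {g p ξ : F → F} {y0 : F} {ρ η C : ℝ} (hρ : 0 < ρ)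
    (hC : 0 ≤ C) (hη : 0 ≤ η)
    (hf : ∀ y, HasFDerivAt f (innerSL ℝ (g y)) y) (hP : ∀ y, HasFDerivAt P (innerSL ℝ (p y)) y)
    (hχl : ∀ v w, |χ v - χ w| ≤ C / ρ * ‖v - w‖) (hξ : ∀ v, ‖ξ v‖ ≤ C / ρ)
    (hξl : ∀ v w, ‖ξ v - ξ w‖ ≤ C / ρ ^ 2 * ‖v - w‖)
    (hτ : ∀ y ∈ Metric.ball y0 ρ, |P y - f y| ≤ η * ρ ^ 2)
    (hτg : ∀ y ∈ Metric.ball y0 ρ, ‖p y - g y‖ ≤ η * ρ)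
    {v w : F} (hv : v ∈ Metric.ball y0 ρ) (hw : w ∈ Metric.ball y0 ρ) :
    |⟪(g v + (χ v • (p v - g v) + (P v - f v) • ξ v))
        - (g w + (χ w • (p w - g w) + (P w - f w) • ξ w)), v - w⟫
      - ((1 - χ v) * ⟪g v - g w, v - w⟫ + χ v * ⟪p v - p w, v - w⟫)|
      ≤ 3 * C * η * ‖v - w‖ ^ 2 := by
  have hlip : |(P v - f v) - (P w - f w)| ≤ η * ρ * ‖v - w‖ := by
    have := Convex.norm_image_sub_le_of_norm_hasFDerivWithin_le (𝕜 := ℝ)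
      (f := fun y => P y - f y) (s := Metric.ball y0 ρ) (x := w) (y := v)
      (C := η * ρ) (f' := fun y => innerSL ℝ (p y - g y))
      (fun y _ => by
        rw [map_sub]
        exact ((hP y).sub (hf y)).hasFDerivWithinAt)
      (fun y hy => by
        rw [innerSL_apply_norm]
        exact hτg y hy) (convex_ball _ _) hw hv
    exact this
  -- Besides the convex combination of the two monotonicity terms, three errors remain. Each pairs a
  -- derivative of χ of order ρ⁻ⁱ with a bound of order ηρⁱ, so the powers of ρ cancel.
  have e : ⟪(g v + (χ v • (p v - g v) + (P v - f v) • ξ v))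
        - (g w + (χ w • (p w - g w) + (P w - f w) • ξ w)), v - w⟫
      - ((1 - χ v) * ⟪g v - g w, v - w⟫ + χ v * ⟪p v - p w, v - w⟫) =
      ⟪(χ v - χ w) • (p w - g w), v - w⟫ + ⟪((P v - f v) - (P w - f w)) • ξ v, v - w⟫
      + ⟪(P w - f w) • (ξ v - ξ w), v - w⟫ := by
    simp only [inner_sub_left, inner_add_left, inner_smul_left, RCLike.conj_to_real]
    ring
  rw [e]
  have b1 : |⟪(χ v - χ w) • (p w - g w), v - w⟫| ≤ C * η * ‖v - w‖ ^ 2 := by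
    refine (abs_real_inner_le_norm _ _).trans ?_
    rw [norm_smul, Real.norm_eq_abs]
    calc |χ v - χ w| * ‖p w - g w‖ * ‖v - w‖ ≤ (C / ρ * ‖v - w‖) * (η * ρ) * ‖v - w‖ := by
          gcongr
          · exact hχl v w
          · exact hτg w hw
      _ = _ := by field_simp
  have b2 : |⟪((P v - f v) - (P w - f w)) • ξ v, v - w⟫| ≤ C * η * ‖v - w‖ ^ 2 := by
    refine (abs_real_inner_le_norm _ _).trans ?_
    rw [norm_smul, Real.norm_eq_abs]
    calc _ ≤ (η * ρ * ‖v - w‖) * (C / ρ) * ‖v - w‖ := by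
          gcongr
          exact hξ v
      _ = _ := by field_simp
  have b3 : |⟪(P w - f w) • (ξ v - ξ w), v - w⟫| ≤ C * η * ‖v - w‖ ^ 2 := by
    refine (abs_real_inner_le_norm _ _).trans ?_
    rw [norm_smul, Real.norm_eq_abs]
    calc _ ≤ (η * ρ ^ 2) * (C / ρ ^ 2 * ‖v - w‖) * ‖v - w‖ := by
          gcongr
          · exact hτ w hw
          · exact hξl v w
      _ = _ := by field_simp
  refine (abs_add_le _ _).trans ((add_le_add (abs_add_le _ _) le_rfl).trans ?_)
  linarith

end Gradient

end ConstWidth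

namespace ConstWidth

/-! ### Cutoffs and rank-one oscillations -/

section Gluing

variable {F : Type*} [NormedAddCommGroup F] [InnerProductSpace ℝ F]

/-- All cutoffs are rescalings of one smooth bump, so C depends on θ but neither on the centre nor
on the scale ρ. -/
theorem exists_cutoff [FiniteDimensional ℝ F] {θ : ℝ} (hθ : 0 < θ) (hθ1 : θ < 1) :
    ∃ C : ℝ, 0 ≤ C ∧ ∀ (y0 : F) (ρ : ℝ), 0 < ρ → ∃ (χ : F → ℝ) (ξ : F → F),
      (∀ y, HasFDerivAt χ (innerSL ℝ (ξ y)) y) ∧ Continuous ξ ∧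
      (∀ y, 0 ≤ χ y) ∧ (∀ y, χ y ≤ 1) ∧
      (∀ v w, |χ v - χ w| ≤ C / ρ * ‖v - w‖) ∧ (∀ v, ‖ξ v‖ ≤ C / ρ) ∧
      (∀ v w, ‖ξ v - ξ w‖ ≤ C / ρ ^ 2 * ‖v - w‖) ∧
      (∀ y ∈ Metric.ball y0 ((1 - θ) * ρ), χ y = 1 ∧ ξ y = 0) ∧
      (∀ y, (1 - θ / 2) * ρ ≤ ‖y - y0‖ → χ y = 0 ∧ ξ y = 0) := by
  let b : ContDiffBump (0 : F) := ⟨1 - θ, 1 - θ / 2, by linarith, by linarith⟩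
  have hb : ContDiff ℝ 2 b := b.contDiff
  have hb' : ContDiff ℝ 1 (fderiv ℝ b) := hb.fderiv_right (by norm_num)
  obtain ⟨C1, hC1⟩ := hb.lipschitzWith_of_hasCompactSupport b.hasCompactSupport (by norm_num)
  obtain ⟨C2, hC2⟩ := hb'.lipschitzWith_of_hasCompactSupport
    (b.hasCompactSupport.fderiv (𝕜 := ℝ)) (by norm_num)
  have hd : Differentiable ℝ b := hb.differentiable (by norm_num)
  let D : F → F := fun y => (InnerProductSpace.toDual ℝ F).symm (fderiv ℝ b y)
  have hD : ∀ y, HasFDerivAt b (innerSL ℝ (D y)) y := fun y => by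
    have : innerSL ℝ (D y) = fderiv ℝ b y := by
      ext z
      simp [D, innerSL_apply_apply]
    rw [this]
    exact (hd y).hasFDerivAt
  have hDc : Continuous D :=
    (InnerProductSpace.toDual ℝ F).symm.continuous.comp hb'.continuous
  have hDb : ∀ y, ‖D y‖ ≤ C1 := fun y => by
    simp only [D, LinearIsometryEquiv.norm_map]
    exact norm_fderiv_le_of_lipschitz ℝ hC1
  have hDl : ∀ v w, ‖D v - D w‖ ≤ C2 * ‖v - w‖ := fun v w => by
    simp only [D, ← map_sub, LinearIsometryEquiv.norm_map]
    exact hC2.norm_sub_le v w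
  refine ⟨C1 + C2, by positivity, fun y0 ρ hρ => ?_⟩
  let s : F → F := fun y => ρ⁻¹ • (y - y0)
  have hs : ∀ v w, ‖s v - s w‖ = ρ⁻¹ * ‖v - w‖ := fun v w => by
    simp only [s, ← smul_sub, norm_smul, sub_sub_sub_cancel_right, norm_inv, Real.norm_eq_abs,
      abs_of_pos hρ]
  have hsn : ∀ v, ‖s v‖ = ρ⁻¹ * ‖v - y0‖ := fun v => by
    simp only [s, norm_smul, norm_inv, Real.norm_eq_abs, abs_of_pos hρ]
  have hsd : ∀ y, HasFDerivAt s (ρ⁻¹ • ContinuousLinearMap.id ℝ F) y := fun y =>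
    ((hasFDerivAt_id y).sub_const y0).const_smul ρ⁻¹
  have hχξ : ∀ y, HasFDerivAt (fun y => b (s y)) (innerSL ℝ (ρ⁻¹ • D (s y))) y := fun y => by
    refine ((hD (s y)).comp y (hsd y)).congr_fderiv ?_
    ext z
    simp [innerSL_apply_apply]
  have hzero : ∀ {c : ℝ} {y : F}, (∀ᶠ w in 𝓝 y, b (s w) = c) → ρ⁻¹ • D (s y) = 0 := by
    intro c y h
    have h1 : HasFDerivAt (fun y => b (s y)) (0 : F →L[ℝ] ℝ) y :=
      (hasFDerivAt_const c y).congr_of_eventuallyEq h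
    have h2 := (hχξ y).unique h1
    have h3 : ‖innerSL ℝ (ρ⁻¹ • D (s y))‖ = 0 := by rw [h2, norm_zero]
    rwa [innerSL_apply_norm, norm_eq_zero] at h3
  refine ⟨fun y => b (s y), fun y => ρ⁻¹ • D (s y), hχξ, by fun_prop, fun y => b.nonneg,
    fun y => b.le_one, fun v w => ?_, fun v => ?_, fun v w => ?_, fun y hy => ?_, fun y hy => ?_⟩
  · have := hC1.norm_sub_le (s v) (s w)
    rw [hs, Real.norm_eq_abs] at this
    refine this.trans ?_
    rw [← mul_assoc, ← div_eq_mul_inv]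
    gcongr
    exact le_add_of_nonneg_right C2.2
  · rw [norm_smul, norm_inv, Real.norm_eq_abs, abs_of_pos hρ, div_eq_inv_mul]
    gcongr
    exact (hDb _).trans (le_add_of_nonneg_right C2.2)
  · rw [← smul_sub, norm_smul, norm_inv, Real.norm_eq_abs, abs_of_pos hρ]
    calc ρ⁻¹ * ‖D (s v) - D (s w)‖ ≤ ρ⁻¹ * (C2 * (ρ⁻¹ * ‖v - w‖)) := by
          gcongr
          exact (hDl _ _).trans_eq (by rw [hs])
      _ = C2 / ρ ^ 2 * ‖v - w‖ := by field_simp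
      _ ≤ _ := by
          gcongr
          exact le_add_of_nonneg_left C1.2
  · have h1 : ∀ w ∈ Metric.ball y0 ((1 - θ) * ρ), b (s w) = 1 := fun w hw => by
      apply b.one_of_mem_closedBall
      rw [mem_closedBall_zero_iff, hsn, inv_mul_le_iff₀ hρ, mul_comm]
      exact (mem_ball_iff_norm.1 hw).le
    exact ⟨h1 y hy, hzero (eventually_of_mem (Metric.isOpen_ball.mem_nhds hy) h1)⟩
  · have h1 : ∀ w, (1 - θ / 2) * ρ ≤ ‖w - y0‖ → b (s w) = 0 := fun w hw => by
      apply b.zero_of_le_dist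
      rw [dist_zero_right, hsn, le_inv_mul_iff₀ hρ, mul_comm]
      exact hw
    refine ⟨h1 y hy, ?_⟩
    -- On the sphere bounding the zero set χ need not vanish nearby, but a zero of a nonnegative
    -- function is a minimum, so the gradient vanishes there too.
    have hmin : IsLocalMin (fun y => b (s y)) y :=
      Filter.Eventually.of_forall fun w => by
        show b (s y) ≤ b (s w)
        rw [h1 y hy]
        exact b.nonneg
    have h2 := hmin.hasFDerivAt_eq_zero (hχξ y)
    have h3 : ‖innerSL ℝ (ρ⁻¹ • D (s y))‖ = 0 := by rw [h2, norm_zero]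
    rwa [innerSL_apply_norm, norm_eq_zero] at h3

/-- The value is of order k⁻² and the gradient of order k⁻¹, whereas the Hessian is ½cos(k⟨t, y -
y0⟩ + α) t⊗t for every k. Large k thus changes second derivatives only. -/
theorem hasFDerivAt_ridge (k α : ℝ) (hk : 0 < k) (t y0 y : F) :
    HasFDerivAt (fun y => -(1 / (2 * k ^ 2)) * Real.cos (k * ⟪t, y - y0⟫ + α))
      (innerSL ℝ ((1 / (2 * k) * Real.sin (k * ⟪t, y - y0⟫ + α)) • t)) y := by
  have h1 : HasFDerivAt (fun y => ⟪t, y - y0⟫) (innerSL ℝ t) y := by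
    exact (innerSL ℝ t).hasFDerivAt (x := y - y0) |>.comp y ((hasFDerivAt_id y).sub_const y0)
  have h2 := (((h1.const_mul k).add_const α).cos).const_mul (-(1 / (2 * k ^ 2)))
  refine h2.congr_fderiv ?_
  ext d
  simp only [smul_apply, innerSL_apply_apply, inner_smul_left, RCLike.conj_to_real, smul_eq_mul]
  field_simp

theorem inner_ridge_gradient_sub (k α : ℝ) (hk : 0 < k) (t y0 v w : F) :
    |⟪(1 / (2 * k) * Real.sin (k * ⟪t, v - y0⟫ + α)) • t
      - (1 / (2 * k) * Real.sin (k * ⟪t, w - y0⟫ + α)) • t, v - w⟫| ≤ 1 / 2 * ⟪t, v - w⟫ ^ 2 := by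
  have hsin : ∀ a b : ℝ, |Real.sin a - Real.sin b| ≤ |a - b| := fun a b => by
    simpa using Real.abs_sin_sub_sin_le a b
  rw [← sub_smul, inner_smul_left, RCLike.conj_to_real, ← mul_sub, abs_mul, abs_mul,
    abs_of_pos (by positivity : 0 < 1 / (2 * k))]
  have h := hsin (k * ⟪t, v - y0⟫ + α) (k * ⟪t, w - y0⟫ + α)
  have e : k * ⟪t, v - y0⟫ + α - (k * ⟪t, w - y0⟫ + α) = k * ⟪t, v - w⟫ := by
    simp only [inner_sub_right]
    ring
  rw [e, abs_mul, abs_of_pos hk] at h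
  calc _ ≤ 1 / (2 * k) * (k * |⟪t, v - w⟫|) * |⟪t, v - w⟫| := by gcongr
    _ = 1 / 2 * |⟪t, v - w⟫| ^ 2 := by field_simp
    _ = _ := by rw [sq_abs]

/-- Pairwise comparison of gradients passes to derivatives. -/
theorem inner_fderiv_le_of_pairwise {g ν : F → F} {y0 : F} {H M : F →L[ℝ] F}
    (h : ∀ v, ⟪ν v - ν y0, v - y0⟫ ≤ ⟪g v - g y0, v - y0⟫)
    (hν : HasFDerivAt ν M y0) (hg : HasFDerivAt g H y0) (d : F) : ⟪M d, d⟫ ≤ ⟪H d, d⟫ := by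
  have lim : ∀ {q : F → F} {Q : F →L[ℝ] F}, HasFDerivAt q Q y0 →
      Tendsto (fun s : ℝ => ⟪s⁻¹ • (q (y0 + s • d) - q y0), d⟫) (𝓝[>] 0) (𝓝 ⟪Q d, d⟫) := by
    intro q Q hq
    have h1 : HasDerivAt (fun s : ℝ => q (y0 + s • d)) (Q d) 0 := by
      have h2 : HasDerivAt (fun s : ℝ => y0 + s • d) d 0 := by
        simpa using ((hasDerivAt_id (0 : ℝ)).smul_const d).const_add y0
      exact HasFDerivAt.comp_hasDerivAt (0 : ℝ) (by simpa using hq) h2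
    have h3 := h1.tendsto_slope_zero_right
    simp only [zero_add, zero_smul, add_zero] at h3
    exact h3.inner tendsto_const_nhds
  refine le_of_tendsto_of_tendsto (lim hν) (lim hg) ?_
  filter_upwards [self_mem_nhdsWithin] with s hs
  have hs : 0 < s := hs
  have := h (y0 + s • d)
  rw [add_sub_cancel_left, inner_smul_right, inner_smul_right] at this
  rw [inner_smul_left, inner_smul_left]
  simp only [RCLike.conj_to_real]
  have h4 := le_of_mul_le_mul_left this hs
  exact mul_le_mul_of_nonneg_left h4 (by positivity)

/-- The bookkeeping behind the gluing. Here L and Md are the increment of ν and its linearization,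
Hd is the Taylor form, rr the oscillation and G the glued increment. Since |rr| ≤ tt/2 uses only
half of the slack Hd and Md - Hd, the model stays between the factors ε/2 and 1 - ε/2, up to η·d2.
The total error (1 + 3C)η·d2 = (ε/4)·lam·d2 is at most (ε/4)L, which lowers ε/2 to ε/4. -/
theorem cutoff_bounds {ε η C lam d2 χ L gg pp Hd Md G rr tt : ℝ} (hε : 0 < ε) (hε1 : ε ≤ 1)
    (hη : 0 ≤ η) (hd2 : 0 ≤ d2) (c0 : 0 ≤ χ) (c1 : χ ≤ 1) (hηC : (1 + 3 * C) * η = ε * lam / 4)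
    (hL : lam * d2 ≤ L) (hM : |L - Md| ≤ η * d2)
    (hcutoff : |G - ((1 - χ) * gg + χ * pp)| ≤ 3 * C * η * d2) (hpd : pp = Hd + rr)
    (hr : |rr| ≤ 1 / 2 * tt) (hl : ε * L ≤ gg) (hu : gg ≤ (1 - ε) * L) (t1 : tt ≤ Hd)
    (t2 : tt ≤ Md - Hd) (m1 : ε * Md ≤ Hd) (m2 : Hd ≤ (1 - ε) * Md) (hlam : 0 ≤ lam) :
    ε / 4 * L ≤ G ∧ G ≤ (1 - ε / 4) * L := by
  rw [abs_le] at hcutoff hM hr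
  have hL0 : 0 ≤ L := le_trans (by positivity) hL
  have hε4 : ε / 4 * (lam * d2) ≤ ε / 4 * L := by gcongr
  have hηC' : (1 + 3 * C) * η * d2 = ε / 4 * (lam * d2) := by rw [hηC]; ring
  have hηd : 0 ≤ η * d2 := by positivity
  have hpl : ε / 2 * L - η * d2 ≤ pp := by
    have h1 : ε / 2 * L ≤ ε / 2 * Md + ε / 2 * (η * d2) := by
      rw [← mul_add]
      gcongr
      linarith [hM.2]
    have h2 : ε / 2 * (η * d2) ≤ η * d2 := mul_le_of_le_one_left hηd (by linarith)
    linarith [hr.1]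
  have hpu : pp ≤ (1 - ε / 2) * L + η * d2 := by
    have h1 : (1 - ε / 2) * Md ≤ (1 - ε / 2) * L + (1 - ε / 2) * (η * d2) := by
      rw [← mul_add]
      apply mul_le_mul_of_nonneg_left _ (by linarith)
      linarith [hM.1]
    have h2 : (1 - ε / 2) * (η * d2) ≤ η * d2 := mul_le_of_le_one_left hηd (by linarith)
    linarith [hr.2]
  have hεL : 0 ≤ ε * L := by positivity
  have hgl : ε / 2 * L - η * d2 ≤ gg := by linarith
  have hgu : gg ≤ (1 - ε / 2) * L + η * d2 := by linarith
  have hcl : ε / 2 * L - η * d2 ≤ (1 - χ) * gg + χ * pp := by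
    have h1 := mul_le_mul_of_nonneg_left hgl (sub_nonneg.2 c1)
    have h2 := mul_le_mul_of_nonneg_left hpl c0
    linarith
  have hcu : (1 - χ) * gg + χ * pp ≤ (1 - ε / 2) * L + η * d2 := by
    have h1 := mul_le_mul_of_nonneg_left hgu (sub_nonneg.2 c1)
    have h2 := mul_le_mul_of_nonneg_left hpu c0
    linarith
  constructor
  · linarith [hcutoff.1]
  · linarith [hcutoff.2]

/-- Local perturbation: near a point where the gradient `g` is differentiable, `f` may be replaced
by a rank-one oscillation around its Taylor polynomial, keeping the two-sided gradient bounds. -/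
theorem exists_local_perturbation [FiniteDimensional ℝ F]
    {f : F → ℝ} {g ν : F → F} {y0 t : F} {H M : F →L[ℝ] F} {ε lam θ σ r₀ : ℝ}
    (hf : ∀ y, HasFDerivAt f (innerSL ℝ (g y)) y) (hgc : Continuous g)
    (hgH : HasFDerivAt g H y0) (hsym : ∀ a b, ⟪H a, b⟫ = ⟪a, H b⟫)
    (hε : 0 < ε) (hε1 : ε ≤ 1)
    (hlow : ∀ v w, ε * ⟪ν v - ν w, v - w⟫ ≤ ⟪g v - g w, v - w⟫)
    (hup : ∀ v w, ⟪g v - g w, v - w⟫ ≤ (1 - ε) * ⟪ν v - ν w, v - w⟫)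
    (hν : HasStrictFDerivAt ν M y0) (hlam : 0 < lam) (hr₀ : 0 < r₀)
    (hmono : ∀ v ∈ Metric.ball y0 r₀, ∀ w ∈ Metric.ball y0 r₀,
      lam * ‖v - w‖ ^ 2 ≤ ⟪ν v - ν w, v - w⟫)
    (ht : ∀ d, ⟪t, d⟫ ^ 2 ≤ ⟪H d, d⟫) (ht' : ∀ d, ⟪t, d⟫ ^ 2 ≤ ⟪M d, d⟫ - ⟪H d, d⟫)
    (hθ : 0 < θ) (hθ1 : θ < 1) (hσ : 0 < σ) :
    ∃ ρ₀ > 0, ∀ ρ, 0 < ρ → ρ < ρ₀ → ∃ k > 0, ∀ α : ℝ, ∃ (φ : F → ℝ) (γ : F → F),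
      Continuous γ ∧ (∀ y, HasFDerivAt φ (innerSL ℝ (γ y)) y) ∧ (∀ y, |φ y| ≤ σ) ∧
      (∃ r < ρ, ∀ y, r ≤ ‖y - y0‖ → φ y = 0 ∧ γ y = 0) ∧
      (∀ v ∈ Metric.ball y0 ρ, ∀ w ∈ Metric.ball y0 ρ,
        ε / 4 * ⟪ν v - ν w, v - w⟫ ≤ ⟪(g v + γ v) - (g w + γ w), v - w⟫ ∧
        ⟪(g v + γ v) - (g w + γ w), v - w⟫ ≤ (1 - ε / 4) * ⟪ν v - ν w, v - w⟫) ∧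
      ∀ y ∈ Metric.ball y0 ((1 - θ) * ρ), g y + γ y =
        g y0 + H (y - y0) + (1 / (2 * k) * Real.sin (k * ⟪t, y - y0⟫ + α)) • t := by
  obtain ⟨C, hC, hcut⟩ := exists_cutoff (F := F) hθ hθ1
  have hHl : ∀ d, ε * ⟪M d, d⟫ ≤ ⟪H d, d⟫ := fun d => by
    have := inner_fderiv_le_of_pairwise (ν := fun v => ε • ν v) (M := ε • M) (g := g)
      (fun v => by
        rw [← smul_sub, inner_smul_left]
        exact hlow v y0) (hν.hasFDerivAt.const_smul ε) hgH d
    simpa [inner_smul_left] using this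
  have hHu : ∀ d, ⟪H d, d⟫ ≤ (1 - ε) * ⟪M d, d⟫ := fun d => by
    have := inner_fderiv_le_of_pairwise (g := fun v => (1 - ε) • ν v) (H := (1 - ε) • M) (ν := g)
      (fun v => by
        rw [← smul_sub, inner_smul_left]
        exact hup v y0) hgH (hν.hasFDerivAt.const_smul (1 - ε)) d
    simpa [inner_smul_left] using this
  -- Chosen so that the three cutoff errors and the linearization error add up to ε·lam/4.
  set η : ℝ := ε * lam / (4 * (1 + 3 * C)) with hηdef
  have hη : 0 < η := by positivity
  have hηC : (1 + 3 * C) * η = ε * lam / 4 := by rw [hηdef]; field_simp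
  obtain ⟨ρ1, hρ1, htay⟩ := taylor_of_gradient (Eventually.of_forall hf) hgH hsym (half_pos hη)
  have hstrict := (hasStrictFDerivAt_iff_isLittleO.1 hν).def hη
  obtain ⟨ρ2, hρ2, hst⟩ : ∃ ρ2 > 0, ∀ v ∈ Metric.ball y0 ρ2, ∀ w ∈ Metric.ball y0 ρ2,
      ‖ν v - ν w - M (v - w)‖ ≤ η * ‖v - w‖ := by
    obtain ⟨ρ2, hρ2, h⟩ := Metric.eventually_nhds_iff_ball.1 hstrict
    refine ⟨ρ2, hρ2, fun v hv w hw => h (v, w) ?_⟩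
    rw [← ball_prod_same]
    exact ⟨hv, hw⟩
  -- The bounds ρ < 1 and ρ < σ/η give ηρ² ≤ σ, the bound on the size of the perturbation.
  refine ⟨min (min ρ1 ρ2) (min r₀ (min 1 (σ / η))), by positivity, fun ρ hρ hρlt => ?_⟩
  simp only [lt_min_iff] at hρlt
  obtain ⟨⟨hρa, hρb⟩, hρc, hρd, hρe⟩ := hρlt
  obtain ⟨χ, ξ, hχ, hξc, hχ0, hχ1, hχl, hξ, hξl, hin, hout⟩ := hcut y0 ρ hρ
  -- The second summand makes the ridge gradient at most ηρ/2, the third makes its value at most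
  -- ηρ²/2, and the 1 gives k ≤ k². The frequency is fixed before the phase α, so that the phase can
  -- be selected later.
  set k : ℝ := 1 + ‖t‖ / (η * ρ) + 1 / (η * ρ ^ 2) with hkdef
  have hk1 : 1 ≤ k := by
    have : 0 ≤ ‖t‖ / (η * ρ) + 1 / (η * ρ ^ 2) := by positivity
    linarith
  have hk : 0 < k := by linarith
  have hkt : ‖t‖ / (2 * k) ≤ η / 2 * ρ := by
    have h1 : ‖t‖ / (η * ρ) ≤ k := by
      have : 0 ≤ 1 / (η * ρ ^ 2) := by positivity
      linarith
    rw [div_le_iff₀ (by positivity)] at h1 ⊢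
    linarith
  have hkk : 1 / (2 * k ^ 2) ≤ η / 2 * ρ ^ 2 := by
    have h1 : 1 / (η * ρ ^ 2) ≤ k := by
      have : 0 ≤ ‖t‖ / (η * ρ) := by positivity
      linarith
    have h2 : k ≤ k ^ 2 := by nlinarith
    have h3 := h1.trans h2
    rw [div_le_iff₀ (by positivity)] at h3 ⊢
    linarith
  refine ⟨k, hk, fun α => ?_⟩
  set P : F → ℝ := fun y => (f y0 + ⟪g y0, y - y0⟫ + 1 / 2 * ⟪H (y - y0), y - y0⟫)
    + -(1 / (2 * k ^ 2)) * Real.cos (k * ⟪t, y - y0⟫ + α) with hP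
  set p : F → F := fun y => g y0 + H (y - y0)
    + (1 / (2 * k) * Real.sin (k * ⟪t, y - y0⟫ + α)) • t with hp
  have hPp : ∀ y, HasFDerivAt P (innerSL ℝ (p y)) y := fun y => by
    simp only [hp]
    rw [map_add]
    exact (hasFDerivAt_quadratic (f y0) (g y0) y0 H hsym y).add (hasFDerivAt_ridge k α hk t y0 y)
  have hpc : Continuous p := by fun_prop
  have hPc : Continuous P := continuous_iff_continuousAt.2 fun y => (hPp y).continuousAt
  have hfc : Continuous f := continuous_iff_continuousAt.2 fun y => (hf y).continuousAt
  have hball : ∀ y ∈ Metric.ball y0 ρ, y ∈ Metric.ball y0 ρ1 := fun y hy =>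
    Metric.ball_subset_ball hρa.le hy
  have hτ : ∀ y ∈ Metric.ball y0 ρ, |P y - f y| ≤ η * ρ ^ 2 := fun y hy => by
    have h1 := (htay y (hball y hy)).2
    have hn : ‖y - y0‖ ≤ ρ := (mem_ball_iff_norm.1 hy).le
    have h2 : η / 2 * ‖y - y0‖ ^ 2 ≤ η / 2 * ρ ^ 2 := by gcongr
    have h3 : |(1 / (2 * k ^ 2)) * Real.cos (k * ⟪t, y - y0⟫ + α)| ≤ η / 2 * ρ ^ 2 := by
      rw [abs_mul, abs_of_pos (by positivity : 0 < 1 / (2 * k ^ 2))]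
      refine le_trans ?_ hkk
      exact mul_le_of_le_one_right (by positivity) (Real.abs_cos_le_one _)
    simp only [hP]
    rw [abs_le] at h1 h3 ⊢
    constructor <;> linarith [h1.1, h1.2, h3.1, h3.2]
  have hτg : ∀ y ∈ Metric.ball y0 ρ, ‖p y - g y‖ ≤ η * ρ := fun y hy => by
    have h1 := (htay y (hball y hy)).1
    have hn : ‖y - y0‖ ≤ ρ := (mem_ball_iff_norm.1 hy).le
    have h2 : η / 2 * ‖y - y0‖ ≤ η / 2 * ρ := by gcongr
    have h3 : ‖(1 / (2 * k) * Real.sin (k * ⟪t, y - y0⟫ + α)) • t‖ ≤ η / 2 * ρ := by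
      rw [norm_smul, Real.norm_eq_abs, abs_mul, abs_of_pos (by positivity : 0 < 1 / (2 * k))]
      refine le_trans ?_ hkt
      calc _ ≤ 1 / (2 * k) * 1 * ‖t‖ := by gcongr; exact Real.abs_sin_le_one _
        _ = _ := by ring
    have e : p y - g y = -(g y - (g y0 + H (y - y0)))
        + (1 / (2 * k) * Real.sin (k * ⟪t, y - y0⟫ + α)) • t := by
      simp only [hp]
      abel
    rw [e]
    refine (norm_add_le _ _).trans ?_
    rw [norm_neg]
    linarith
  refine ⟨fun y => χ y * (P y - f y), fun y => χ y • (p y - g y) + (P y - f y) • ξ y,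
    ?_, fun y => ?_, fun y => ?_, ⟨(1 - θ / 2) * ρ, by nlinarith, fun y hy => ?_⟩, ?_,
    fun y hy => ?_⟩
  · have hχc : Continuous χ := continuous_iff_continuousAt.2 fun y => (hχ y).continuousAt
    fun_prop
  · refine ((hχ y).mul ((hPp y).sub (hf y))).congr_fderiv ?_
    ext d
    simp [innerSL_apply_apply]
  · by_cases hy : y ∈ Metric.ball y0 ρ
    · rw [abs_mul, abs_of_nonneg (hχ0 y)]
      refine (mul_le_of_le_one_left (abs_nonneg _) (hχ1 y)).trans ((hτ y hy).trans ?_)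
      rw [lt_div_iff₀ hη] at hρe
      nlinarith
    · rw [mem_ball_iff_norm, not_lt] at hy
      have h0 := (hout y (le_trans (by nlinarith) hy)).1
      simpa [h0] using hσ.le
  · simp [(hout y hy).1, (hout y hy).2]
  · intro v hv w hw
    have hL : lam * ‖v - w‖ ^ 2 ≤ ⟪ν v - ν w, v - w⟫ :=
      hmono v (Metric.ball_subset_ball hρc.le hv) w (Metric.ball_subset_ball hρc.le hw)
    have hM : |⟪ν v - ν w, v - w⟫ - ⟪M (v - w), v - w⟫| ≤ η * ‖v - w‖ ^ 2 := by
      rw [← inner_sub_left]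
      refine (abs_real_inner_le_norm _ _).trans ?_
      have := hst v (Metric.ball_subset_ball hρb.le hv) w (Metric.ball_subset_ball hρb.le hw)
      nlinarith [norm_nonneg (v - w)]
    have hcutoff := inner_gradient_cutoff hρ hC hη.le hf hPp hχl hξ hξl hτ hτg hv hw
    have hpd : ⟪p v - p w, v - w⟫ = ⟪H (v - w), v - w⟫ +
        ⟪(1 / (2 * k) * Real.sin (k * ⟪t, v - y0⟫ + α)) • t
          - (1 / (2 * k) * Real.sin (k * ⟪t, w - y0⟫ + α)) • t, v - w⟫ := by
      rw [← inner_add_left]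
      congr 1
      have : H (v - w) = H (v - y0) - H (w - y0) := by rw [← map_sub]; congr 1; abel
      simp only [hp]
      rw [this]
      abel
    refine cutoff_bounds hε hε1 hη.le (sq_nonneg _) (hχ0 v) (hχ1 v) ?_ hL hM hcutoff hpd
      (inner_ridge_gradient_sub k α hk t y0 v w) (hlow v w) (hup v w) (ht _) (ht' _) (hHl _)
      (hHu _) hlam.le
    rw [hηC]
  · simp only [(hin y hy).1, (hin y hy).2, smul_zero, add_zero, one_smul, add_sub_cancel, hp]

end Gluing

end ConstWidth

namespace ConstWidth

noncomputable section

/-! ### Support functions and the Hausdorff distance -/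

section SupportFunction

variable {n : ℕ}

theorem bddAbove_inner_image (K : ConvexBody (E n)) (u : E n) :
    BddAbove ((fun x : E n => ⟪x, u⟫) '' (K : Set (E n))) :=
  (K.isCompact.image (by fun_prop)).bddAbove

theorem inner_le_supportFun {K : ConvexBody (E n)} {x : E n} (hx : x ∈ K) (u : E n) :
    ⟪x, u⟫ ≤ supportFun K u :=
  le_csSup (bddAbove_inner_image K u) ⟨x, hx, rfl⟩

theorem exists_inner_eq_supportFun (K : ConvexBody (E n)) (u : E n) :
    ∃ x ∈ K, ⟪x, u⟫ = supportFun K u := by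
  obtain ⟨x, hx, h⟩ := K.isCompact.exists_sSup_image_eq (f := fun x : E n => ⟪x, u⟫) K.nonempty
    (by fun_prop)
  exact ⟨x, hx, h.symm⟩

/-- A support point of `K` with outer normal vector `u`. -/
def supportPoint (K : ConvexBody (E n)) (u : E n) : E n :=
  (exists_inner_eq_supportFun K u).choose

theorem supportPoint_mem (K : ConvexBody (E n)) (u : E n) : supportPoint K u ∈ K :=
  (exists_inner_eq_supportFun K u).choose_spec.1

theorem inner_supportPoint (K : ConvexBody (E n)) (u : E n) :
    ⟪supportPoint K u, u⟫ = supportFun K u :=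
  (exists_inner_eq_supportFun K u).choose_spec.2

theorem supportFun_le {K : ConvexBody (E n)} {u : E n} {c : ℝ} (h : ∀ x ∈ K, ⟪x, u⟫ ≤ c) :
    supportFun K u ≤ c := by
  rw [← inner_supportPoint]
  exact h _ (supportPoint_mem K u)

theorem supportFun_smul (K : ConvexBody (E n)) {c : ℝ} (hc : 0 ≤ c) (u : E n) :
    supportFun K (c • u) = c * supportFun K u := by
  apply le_antisymm
  · refine supportFun_le fun x hx => ?_
    rw [inner_smul_right]
    exact mul_le_mul_of_nonneg_left (inner_le_supportFun hx u) hc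
  · rw [← inner_supportPoint K u, ← inner_smul_right]
    exact inner_le_supportFun (supportPoint_mem K u) _

theorem supportFun_zero (K : ConvexBody (E n)) : supportFun K 0 = 0 := by
  simpa using supportFun_smul K le_rfl 0

theorem supportFun_add_le (K : ConvexBody (E n)) (u v : E n) :
    supportFun K (u + v) ≤ supportFun K u + supportFun K v := by
  refine supportFun_le fun x hx => ?_
  rw [inner_add_right]
  exact add_le_add (inner_le_supportFun hx u) (inner_le_supportFun hx v)

theorem supportFun_le_add_dist (K L : ConvexBody (E n)) (u : E n) :
    supportFun K u ≤ supportFun L u + dist K L * ‖u‖ := by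
  refine supportFun_le fun x hx => ?_
  obtain ⟨y, hy, hxy⟩ := L.isCompact.exists_infDist_eq_dist L.nonempty x
  have h1 : dist x y ≤ dist K L := by
    rw [← hxy, ← ConvexBody.hausdorffDist_coe]
    exact Metric.infDist_le_hausdorffDist_of_mem hx ConvexBody.hausdorffEDist_ne_top
  have h2 : ⟪x, u⟫ = ⟪y, u⟫ + ⟪x - y, u⟫ := by rw [inner_sub_left]; ring
  rw [h2]
  refine add_le_add (inner_le_supportFun hy u) ((real_inner_le_norm _ _).trans ?_)
  rw [← dist_eq_norm]
  gcongr

/-- A point is within distance `c` of `L` if its inner products are bounded by `h(L, ·) + c`. -/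
theorem infDist_le_of_inner_le {L : ConvexBody (E n)} {x : E n} {c : ℝ} (hc : 0 ≤ c)
    (h : ∀ u : E n, ‖u‖ = 1 → ⟪x, u⟫ ≤ supportFun L u + c) : ∃ y ∈ L, dist x y ≤ c := by
  obtain ⟨y, hy, hxy⟩ := exists_norm_eq_iInf_of_complete_convex L.nonempty
    L.isCompact.isComplete L.convex x
  rw [norm_eq_iInf_iff_real_inner_le_zero L.convex hy] at hxy
  refine ⟨y, hy, ?_⟩
  rw [dist_eq_norm]
  by_cases h0 : x - y = 0
  · rw [h0, norm_zero]; exact hc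
  have hn : 0 < ‖x - y‖ := norm_pos_iff.2 h0
  have h1 := h (‖x - y‖⁻¹ • (x - y)) (by rw [norm_smul, norm_inv, norm_norm, inv_mul_cancel₀ hn.ne'])
  have h2 : supportFun L (‖x - y‖⁻¹ • (x - y)) ≤ ⟪y, ‖x - y‖⁻¹ • (x - y)⟫ := by
    refine supportFun_le fun w hw => ?_
    have := hxy w hw
    rw [inner_smul_right, inner_smul_right]
    refine mul_le_mul_of_nonneg_left ?_ (by positivity)
    rw [real_inner_comm, inner_sub_left] at this
    linarith
  have h3 : ⟪x, ‖x - y‖⁻¹ • (x - y)⟫ = ⟪y, ‖x - y‖⁻¹ • (x - y)⟫ + ‖x - y‖ := by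
    have : ⟪x - y, ‖x - y‖⁻¹ • (x - y)⟫ = ‖x - y‖ := by
      rw [inner_smul_right, real_inner_self_eq_norm_sq]
      field_simp
    rw [inner_sub_left] at this
    linarith
  linarith

theorem dist_le_of_supportFun {K L : ConvexBody (E n)} {c : ℝ} (hc : 0 ≤ c)
    (h : ∀ u : E n, ‖u‖ = 1 → |supportFun K u - supportFun L u| ≤ c) : dist K L ≤ c := by
  rw [← ConvexBody.hausdorffDist_coe]
  refine Metric.hausdorffDist_le_of_mem_dist hc (fun x hx => ?_) fun x hx => ?_
  · refine infDist_le_of_inner_le hc fun u hu => (inner_le_supportFun hx u).trans ?_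
    linarith [(abs_le.1 (h u hu)).2]
  · refine infDist_le_of_inner_le hc fun u hu => (inner_le_supportFun hx u).trans ?_
    linarith [(abs_le.1 (h u hu)).1]

/-- Every real sublinear function is a support function. -/
theorem exists_convexBody_of_sublinear {h : E n → ℝ}
    (hs : ∀ c : ℝ, 0 < c → ∀ x, h (c • x) = c * h x) (ha : ∀ x y, h (x + y) ≤ h x + h y) :
    ∃ K : ConvexBody (E n), supportFun K = h := by
  have h0 : h 0 = 0 := by
    have := hs 2 two_pos 0
    rw [smul_zero] at this
    linarith
  have hneg : ∀ x, -h (-x) ≤ h x := fun x => by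
    have := ha x (-x)
    rw [add_neg_cancel, h0] at this
    linarith
  -- Hahn–Banach: the functional c • u ↦ c·h(u) on the line through u is dominated by h (for c < 0
  -- because -h(-x) ≤ h(x)), and its extension is a point of the body exposed in direction u.
  have hext : ∀ u : E n, ∃ p : E n, (∀ x, ⟪p, x⟫ ≤ h x) ∧ ⟪p, u⟫ = h u := by
    intro u
    obtain ⟨g, hg, hgl⟩ : ∃ g : E n →ₗ[ℝ] ℝ, g u = h u ∧ ∀ x, g x ≤ h x := by
      by_cases hu : u = 0
      · obtain ⟨g, -, hgl⟩ := exists_extension_of_le_sublinear (⟨⊥, 0⟩ : E n →ₗ.[ℝ] ℝ) h hs ha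
          (fun x => by
            have hx : (x : E n) = 0 := (Submodule.mem_bot ℝ).1 x.2
            rw [hx, h0]
            exact le_rfl)
        exact ⟨g, by rw [hu, h0, map_zero], hgl⟩
      · obtain ⟨g, hg, hgl⟩ := exists_extension_of_le_sublinear
          (LinearPMap.mkSpanSingleton (K := ℝ) u (h u) hu) h hs ha
          (fun x => by
            obtain ⟨x, hx⟩ := x
            obtain ⟨c, rfl⟩ := Submodule.mem_span_singleton.1 hx
            have e : (LinearPMap.mkSpanSingleton (K := ℝ) u (h u) hu) ⟨c • u, hx⟩ = c • h u :=
              LinearPMap.mkSpanSingleton'_apply _ _ _ _ _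
            rw [e]
            rcases lt_trichotomy c 0 with hc | hc | hc
            · have h1 : c • u = (-c) • (-u) := by simp
              simp only [smul_eq_mul]
              rw [h1, hs (-c) (by linarith)]
              have := hneg u
              nlinarith
            · simp [hc, h0]
            · simp only [smul_eq_mul]
              rw [hs c hc])
        refine ⟨g, ?_, hgl⟩
        have := hg ⟨u, Submodule.mem_span_singleton_self u⟩
        rw [LinearPMap.mkSpanSingleton_apply] at this
        exact this
    refine ⟨(InnerProductSpace.toDual ℝ (E n)).symm (LinearMap.toContinuousLinearMap g),
      fun x => ?_, ?_⟩
    · simpa using hgl x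
    · simpa using hg
  let S : Set (E n) := {p | ∀ x, ⟪p, x⟫ ≤ h x}
  have hconv : Convex ℝ S := by
    intro p hp q hq a b ha' hb hab x
    rw [inner_add_left, inner_smul_left, inner_smul_left]
    simp only [RCLike.conj_to_real]
    have h1 := mul_le_mul_of_nonneg_left (hp x) ha'
    have h2 := mul_le_mul_of_nonneg_left (hq x) hb
    have : a * h x + b * h x = h x := by rw [← add_mul, hab, one_mul]
    linarith
  have hclosed : IsClosed S := by
    have : S = ⋂ x, {p | ⟪p, x⟫ ≤ h x} := by ext; simp [S]
    rw [this]
    exact isClosed_iInter fun x => isClosed_le (by fun_prop) continuous_const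
  have hbdd : Bornology.IsBounded S := by
    let b := EuclideanSpace.basisFun (Fin n) ℝ
    refine isBounded_iff_forall_norm_le.2 ⟨∑ i, (|h (b i)| + |h (-b i)|), fun p hp => ?_⟩
    conv_lhs => rw [← b.sum_repr p]
    refine (norm_sum_le _ _).trans (Finset.sum_le_sum fun i _ => ?_)
    rw [norm_smul, b.norm_eq_one, mul_one, b.repr_apply_apply, Real.norm_eq_abs, real_inner_comm]
    have h1 := hp (b i)
    have h2 := hp (-b i)
    rw [inner_neg_right] at h2
    rw [abs_le]
    constructor
    · linarith [le_abs_self (h (-b i)), abs_nonneg (h (b i))]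
    · linarith [le_abs_self (h (b i)), abs_nonneg (h (-b i))]
  obtain ⟨p0, hp0, -⟩ := hext 0
  let K : ConvexBody (E n) := ⟨S, hconv, Metric.isCompact_of_isClosed_isBounded hclosed hbdd,
    ⟨p0, hp0⟩⟩
  refine ⟨K, funext fun u => le_antisymm (supportFun_le fun x hx => hx u) ?_⟩
  obtain ⟨p, hp, hpu⟩ := hext u
  rw [← hpu]
  exact inner_le_supportFun (K := K) hp u

end SupportFunction

/-! ### Touching balls and the support point map -/

section ConstantWidth

variable {n : ℕ}

theorem norm_inv_smul_self {v : E n} (hv : v ≠ 0) : ‖‖v‖⁻¹ • v‖ = 1 := by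
  rw [norm_smul, norm_inv, norm_norm, inv_mul_cancel₀ (norm_ne_zero_iff.2 hv)]

theorem IsOfConstantWidth.add_neg {K : ConvexBody (E n)} (hK : IsOfConstantWidth K 1) (u : E n) :
    supportFun K u + supportFun K (-u) = ‖u‖ := by
  by_cases hu : u = 0
  · simp [hu, supportFun_zero]
  have h := hK _ (norm_inv_smul_self hu)
  have hn : ‖u‖ ≠ 0 := norm_ne_zero_iff.2 hu
  rw [← smul_neg, supportFun_smul K (by positivity), supportFun_smul K (by positivity)] at h
  field_simp at h
  exact h

/-- With the direction x - y itself as test vector, ‖x - y‖² is at most the width in that direction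
times its length, that is, ‖x - y‖. -/
theorem IsOfConstantWidth.norm_sub_le_one {K : ConvexBody (E n)} (hK : IsOfConstantWidth K 1)
    {x y : E n} (hx : x ∈ K) (hy : y ∈ K) : ‖x - y‖ ≤ 1 := by
  have h := hK.add_neg (x - y)
  have h1 := inner_le_supportFun hx (x - y)
  have h2 := inner_le_supportFun hy (-(x - y))
  have h3 : ⟪x - y, x - y⟫ = ‖x - y‖ ^ 2 := real_inner_self_eq_norm_sq _
  rw [inner_sub_left] at h3
  rw [inner_neg_right] at h2
  by_contra hlt
  nlinarith

/-- The support point y in direction -u satisfies ⟨x - y, u⟩ = 1 and ‖x - y‖ ≤ 1. Equality in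
Cauchy–Schwarz forces y = x - u. -/
theorem IsOfConstantWidth.sub_mem {K : ConvexBody (E n)} (hK : IsOfConstantWidth K 1)
    {x u : E n} (hx : x ∈ K) (hu : ‖u‖ = 1) (hxu : ⟪x, u⟫ = supportFun K u) : x - u ∈ K := by
  set y := supportPoint K (-u)
  have hy : y ∈ K := supportPoint_mem K (-u)
  have hyu : ⟪y, -u⟫ = supportFun K (-u) := inner_supportPoint K (-u)
  have h1 := hK.norm_sub_le_one hx hy
  have h2 := hK u hu
  rw [inner_neg_right] at hyu
  have h3 : ⟪x - y, u⟫ = 1 := by rw [inner_sub_left]; linarith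
  have h4 : ‖(x - y) - u‖ ^ 2 ≤ 0 := by
    rw [norm_sub_sq_real, h3, hu]
    nlinarith [norm_nonneg (x - y)]
  have h5 : (x - y) - u = 0 := by
    have := pow_eq_zero_iff (two_ne_zero) |>.1 (le_antisymm h4 (sq_nonneg _))
    exact norm_eq_zero.1 this
  have : x - u = y := by
    rw [sub_eq_zero] at h5
    rw [← h5]; abel
  rwa [this]

/-- The whole body lies in the unit ball that touches it at a support point. -/
theorem IsOfConstantWidth.norm_sq_le {K : ConvexBody (E n)} (hK : IsOfConstantWidth K 1)
    {x u y : E n} (hx : x ∈ K) (hu : ‖u‖ = 1) (hxu : ⟪x, u⟫ = supportFun K u) (hy : y ∈ K) :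
    ‖y - x‖ ^ 2 ≤ -2 * ⟪y - x, u⟫ := by
  have h := hK.norm_sub_le_one hy (hK.sub_mem hx hu hxu)
  have e : y - (x - u) = (y - x) + u := by abel
  rw [e] at h
  have h2 := norm_add_sq_real (y - x) u
  rw [hu] at h2
  nlinarith [norm_nonneg (y - x + u)]

theorem inner_inv_norm_smul_supportPoint (K : ConvexBody (E n)) (v : E n) :
    ⟪supportPoint K v, ‖v‖⁻¹ • v⟫ = supportFun K (‖v‖⁻¹ • v) := by
  rw [supportFun_smul K (by positivity), inner_smul_right, inner_supportPoint]

/-- The support point map of a body of constant width is firmly nonexpansive on the sphere. -/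
theorem IsOfConstantWidth.firmly_nonexpansive {K : ConvexBody (E n)}
    (hK : IsOfConstantWidth K 1) {v w : E n} (hv : v ≠ 0) (hw : w ≠ 0) :
    ‖supportPoint K v - supportPoint K w‖ ^ 2 ≤
      ⟪supportPoint K v - supportPoint K w, ‖v‖⁻¹ • v - ‖w‖⁻¹ • w⟫ := by
  -- Each support point lies in the unit ball touching at the other; the sum of the two inequalities
  -- is the claim.
  have h1 := hK.norm_sq_le (supportPoint_mem K v) (norm_inv_smul_self hv)
    (inner_inv_norm_smul_supportPoint K v) (supportPoint_mem K w)
  have h2 := hK.norm_sq_le (supportPoint_mem K w) (norm_inv_smul_self hw)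
    (inner_inv_norm_smul_supportPoint K w) (supportPoint_mem K v)
  rw [norm_sub_rev, ← neg_sub (supportPoint K v), inner_neg_left] at h1
  rw [inner_sub_right]
  linarith

theorem IsOfConstantWidth.norm_supportPoint_sub_le {K : ConvexBody (E n)}
    (hK : IsOfConstantWidth K 1) {v w : E n} (hv : v ≠ 0) (hw : w ≠ 0) :
    ‖supportPoint K v - supportPoint K w‖ ≤ ‖‖v‖⁻¹ • v - ‖w‖⁻¹ • w‖ := by
  have h := (hK.firmly_nonexpansive hv hw).trans (real_inner_le_norm _ _)
  by_contra hlt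
  nlinarith [norm_nonneg (‖v‖⁻¹ • v - ‖w‖⁻¹ • w),
    norm_nonneg (supportPoint K v - supportPoint K w)]

theorem IsOfConstantWidth.eq_supportPoint {K : ConvexBody (E n)}
    (hK : IsOfConstantWidth K 1) {v x : E n} (hv : v ≠ 0) (hx : x ∈ K)
    (hxv : ⟪x, v⟫ = supportFun K v) : x = supportPoint K v := by
  have h1 := hK.norm_sq_le (supportPoint_mem K v) (norm_inv_smul_self hv)
    (inner_inv_norm_smul_supportPoint K v) hx
  have h2 : ⟪x - supportPoint K v, ‖v‖⁻¹ • v⟫ = 0 := by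
    rw [inner_sub_left, inner_smul_right, inner_smul_right, hxv, inner_supportPoint, sub_self]
  rw [h2, mul_zero] at h1
  have := pow_eq_zero_iff (two_ne_zero) |>.1 (le_antisymm h1 (sq_nonneg _))
  exact sub_eq_zero.1 (norm_eq_zero.1 this)

theorem IsOfConstantWidth.supportPoint_smul {K : ConvexBody (E n)}
    (hK : IsOfConstantWidth K 1) {c : ℝ} (hc : 0 < c) {v : E n} (hv : v ≠ 0) :
    supportPoint K (c • v) = supportPoint K v := by
  refine (hK.eq_supportPoint (smul_ne_zero hc.ne' hv) (supportPoint_mem K v) ?_).symm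
  rw [inner_smul_right, inner_supportPoint, supportFun_smul K hc.le]

/-- With c the cosine of the angle, ‖v - w‖² = (‖v‖ - ‖w‖)² + 2‖v‖‖w‖(1 - c), while the normalized
vectors have squared distance 2(1 - c). -/
theorem norm_inv_norm_smul_sub_le {v w : E n} (hv : 1 ≤ ‖v‖) (hw : 1 ≤ ‖w‖) :
    ‖‖v‖⁻¹ • v - ‖w‖⁻¹ • w‖ ≤ ‖v - w‖ := by
  have hv0 : 0 < ‖v‖ := by linarith
  have hw0 : 0 < ‖w‖ := by linarith
  refine le_of_sq_le_sq ?_ (norm_nonneg _)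
  have h1 := norm_sub_sq_real (‖v‖⁻¹ • v) (‖w‖⁻¹ • w)
  have h2 := norm_sub_sq_real v w
  rw [norm_inv_smul_self (norm_pos_iff.1 hv0), norm_inv_smul_self (norm_pos_iff.1 hw0),
    inner_smul_left, inner_smul_right] at h1
  simp only [RCLike.conj_to_real] at h1
  set c := ‖v‖⁻¹ * (‖w‖⁻¹ * ⟪v, w⟫) with hc
  have hcv : ⟪v, w⟫ = ‖v‖ * ‖w‖ * c := by rw [hc]; field_simp
  have hc1 : c ≤ 1 := by
    have := real_inner_le_norm v w
    rw [hcv] at this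
    exact le_of_mul_le_mul_left (by linarith) (mul_pos hv0 hw0)
  rw [h1, h2, hcv]
  have : 1 ≤ ‖v‖ * ‖w‖ := one_le_mul_of_one_le_of_one_le hv hw
  nlinarith [sq_nonneg (‖v‖ - ‖w‖), mul_nonneg (sub_nonneg.2 this) (sub_nonneg.2 hc1)]

theorem IsOfConstantWidth.continuousAt_supportPoint {K : ConvexBody (E n)}
    (hK : IsOfConstantWidth K 1) {v : E n} (hv : v ≠ 0) : ContinuousAt (supportPoint K) v := by
  rw [ContinuousAt, tendsto_iff_norm_sub_tendsto_zero]
  have hc : ContinuousAt (fun w : E n => ‖‖w‖⁻¹ • w - ‖v‖⁻¹ • v‖) v := by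
    have : ContinuousAt (fun w : E n => ‖w‖⁻¹) v :=
      continuous_norm.continuousAt.inv₀ (norm_ne_zero_iff.2 hv)
    fun_prop
  have h0 : Tendsto (fun w : E n => ‖‖w‖⁻¹ • w - ‖v‖⁻¹ • v‖) (𝓝 v) (𝓝 0) := by
    have := hc.tendsto
    simpa using this
  refine tendsto_of_tendsto_of_tendsto_of_le_of_le' tendsto_const_nhds h0
    (Eventually.of_forall fun _ => norm_nonneg _) ?_
  filter_upwards [isOpen_ne.mem_nhds hv] with w hw
  exact hK.norm_supportPoint_sub_le hw hv

/-- The support inequalities at v and at w squeeze the first order remainder between 0 and ⟨x(w) -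
x(v), w - v⟩, which is o(‖w - v‖) by continuity of x. -/
theorem IsOfConstantWidth.hasFDerivAt_supportFun {K : ConvexBody (E n)}
    (hK : IsOfConstantWidth K 1) {v : E n} (hv : v ≠ 0) :
    HasFDerivAt (supportFun K) (innerSL ℝ (supportPoint K v)) v := by
  rw [hasFDerivAt_iff_isLittleO, Asymptotics.isLittleO_iff]
  intro c hc
  have h1 := (hK.continuousAt_supportPoint hv).eventually (Metric.closedBall_mem_nhds _ hc)
  filter_upwards [h1] with w hw
  rw [dist_eq_norm] at hw
  have h2 := inner_le_supportFun (supportPoint_mem K v) w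
  have h3 := inner_le_supportFun (supportPoint_mem K w) v
  have h4 := inner_supportPoint K v
  have h5 := inner_supportPoint K w
  have h6 : ⟪supportPoint K w - supportPoint K v, w - v⟫ ≤ c * ‖w - v‖ :=
    (real_inner_le_norm _ _).trans (by gcongr)
  simp only [inner_sub_left, inner_sub_right] at h6
  rw [innerSL_apply_apply, inner_sub_right, Real.norm_eq_abs, abs_le]
  constructor <;> linarith [mul_nonneg hc.le (norm_nonneg (w - v))]

/-- The support points depend continuously on the body. -/
theorem continuous_supportPoint_body {v : E n} (hv : v ≠ 0) :
    Continuous fun K : ConstantWidthBody n => supportPoint K.1 v := by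
  rw [continuous_iff_continuousAt]
  intro K
  rw [ContinuousAt, tendsto_iff_norm_sub_tendsto_zero]
  -- A point p of K within dist L K of the support point of L misses the supporting hyperplane of K
  -- by at most 2·dist L K. The touching ball turns this into ‖p - x‖² ≤ 4·dist L K.
  have key : ∀ L : ConstantWidthBody n, ‖supportPoint L.1 v - supportPoint K.1 v‖ ≤
      dist L K + Real.sqrt (4 * dist L K) := by
    intro L
    set x' := supportPoint L.1 v
    set x := supportPoint K.1 v
    set u := ‖v‖⁻¹ • v
    have hu : ‖u‖ = 1 := norm_inv_smul_self hv
    have hx'u : ⟪x', u⟫ = supportFun L.1 u := inner_inv_norm_smul_supportPoint L.1 v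
    have hxu : ⟪x, u⟫ = supportFun K.1 u := inner_inv_norm_smul_supportPoint K.1 v
    have hd : dist L K = dist L.1 K.1 := rfl
    obtain ⟨p, hp, hxp⟩ := infDist_le_of_inner_le (L := K.1) (x := x') (c := dist L K)
      dist_nonneg fun w hw => by
        refine (inner_le_supportFun (supportPoint_mem L.1 v) w).trans ?_
        have := supportFun_le_add_dist L.1 K.1 w
        rwa [hw, mul_one] at this
    have h1 : supportFun K.1 u ≤ supportFun L.1 u + dist L K := by
      have := supportFun_le_add_dist K.1 L.1 u
      rwa [hu, mul_one, dist_comm] at this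
    have h2 : ⟪x' - p, u⟫ ≤ dist L K := by
      refine (real_inner_le_norm _ _).trans ?_
      rwa [hu, mul_one, ← dist_eq_norm]
    have h3 := K.2.norm_sq_le (supportPoint_mem K.1 v) hu hxu hp
    rw [inner_sub_left] at h2 h3
    have h4 : ‖p - x‖ ≤ Real.sqrt (4 * dist L K) := by
      apply Real.le_sqrt_of_sq_le
      linarith
    calc ‖x' - x‖ = ‖(x' - p) + (p - x)‖ := by congr 1; abel
      _ ≤ ‖x' - p‖ + ‖p - x‖ := norm_add_le _ _
      _ ≤ _ := add_le_add (by rwa [← dist_eq_norm]) h4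
  have hlim : Tendsto (fun L : ConstantWidthBody n => dist L K + Real.sqrt (4 * dist L K))
      (𝓝 K) (𝓝 0) := by
    have : Continuous fun L : ConstantWidthBody n => dist L K + Real.sqrt (4 * dist L K) := by
      fun_prop
    simpa using this.tendsto K
  exact tendsto_of_tendsto_of_tendsto_of_le_of_le tendsto_const_nhds hlim
    (fun _ => norm_nonneg _) key

end ConstantWidth

end

end ConstWidth

namespace ConstWidth

noncomputable section

/-! ### The derivative of the support point map -/

section Derivative

variable {n : ℕ}

theorem tendsto_slope_line {q : E n → E n} {Q : E n →L[ℝ] E n} {v : E n} (hq : HasFDerivAt q Q v)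
    (z : E n) : Tendsto (fun s : ℝ => s⁻¹ • (q (v + s • z) - q v)) (𝓝[>] 0) (𝓝 (Q z)) := by
  have h1 : HasDerivAt (fun s : ℝ => q (v + s • z)) (Q z) 0 := by
    have h2 : HasDerivAt (fun s : ℝ => v + s • z) z 0 := by
      simpa using ((hasDerivAt_id (0 : ℝ)).smul_const z).const_add v
    exact HasFDerivAt.comp_hasDerivAt (0 : ℝ) (by simpa using hq) h2
  have h3 := h1.tendsto_slope_zero_right
  simpa only [zero_add, zero_smul, add_zero] using h3

/-- The derivative of `w ↦ w / ‖w‖` at `v`. -/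
def normalizeDeriv (v : E n) : E n →L[ℝ] E n :=
  ‖v‖⁻¹ • (ContinuousLinearMap.id ℝ (E n) - (innerSL ℝ ((‖v‖ ^ 2)⁻¹ • v)).smulRight v)

theorem normalizeDeriv_apply (v z : E n) :
    normalizeDeriv v z = ‖v‖⁻¹ • (z - ((‖v‖ ^ 2)⁻¹ * ⟪v, z⟫) • v) := by
  simp [normalizeDeriv]

theorem hasStrictFDerivAt_normalize {v : E n} (hv : v ≠ 0) :
    HasStrictFDerivAt (fun w : E n => ‖w‖⁻¹ • w) (normalizeDeriv v) v := by
  have hn : ‖v‖ ≠ 0 := norm_ne_zero_iff.2 hv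
  have h1 : HasStrictFDerivAt (fun w : E n => ‖w‖ ^ 2) (2 • innerSL ℝ v) v :=
    hasStrictFDerivAt_norm_sq v
  have h2 := h1.sqrt (by positivity)
  have h3 : HasStrictFDerivAt (fun w : E n => ‖w‖)
      ((1 / (2 * √(‖v‖ ^ 2))) • (2 • innerSL ℝ v)) v := by
    simpa [Real.sqrt_sq (norm_nonneg _)] using h2
  have h4 := (hasStrictDerivAt_inv hn).comp_hasStrictFDerivAt v h3
  have h5 := h4.smul (hasStrictFDerivAt_id v)
  refine h5.congr_fderiv ?_
  ext1 z
  rw [normalizeDeriv_apply]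
  simp only [add_apply, smul_apply, ContinuousLinearMap.smulRight_apply, innerSL_apply_apply,
    ContinuousLinearMap.id_apply, Real.sqrt_sq (norm_nonneg v), smul_eq_mul, nsmul_eq_mul, id_eq,
    Function.comp]
  rw [smul_sub, smul_smul, sub_eq_add_neg, ← neg_smul]
  congr 2
  field_simp
  simp

variable {K : ConvexBody (E n)} {v : E n} {A : E n →L[ℝ] E n}

/-- The support point map is the gradient of h near v, so A is a Hessian. -/
theorem IsOfConstantWidth.deriv_symm (hK : IsOfConstantWidth K 1) (hv : v ≠ 0)
    (hA : HasFDerivAt (supportPoint K) A v) (a b : E n) : ⟪A a, b⟫ = ⟪a, A b⟫ := by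
  let I : E n →L[ℝ] (E n →L[ℝ] ℝ) := LinearMap.toContinuousLinearMap
    { toFun := fun x => innerSL ℝ x
      map_add' := fun x y => map_add _ x y
      map_smul' := fun c x => by ext; simp }
  have h1 : HasFDerivAt (fun y => innerSL ℝ (supportPoint K y)) (I.comp A) v :=
    (I.hasFDerivAt (x := supportPoint K v)).comp v hA
  have h2 : ∀ᶠ y in 𝓝 v, HasFDerivAt (supportFun K) (innerSL ℝ (supportPoint K y)) y := by
    filter_upwards [isOpen_ne.mem_nhds hv] with y hy
    exact hK.hasFDerivAt_supportFun hy
  have h3 : (innerSL ℝ (A a)) b = (innerSL ℝ (A b)) a :=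
    second_derivative_symmetric_of_eventually h2 h1 a b
  rw [innerSL_apply_apply, innerSL_apply_apply] at h3
  rw [h3, real_inner_comm]

/-- The support point map is constant along rays. -/
theorem IsOfConstantWidth.deriv_self (hK : IsOfConstantWidth K 1) (hv : v ≠ 0)
    (hA : HasFDerivAt (supportPoint K) A v) : A v = 0 := by
  refine tendsto_nhds_unique (tendsto_slope_line hA v) ?_
  refine tendsto_const_nhds.congr' ?_
  filter_upwards [self_mem_nhdsWithin] with s hs
  have hs : 0 < s := hs
  have : v + s • v = (1 + s) • v := by rw [add_smul, one_smul]
  rw [this, hK.supportPoint_smul (by positivity) hv, sub_self, smul_zero]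

/-- The infinitesimal form of firm nonexpansiveness. The derivative of v/‖v‖ contributes a multiple
of z plus a multiple of v, and the latter drops out because Az ⟂ v. -/
theorem IsOfConstantWidth.deriv_firm (hK : IsOfConstantWidth K 1) (hv : v ≠ 0)
    (hA : HasFDerivAt (supportPoint K) A v) (z : E n) : ‖v‖ * ‖A z‖ ^ 2 ≤ ⟪A z, z⟫ := by
  have h1 := tendsto_slope_line hA z
  have h2 := tendsto_slope_line (hasStrictFDerivAt_normalize hv).hasFDerivAt z
  have hne : ∀ᶠ s : ℝ in 𝓝[>] 0, v + s • z ≠ 0 := by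
    have : Tendsto (fun s : ℝ => v + s • z) (𝓝[>] 0) (𝓝 v) := by
      have hc : Continuous fun s : ℝ => v + s • z := by fun_prop
      have := hc.tendsto 0
      rw [zero_smul, add_zero] at this
      exact this.mono_left nhdsWithin_le_nhds
    exact this.eventually (isOpen_ne.mem_nhds hv)
  have h3 : ‖A z‖ ^ 2 ≤ ⟪A z, normalizeDeriv v z⟫ := by
    refine le_of_tendsto_of_tendsto (h1.norm.pow 2) (h1.inner h2) ?_
    filter_upwards [hne] with s hs
    have := hK.firmly_nonexpansive hs hv
    rw [norm_smul, inner_smul_left, inner_smul_right, mul_pow, RCLike.conj_to_real, ← mul_assoc,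
      ← pow_two, Real.norm_eq_abs, sq_abs]
    exact mul_le_mul_of_nonneg_left this (sq_nonneg _)
  have h4 : ⟪A z, v⟫ = 0 := by
    rw [hK.deriv_symm hv hA, hK.deriv_self hv hA, inner_zero_right]
  rw [normalizeDeriv_apply, inner_smul_right, inner_sub_right, inner_smul_right, h4, mul_zero,
    sub_zero] at h3
  have hn : 0 < ‖v‖ := norm_pos_iff.2 hv
  rwa [← le_inv_mul_iff₀ hn]

end Derivative

/-! ### Rank-one forms dominated by the curvature constraints -/

section QuadraticForm

variable {F : Type*} [NormedAddCommGroup F] [InnerProductSpace ℝ F]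

/-- Cauchy–Schwarz for the possibly degenerate form of B, through the discriminant of s ↦ ⟨B(w +
sd), w + sd⟩. -/
theorem inner_sq_le_of_nonneg {B : F →L[ℝ] F} (hs : ∀ a b, ⟪B a, b⟫ = ⟪a, B b⟫)
    (hp : ∀ a, 0 ≤ ⟪B a, a⟫) (w d : F) : ⟪B w, d⟫ ^ 2 ≤ ⟪B w, w⟫ * ⟪B d, d⟫ := by
  have h : ∀ s : ℝ, 0 ≤ ⟪B d, d⟫ * (s * s) + 2 * ⟪B w, d⟫ * s + ⟪B w, w⟫ := fun s => by
    have := hp (w + s • d)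
    have e : ⟪B d, w⟫ = ⟪B w, d⟫ := by rw [hs, real_inner_comm]
    simp only [map_add, map_smul, inner_add_left, inner_add_right, inner_smul_left,
      inner_smul_right, RCLike.conj_to_real, e] at this
    linarith
  have := discrim_le_zero h
  rw [discrim] at this
  nlinarith

end QuadraticForm

section RankOne

variable {n : ℕ} {K : ConvexBody (E n)} {v z : E n} {A : E n →L[ℝ] E n}

theorem IsOfConstantWidth.inner_deriv_eq (hK : IsOfConstantWidth K 1) (hv : v ≠ 0)
    (hA : HasFDerivAt (supportPoint K) A v) (a : E n) : ⟪A a, v⟫ = 0 := by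
  rw [hK.deriv_symm hv hA, hK.deriv_self hv hA, inner_zero_right]

theorem IsOfConstantWidth.inner_deriv_nonneg (hK : IsOfConstantWidth K 1) (hv : v ≠ 0)
    (hA : HasFDerivAt (supportPoint K) A v) (a : E n) : 0 ≤ ⟪A a, a⟫ :=
  le_trans (by positivity) (hK.deriv_firm hv hA a)

theorem inner_normalizeDeriv (v a b : E n) :
    ⟪normalizeDeriv v a, b⟫ = ‖v‖⁻¹ * (⟪a, b⟫ - (‖v‖ ^ 2)⁻¹ * ⟪v, a⟫ * ⟪v, b⟫) := by
  rw [normalizeDeriv_apply, inner_smul_left, inner_sub_left, inner_smul_left]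
  simp

theorem inner_normalizeDeriv_self_le (v a : E n) :
    ⟪normalizeDeriv v a, a⟫ ≤ ‖v‖⁻¹ * ‖a‖ ^ 2 := by
  rw [inner_normalizeDeriv, real_inner_self_eq_norm_sq, mul_assoc, ← pow_two]
  have : 0 ≤ (‖v‖ ^ 2)⁻¹ * ⟪v, a⟫ ^ 2 := by positivity
  gcongr
  linarith

/-- `normalizeDeriv v` is the Hessian of the norm, so this is the upper curvature constraint. With b
the part of a orthogonal to v, `deriv_firm` and Cauchy–Schwarz give ‖v‖‖Aa‖ ≤ ‖b‖. -/
theorem IsOfConstantWidth.inner_deriv_le (hK : IsOfConstantWidth K 1) (hv : v ≠ 0)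
    (hA : HasFDerivAt (supportPoint K) A v) (a : E n) :
    ⟪A a, a⟫ ≤ ⟪normalizeDeriv v a, a⟫ := by
  have hn : 0 < ‖v‖ := norm_pos_iff.2 hv
  set b := a - ((‖v‖ ^ 2)⁻¹ * ⟪v, a⟫) • v with hb
  have h1 : ⟪A a, a⟫ = ⟪A a, b⟫ := by
    rw [hb, inner_sub_right, inner_smul_right, hK.inner_deriv_eq hv hA, mul_zero, sub_zero]
  have h2 : ⟪normalizeDeriv v a, a⟫ = ‖v‖⁻¹ * ‖b‖ ^ 2 := by
    rw [inner_normalizeDeriv, hb, norm_sub_sq_real, inner_smul_right, norm_smul, mul_pow,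
      Real.norm_eq_abs, sq_abs, real_inner_self_eq_norm_sq, real_inner_comm a v]
    field_simp
    ring
  have h3 := hK.deriv_firm hv hA a
  have h4 := real_inner_le_norm (A a) b
  rw [h2, le_inv_mul_iff₀ hn]
  rw [h1] at h3 ⊢
  have h5 : ‖v‖ * ‖A a‖ ≤ ‖b‖ := by
    by_contra hlt
    push Not at hlt
    have : 0 < ‖A a‖ := by
      by_contra h0
      have h0' : ‖A a‖ = 0 := le_antisymm (not_lt.1 h0) (norm_nonneg _)
      rw [h0', mul_zero] at hlt
      linarith [norm_nonneg b]
    nlinarith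
  calc ‖v‖ * ⟪A a, b⟫ ≤ ‖v‖ * (‖A a‖ * ‖b‖) := by gcongr
    _ = (‖v‖ * ‖A a‖) * ‖b‖ := by ring
    _ ≤ ‖b‖ * ‖b‖ := by gcongr
    _ = ‖b‖ ^ 2 := by ring

/-- The rank-one form spanned by `A z - ‖v‖ A² z` is dominated by `A`. -/
theorem IsOfConstantWidth.rankOne_le (hK : IsOfConstantWidth K 1) (hv : 1 ≤ ‖v‖)
    (hA : HasFDerivAt (supportPoint K) A v) (hz : ‖z‖ ≤ 1) (d : E n) :
    ⟪A z - ‖v‖ • A (A z), d⟫ ^ 2 ≤ ⟪A d, d⟫ := by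
  have hv0 : v ≠ 0 := norm_pos_iff.1 (by linarith)
  have hs := hK.deriv_symm hv0 hA
  have hp := hK.inner_deriv_nonneg hv0 hA
  -- The vector in question is Aw, so Cauchy–Schwarz for A leaves ⟨Aw, w⟩ ≤ 1 to be shown; firmness
  -- gives ‖w‖ ≤ 1.
  set w := z - ‖v‖ • A z with hw
  have e : A z - ‖v‖ • A (A z) = A w := by rw [hw, map_sub, map_smul]
  rw [e]
  refine (inner_sq_le_of_nonneg hs hp w d).trans ?_
  have h1 : ⟪A w, w⟫ ≤ 1 := by
    refine (hK.inner_deriv_le hv0 hA w).trans ((inner_normalizeDeriv_self_le v w).trans ?_)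
    have h2 : ‖w‖ ^ 2 ≤ 1 := by
      have h3 := hK.deriv_firm hv0 hA z
      have h4 := hp z
      rw [hw, norm_sub_sq_real, inner_smul_right, norm_smul, norm_norm, real_inner_comm]
      nlinarith [norm_nonneg z]
    calc ‖v‖⁻¹ * ‖w‖ ^ 2 ≤ 1 * 1 := by
          gcongr
          exact inv_le_one_of_one_le₀ hv
      _ = 1 := one_mul 1
  exact mul_le_of_le_one_left (hp d) h1

/-- The rank-one form spanned by `A z - ‖v‖ A² z` is dominated by the complement of `A`. -/
theorem IsOfConstantWidth.rankOne_le_compl (hK : IsOfConstantWidth K 1) (hv : 1 ≤ ‖v‖)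
    (hA : HasFDerivAt (supportPoint K) A v) (hz : ‖z‖ ≤ 1) (d : E n) :
    ⟪A z - ‖v‖ • A (A z), d⟫ ^ 2 ≤ ⟪normalizeDeriv v d, d⟫ - ⟪A d, d⟫ := by
  have hn : 0 < ‖v‖ := by linarith
  have hv0 : v ≠ 0 := norm_pos_iff.1 hn
  have hs := hK.deriv_symm hv0 hA
  set B := normalizeDeriv v - A with hB
  have hBs : ∀ a b, ⟪B a, b⟫ = ⟪a, B b⟫ := fun a b => by
    rw [hB, sub_apply, sub_apply, inner_sub_left, inner_sub_right, hs, inner_normalizeDeriv,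
      real_inner_comm (normalizeDeriv v b), inner_normalizeDeriv, real_inner_comm a b]
    ring
  have hBp : ∀ a, 0 ≤ ⟪B a, a⟫ := fun a => by
    rw [hB, sub_apply, inner_sub_left]
    linarith [hK.inner_deriv_le hv0 hA a]
  -- The same vector is Bw for the complementary form B, since w ⟂ v. Here ⟨Bw, w⟩ ≤ ‖v‖‖Az‖² ≤ ⟨Az,
  -- z⟩ ≤ 1.
  set w := ‖v‖ • A z with hw
  have e : A z - ‖v‖ • A (A z) = B w := by
    have h1 : ⟪v, w⟫ = 0 := by
      rw [hw, inner_smul_right, real_inner_comm, hK.inner_deriv_eq hv0 hA, mul_zero]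
    rw [hB, sub_apply, normalizeDeriv_apply, h1, mul_zero, zero_smul, sub_zero, hw, map_smul,
      smul_smul, inv_mul_cancel₀ hn.ne', one_smul]
  rw [e]
  refine (inner_sq_le_of_nonneg hBs hBp w d).trans ?_
  have h1 : ⟪B w, w⟫ ≤ 1 := by
    have h2 : ⟪B w, w⟫ ≤ ‖v‖⁻¹ * ‖w‖ ^ 2 := by
      rw [hB, sub_apply, inner_sub_left]
      linarith [inner_normalizeDeriv_self_le v w, hK.inner_deriv_nonneg hv0 hA w]
    have h3 : ‖v‖⁻¹ * ‖w‖ ^ 2 = ‖v‖ * ‖A z‖ ^ 2 := by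
      rw [hw, norm_smul, norm_norm]
      field_simp
    have h4 := hK.deriv_firm hv0 hA z
    have h5 : ⟪A z, z⟫ ≤ 1 := by
      refine (hK.inner_deriv_le hv0 hA z).trans ((inner_normalizeDeriv_self_le v z).trans ?_)
      calc ‖v‖⁻¹ * ‖z‖ ^ 2 ≤ 1 * 1 ^ 2 := by
            gcongr
            exact inv_le_one_of_one_le₀ hv
        _ = 1 := by norm_num
    linarith
  have h2 : ⟪normalizeDeriv v d, d⟫ - ⟪A d, d⟫ = ⟪B d, d⟫ := by
    rw [hB, sub_apply, inner_sub_left]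
  rw [h2]
  exact mul_le_of_le_one_left (hBp d) h1

end RankOne

end

end ConstWidth

namespace ConstWidth

noncomputable section

/-! ### Radii of curvature of planar sections -/

section Curvature

variable {n : ℕ}

/-- Squaring ‖(z - x) + ru‖ = r leaves a linear equation for r, so the infimum runs over a single
radius. -/
theorem circleRadius_eq {x u z : E n} (hu : ‖u‖ = 1) (hz : ⟪z - x, u⟫ < 0) :
    circleRadius x u z = ENNReal.ofReal (‖z - x‖ ^ 2 / (-2 * ⟪z - x, u⟫)) := by
  have key : ∀ r : ℝ≥0, dist z (x - (r : ℝ) • u) = r ↔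
      (r : ℝ) = ‖z - x‖ ^ 2 / (-2 * ⟪z - x, u⟫) := fun r => by
    have e : z - (x - (r : ℝ) • u) = (z - x) + (r : ℝ) • u := by abel
    have h2 := norm_add_sq_real (z - x) ((r : ℝ) • u)
    rw [norm_smul, hu, inner_smul_right, mul_one, Real.norm_eq_abs, sq_abs] at h2
    rw [dist_eq_norm, e, eq_div_iff (by linarith)]
    constructor
    · intro h
      rw [h] at h2
      linarith
    · intro h
      refine (sq_eq_sq₀ (norm_nonneg _) r.2).1 ?_
      show ‖z - x + (r : ℝ) • u‖ ^ 2 = (r : ℝ) ^ 2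
      linarith
  have hnn : 0 ≤ ‖z - x‖ ^ 2 / (-2 * ⟪z - x, u⟫) := by
    apply div_nonneg (sq_nonneg _)
    linarith
  unfold circleRadius
  apply le_antisymm
  · refine iInf₂_le_of_le (Real.toNNReal (‖z - x‖ ^ 2 / (-2 * ⟪z - x, u⟫))) ?_ le_rfl
    rw [key, Real.coe_toNNReal _ hnn]
  · refine le_iInf₂ fun r hr => ?_
    rw [key] at hr
    rw [← hr, ENNReal.ofReal_coe_nnreal]

theorem IsOfConstantWidth.continuousOn_supportFun {K : ConvexBody (E n)}
    (hK : IsOfConstantWidth K 1) : ContinuousOn (supportFun K) (Metric.sphere 0 1) :=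
  fun v hv => ((hK.hasFDerivAt_supportFun (norm_pos_iff.1 (by
    rw [mem_sphere_zero_iff_norm.1 hv]; exact one_pos))).continuousAt).continuousWithinAt

/-- By compactness of the sphere the strict inequalities hold with a uniform gap m, and the ball of
radius m around z lies in K. In contrapositive form this supplies outer normals at points outside
the interior. -/
theorem IsOfConstantWidth.mem_interior {K : ConvexBody (E n)} (hK : IsOfConstantWidth K 1)
    {z : E n} (h : ∀ v : E n, ‖v‖ = 1 → ⟪z, v⟫ < supportFun K v) : z ∈ interior (K : Set (E n)) := by
  obtain ⟨m, hm, hmv⟩ : ∃ m > 0, ∀ v : E n, ‖v‖ = 1 → ⟪z, v⟫ + m ≤ supportFun K v := by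
    rcases (Metric.sphere (0 : E n) 1).eq_empty_or_nonempty with he | hne
    · refine ⟨1, one_pos, fun v hv => ?_⟩
      have : v ∈ Metric.sphere (0 : E n) 1 := mem_sphere_zero_iff_norm.2 hv
      rw [he] at this
      exact this.elim
    · obtain ⟨v0, hv0, hmin⟩ := (isCompact_sphere (0 : E n) 1).exists_isMinOn hne
        (hK.continuousOn_supportFun.sub (by fun_prop : ContinuousOn (fun v : E n => ⟪z, v⟫) _))
      refine ⟨supportFun K v0 - ⟪z, v0⟫, sub_pos.2 (h v0 (mem_sphere_zero_iff_norm.1 hv0)),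
        fun v hv => ?_⟩
      have : supportFun K v0 - ⟪z, v0⟫ ≤ supportFun K v - ⟪z, v⟫ :=
        hmin (mem_sphere_zero_iff_norm.2 hv)
      linarith
  rw [mem_interior_iff_mem_nhds]
  refine Filter.mem_of_superset (Metric.ball_mem_nhds z hm) fun y hy => ?_
  obtain ⟨p, hp, hyp⟩ := infDist_le_of_inner_le (L := K) (x := y) le_rfl fun v hv => by
    have h1 : ⟪y - z, v⟫ ≤ m := by
      refine (real_inner_le_norm _ _).trans ?_
      rw [hv, mul_one]
      exact (mem_ball_iff_norm.1 hy).le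
    rw [inner_sub_left] at h1
    linarith [hmv v hv]
  rwa [dist_le_zero.1 hyp]

theorem not_mem_interior_of_mem_intrinsicFrontier {K : ConvexBody (E n)} {x u t z : E n}
    (hz : z ∈ intrinsicFrontier ℝ (planarSection K x u t)) : z ∉ interior (K : Set (E n)) := by
  intro hzi
  obtain ⟨y, hy, rfl⟩ := mem_intrinsicFrontier.1 hz
  refine hy.2 (mem_interior.2 ⟨Subtype.val ⁻¹' interior (K : Set (E n)),
    fun w hw => ⟨interior_subset (s := (K : Set (E n))) hw, ?_⟩,
    isOpen_interior.preimage continuous_subtype_val, hzi⟩)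
  exact affineSpan_le.2 (fun q hq => hq.2 : planarSection K x u t ⊆ sectionPlane x u t) w.2

theorem isClosed_planarSection (K : ConvexBody (E n)) (x u t : E n) :
    IsClosed (planarSection K x u t) :=
  K.isClosed.inter (AffineSubspace.closed_of_finiteDimensional _)

theorem mem_planarSection_iff {K : ConvexBody (E n)} {x u t z : E n} :
    z ∈ planarSection K x u t ↔ z ∈ K ∧ ∃ a b : ℝ, a • u + b • t = z - x := by
  simp only [planarSection, sectionPlane, mem_inter_iff, SetLike.mem_coe,
    AffineSubspace.mem_mk', vsub_eq_sub, Submodule.mem_span_pair]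

theorem mem_planarSection_coords {K : ConvexBody (E n)} {x u t z : E n} (hu : ‖u‖ = 1)
    (ht : ‖t‖ = 1) (hut : ⟪u, t⟫ = 0) (hz : z ∈ planarSection K x u t) :
    z - x = ⟪z - x, u⟫ • u + ⟪z - x, t⟫ • t ∧
      ‖z - x‖ ^ 2 = ⟪z - x, u⟫ ^ 2 + ⟪z - x, t⟫ ^ 2 := by
  obtain ⟨-, a, b, hab⟩ := mem_planarSection_iff.1 hz
  have ha : ⟪z - x, u⟫ = a := by
    rw [← hab, inner_add_left, inner_smul_left, inner_smul_left, real_inner_comm u t, hut]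
    simp [hu]
  have hb : ⟪z - x, t⟫ = b := by
    rw [← hab, inner_add_left, inner_smul_left, inner_smul_left, hut]
    simp [ht]
  rw [ha, hb]
  refine ⟨hab.symm, ?_⟩
  rw [← hab, norm_add_sq_real, inner_smul_left, inner_smul_right, hut, norm_smul, norm_smul, hu, ht]
  simp

variable {K : ConvexBody (E n)} {u t : E n}

/-- A hyperplane supporting K at the midpoint of the diameter from x to x - u would support K at
both ends, against uniqueness of support points. -/
theorem IsOfConstantWidth.midpoint_mem_interior (hK : IsOfConstantWidth K 1) (hu : ‖u‖ = 1) :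
    supportPoint K u - (1 / 2 : ℝ) • u ∈ interior (K : Set (E n)) := by
  have hu0 : u ≠ 0 := norm_pos_iff.1 (by rw [hu]; exact one_pos)
  have hx := supportPoint_mem K u
  have hx' := hK.sub_mem hx hu (inner_supportPoint K u)
  refine hK.mem_interior fun w hw => lt_of_not_ge fun hge => ?_
  have hw0 : w ≠ 0 := norm_pos_iff.1 (by rw [hw]; exact one_pos)
  have h1 := inner_le_supportFun hx w
  have h2 := inner_le_supportFun hx' w
  rw [inner_sub_left, inner_smul_left] at hge
  simp only [RCLike.conj_to_real] at hge
  have h2' := h2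
  rw [inner_sub_left] at h2'
  have e1 := hK.eq_supportPoint hw0 hx (le_antisymm h1 (by linarith))
  have e2 := hK.eq_supportPoint hw0 hx' (le_antisymm h2 (by rw [inner_sub_left]; linarith))
  rw [← e1] at e2
  exact hu0 (by simpa using e2)

/-- Needed to read the lower and upper radii off a limit: along the trivial filter every limit
statement holds, yet the liminf and limsup carry no information. -/
theorem IsOfConstantWidth.boundaryApproach_neBot (hK : IsOfConstantWidth K 1) (hu : ‖u‖ = 1)
    (ht : ‖t‖ = 1) (hut : ⟪u, t⟫ = 0) :
    (boundaryApproach (planarSection K (supportPoint K u) u t) (supportPoint K u) t).NeBot := by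
  set x := supportPoint K u with hxdef
  have hx : x ∈ K := supportPoint_mem K u
  have hxu : ⟪x, u⟫ = supportFun K u := inner_supportPoint K u
  have hxu' := hK.sub_mem hx hu hxu
  obtain ⟨δ0, hδ0, hball⟩ := Metric.mem_nhds_iff.1
    (mem_interior_iff_mem_nhds.1 (hK.midpoint_mem_interior hu))
  set δ := δ0 / 2 with hδ
  have hδp : 0 < δ := half_pos hδ0
  have hq : x - (1 / 2 : ℝ) • u + δ • t ∈ K := by
    apply hball
    rw [mem_ball_iff_norm, add_sub_cancel_left, norm_smul, ht, mul_one, Real.norm_eq_abs,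
      abs_of_pos hδp]
    exact half_lt_self hδ0
  rw [boundaryApproach, ← mem_closure_iff_nhdsWithin_neBot, Metric.mem_closure_iff]
  intro ε hε
  obtain ⟨σ, hσ, hσ1, hσε⟩ : ∃ σ : ℝ, 0 < σ ∧ σ ≤ 1 ∧ σ * (δ + 1) < ε := by
    refine ⟨min 1 (ε / (2 * (δ + 1))), by positivity, min_le_left _ _, ?_⟩
    calc _ ≤ ε / (2 * (δ + 1)) * (δ + 1) := by gcongr; exact min_le_right _ _
      _ = ε / 2 := by field_simp
      _ < ε := half_lt_self hε
  -- The witness is the highest point, with respect to u, of K on the line parallel to u at offset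
  -- σδ in direction t.
  let Lσ : Set (E n) := range fun l : ℝ => x + (σ * δ) • t + l • u
  have hLc : IsClosed Lσ := by
    have : Lσ = AffineSubspace.mk' (x + (σ * δ) • t) (Submodule.span ℝ {u}) := by
      ext w
      simp only [Lσ, mem_range, SetLike.mem_coe, AffineSubspace.mem_mk', vsub_eq_sub,
        Submodule.mem_span_singleton]
      constructor
      · rintro ⟨l, rfl⟩; exact ⟨l, by abel⟩
      · rintro ⟨l, hl⟩; exact ⟨l, by rw [hl]; abel⟩
    rw [this]
    exact AffineSubspace.closed_of_finiteDimensional _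
  have hne : ((K : Set (E n)) ∩ Lσ).Nonempty := by
    refine ⟨x + σ • ((x - (1 / 2 : ℝ) • u + δ • t) - x),
      K.convex.add_smul_sub_mem hx hq ⟨hσ.le, hσ1⟩, -(σ / 2), ?_⟩
    simp only [smul_sub, smul_add, smul_smul]
    rw [neg_smul]
    have : σ * (1 / 2) = σ / 2 := by ring
    rw [this]
    abel
  obtain ⟨z, ⟨hzK, l, hl⟩, hmax⟩ := (K.isCompact.inter_right hLc).exists_isMaxOn hne
    (by fun_prop : ContinuousOn (fun w : E n => ⟪w, u⟫) _)
  simp only at hl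
  have hzx : z - x = l • u + (σ * δ) • t := by rw [← hl]; abel
  have hzC : z ∈ planarSection K x u t := mem_planarSection_iff.2 ⟨hzK, l, σ * δ, hzx.symm⟩
  have htu : ⟪t, u⟫ = 0 := by rw [real_inner_comm, hut]
  have hlz : ⟪z - x, u⟫ = l := by
    rw [hzx, inner_add_left, inner_smul_left, inner_smul_left, htu]; simp [hu]
  have hmz : ⟪z - x, t⟫ = σ * δ := by
    rw [hzx, inner_add_left, inner_smul_left, inner_smul_left, hut]; simp [ht]
  have hl0 : l ≤ 0 := by
    rw [← hlz, inner_sub_left, hxu]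
    linarith [inner_le_supportFun hzK u]
  -- The segment from x to the interior-side point x - u/2 + δt meets the line at height -σ/2, so
  -- the highest point lies no lower and tends to x with σ.
  have hl1 : -(σ / 2) ≤ l := by
    obtain ⟨w, hwK, l', hl'⟩ := hne
    have hw2 : x + σ • ((x - (1 / 2 : ℝ) • u + δ • t) - x) ∈ (K : Set (E n)) ∩ Lσ := by
      refine ⟨K.convex.add_smul_sub_mem hx hq ⟨hσ.le, hσ1⟩, -(σ / 2), ?_⟩
      simp only [smul_sub, smul_add, smul_smul]
      rw [neg_smul]
      have : σ * (1 / 2) = σ / 2 := by ring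
      rw [this]
      abel
    have h1 : ⟪x + σ • ((x - (1 / 2 : ℝ) • u + δ • t) - x), u⟫ ≤ ⟪z, u⟫ := hmax hw2
    have h2 : ⟪z, u⟫ = ⟪x, u⟫ + l := by rw [← hlz, inner_sub_left]; ring
    have e : x - (1 / 2 : ℝ) • u + δ • t - x = δ • t - (1 / 2 : ℝ) • u := by abel
    rw [h2, e, inner_add_left, inner_smul_left, inner_sub_left, inner_smul_left, inner_smul_left,
      htu, real_inner_self_eq_norm_sq, hu] at h1
    simp only [RCLike.conj_to_real] at h1
    linarith
  refine ⟨z, ⟨?_, ?_⟩, ?_⟩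
  · have hcl : z ∈ intrinsicInterior ℝ (planarSection K x u t) ∪
        intrinsicFrontier ℝ (planarSection K x u t) := by
      rw [intrinsicInterior_union_intrinsicFrontier]
      exact subset_intrinsicClosure hzC
    rcases hcl with hi | hf
    · exfalso
      obtain ⟨y, hy, hyz⟩ := mem_intrinsicInterior.1 hi
      have hxC : x ∈ planarSection K x u t := mem_planarSection_iff.2 ⟨hx, 0, 0, by simp⟩
      have hxC' : x - u ∈ planarSection K x u t :=
        mem_planarSection_iff.2 ⟨hxu', -1, 0, by simp⟩
      -- Both x and x - u lie in the section, so its affine span is invariant under translation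
      -- along u. A relatively interior z could be pushed upwards, against maximality.
      have hmem : ∀ s : ℝ, z + s • u ∈ affineSpan ℝ (planarSection K x u t) := fun s => by
        have := AffineSubspace.smul_vsub_vadd_mem (affineSpan ℝ (planarSection K x u t)) s
          (subset_affineSpan ℝ _ hxC) (subset_affineSpan ℝ _ hxC') (subset_affineSpan ℝ _ hzC)
        simpa [add_comm] using this
      let γ : ℝ → affineSpan ℝ (planarSection K x u t) := fun s => ⟨z + s • u, hmem s⟩
      have hγ : Continuous γ := by
        apply Continuous.subtype_mk
        fun_prop
      have hγ0 : γ 0 = y := Subtype.ext (by simp [γ, hyz])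
      have hev : ∀ᶠ s in 𝓝 (0 : ℝ), γ s ∈ interior (Subtype.val ⁻¹' planarSection K x u t) := by
        apply hγ.continuousAt.eventually
        rw [hγ0]
        exact isOpen_interior.mem_nhds hy
      obtain ⟨s, hs, hspos⟩ := ((hev.filter_mono nhdsWithin_le_nhds).and
        (self_mem_nhdsWithin : Ioi (0 : ℝ) ∈ 𝓝[>] 0)).exists
      have hsC : γ s ∈ Subtype.val ⁻¹' planarSection K x u t := interior_subset hs
      have h1 : ⟪z + s • u, u⟫ ≤ ⟪z, u⟫ := hmax ⟨hsC.1, l + s, by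
        simp only
        rw [← hl, add_smul]
        abel⟩
      rw [inner_add_left, inner_smul_left, real_inner_self_eq_norm_sq, hu] at h1
      simp only [RCLike.conj_to_real] at h1
      have : 0 < s := hspos
      linarith
    · exact hf
  · show 0 < ⟪z - x, t⟫
    rw [hmz]
    positivity
  · rw [dist_comm, dist_eq_norm, hzx]
    refine (norm_add_le _ _).trans_lt ?_
    rw [norm_smul, norm_smul, hu, ht, mul_one, mul_one, Real.norm_eq_abs, Real.norm_eq_abs,
      abs_of_nonpos hl0, abs_of_pos (by positivity)]
    nlinarith

theorem IsOfConstantWidth.supportSet_eq (hK : IsOfConstantWidth K 1) (hu : ‖u‖ = 1) :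
    supportSet K u = {supportPoint K u} := by
  have hu0 : u ≠ 0 := norm_pos_iff.1 (by rw [hu]; exact one_pos)
  ext y
  constructor
  · rintro ⟨hy, hyu⟩
    exact hK.eq_supportPoint hu0 hy hyu
  · rintro rfl
    exact ⟨supportPoint_mem K u, inner_supportPoint K u⟩

theorem IsOfConstantWidth.hasRadiusOfCurvature (hK : IsOfConstantWidth K 1) (hu : ‖u‖ = 1)
    (ht : ‖t‖ = 1) (hut : ⟪u, t⟫ = 0) {ρ : ℝ≥0∞}
    (h : Tendsto (circleRadius (supportPoint K u) u)
      (boundaryApproach (planarSection K (supportPoint K u) u t) (supportPoint K u) t) (𝓝 ρ)) :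
    HasRadiusOfCurvature K u t ρ := by
  have := hK.boundaryApproach_neBot hu ht hut
  exact ⟨supportPoint K u, hK.supportSet_eq hu, h.liminf_eq, h.limsup_eq⟩

theorem mem_of_boundaryApproach {x : E n} :
    ∀ᶠ z in boundaryApproach (planarSection K x u t) x t, z ∈ planarSection K x u t ∧
      z ∉ interior (K : Set (E n)) ∧ 0 < ⟪z - x, t⟫ := by
  filter_upwards [self_mem_nhdsWithin] with z hz
  exact ⟨intrinsicFrontier_subset (isClosed_planarSection K x u t) hz.1,
    not_mem_interior_of_mem_intrinsicFrontier hz.1, hz.2⟩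

theorem norm_lt_of_boundaryApproach {C : Set (E n)} {x : E n} {c : ℝ} (hc : 0 < c) :
    ∀ᶠ z in boundaryApproach C x t, ‖z - x‖ < c := by
  have : ∀ᶠ z in 𝓝 x, ‖z - x‖ < c := by
    filter_upwards [Metric.ball_mem_nhds x hc] with z hz
    exact mem_ball_iff_norm.1 hz
  exact this.filter_mono nhdsWithin_le_nhds

theorem IsOfConstantWidth.inner_sub_neg (hK : IsOfConstantWidth K 1) (hu : ‖u‖ = 1) {z : E n}
    (hz : z ∈ K) (hne : z ≠ supportPoint K u) : ⟪z - supportPoint K u, u⟫ < 0 := by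
  have h := hK.norm_sq_le (supportPoint_mem K u) hu (inner_supportPoint K u) hz
  have : 0 < ‖z - supportPoint K u‖ := norm_pos_iff.2 (sub_ne_zero.2 hne)
  nlinarith

/-- Directions in the kernel of the derivative of the support point map have radius of
curvature zero. -/
theorem IsOfConstantWidth.hasRadiusOfCurvature_zero (hK : IsOfConstantWidth K 1) (hu : ‖u‖ = 1)
    {A : E n →L[ℝ] E n} (hA : HasFDerivAt (supportPoint K) A u) (ht : ‖t‖ = 1)
    (hut : ⟪u, t⟫ = 0) (hAt : A t = 0) : HasRadiusOfCurvature K u t 0 := by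
  have hu0 : u ≠ 0 := norm_pos_iff.1 (by rw [hu]; exact one_pos)
  refine hK.hasRadiusOfCurvature hu ht hut ?_
  set x := supportPoint K u with hxdef
  have hx : x ∈ K := supportPoint_mem K u
  have hxu : ⟪x, u⟫ = supportFun K u := inner_supportPoint K u
  rw [ENNReal.tendsto_nhds_zero]
  intro ε hε
  obtain ⟨η, hη, hηε⟩ : ∃ η : ℝ, 0 < η ∧ ENNReal.ofReal (3 * η) ≤ ε := by
    by_cases htop : ε = ⊤
    · exact ⟨1, one_pos, by rw [htop]; exact le_top⟩
    · refine ⟨ε.toReal / 3, div_pos (ENNReal.toReal_pos hε.ne' htop) three_pos, ?_⟩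
      rw [mul_div_cancel₀ _ (three_ne_zero), ENNReal.ofReal_toReal htop]
  obtain ⟨s0, hs0, htay⟩ := taylor_of_gradient
    (by filter_upwards [isOpen_ne.mem_nhds hu0] with y hy; exact hK.hasFDerivAt_supportFun hy)
    hA (hK.deriv_symm hu0 hA) hη
  filter_upwards [mem_of_boundaryApproach, norm_lt_of_boundaryApproach (c := 2 * η * s0)
    (by positivity), norm_lt_of_boundaryApproach hη] with z hz hz1 hz2
  obtain ⟨hzC, -, hμ⟩ := hz
  have hzK : z ∈ K := hzC.1
  have hne : z ≠ x := fun h => by simp [h] at hμ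
  have hl := hK.inner_sub_neg hu hzK hne
  rw [circleRadius_eq hu hl]
  refine le_trans (ENNReal.ofReal_le_ofReal ?_) hηε
  have hsq := (mem_planarSection_coords hu ht hut hzC).2
  have hμle : ⟪z - x, t⟫ ≤ ‖z - x‖ := by
    simpa [ht] using real_inner_le_norm (z - x) t
  have hlle : -⟪z - x, u⟫ ≤ ‖z - x‖ := by
    have := real_inner_le_norm (z - x) (-u)
    rwa [inner_neg_right, norm_neg, hu, mul_one] at this
  set μ := ⟪z - x, t⟫ with hμdef
  set l := ⟪z - x, u⟫ with hldef
  -- The support inequality in direction u + st reads l + sμ ≤ ηs². This s gives μ² ≤ 4η(-l), so the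
  -- radius (l² + μ²)/(-2l) is at most 2η + |l|/2 ≤ 3η.
  set s := μ / (2 * η) with hs
  have hspos : 0 < s := by positivity
  have hss : s < s0 := by
    rw [hs, div_lt_iff₀ (by positivity)]
    linarith
  have h1 := (htay (u + s • t) (by
    rw [mem_ball_iff_norm, add_sub_cancel_left, norm_smul, ht, mul_one, Real.norm_eq_abs,
      abs_of_pos hspos]
    exact hss)).2
  rw [add_sub_cancel_left, map_smul, hAt, smul_zero, inner_zero_left, norm_smul, ht, mul_one,
    Real.norm_eq_abs, sq_abs, inner_smul_right] at h1
  have h2 := inner_le_supportFun hzK (u + s • t)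
  have h3 : ⟪z, u + s • t⟫ = l + s * μ + ⟪x, u⟫ + s * ⟪x, t⟫ := by
    rw [hldef, hμdef, inner_add_right, inner_smul_right, inner_sub_left, inner_sub_left]
    ring
  have h4 := (abs_le.1 h1).2
  have h5 : l + s * μ ≤ η * s ^ 2 := by rw [h3] at h2; linarith
  have hμs : μ = 2 * η * s := by rw [hs]; field_simp
  have h6 : μ ^ 2 ≤ 4 * η * (-l) := by
    rw [hμs] at h5 ⊢
    nlinarith
  rw [div_le_iff₀ (by linarith), hsq]
  nlinarith

/-- If the derivative of the support point map is the identity on `u^⊥`, then the radius of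
curvature is one in every direction. -/
theorem IsOfConstantWidth.hasRadiusOfCurvature_one (hK : IsOfConstantWidth K 1) (hu : ‖u‖ = 1)
    {A : E n →L[ℝ] E n} (hA : HasFDerivAt (supportPoint K) A u)
    (hAw : ∀ w, ⟪u, w⟫ = 0 → A w = w) (ht : ‖t‖ = 1)
    (hut : ⟪u, t⟫ = 0) : HasRadiusOfCurvature K u t 1 := by
  have hu0 : u ≠ 0 := norm_pos_iff.1 (by rw [hu]; exact one_pos)
  refine hK.hasRadiusOfCurvature hu ht hut ?_
  set x := supportPoint K u with hxdef
  have hx : x ∈ K := supportPoint_mem K u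
  have hxu : ⟪x, u⟫ = supportFun K u := inner_supportPoint K u
  -- No other unit normal exists at x: along u + sv the support point would stay x, so Av = 0. As A
  -- is the identity on u^⊥ this forces v = ±u, and -u is excluded by the width.
  have hnormal : ∀ v : E n, ‖v‖ = 1 → v ≠ u → ⟪x, v⟫ < supportFun K v := by
    intro v hv hvu
    refine lt_of_le_of_ne (inner_le_supportFun hx v) fun heq => ?_
    have hvn : v ≠ -u := by
      rintro rfl
      have := hK u hu
      rw [inner_neg_right] at heq
      linarith
    have hconst : ∀ s : ℝ, 0 < s → u + s • v ≠ 0 → supportPoint K (u + s • v) = x := by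
      intro s hs hne
      refine (hK.eq_supportPoint hne hx (le_antisymm (inner_le_supportFun hx _) ?_)).symm
      refine (supportFun_add_le K _ _).trans_eq ?_
      rw [supportFun_smul K hs.le, inner_add_right, inner_smul_right, hxu, heq]
    have hA0 : A v = 0 := by
      refine tendsto_nhds_unique (tendsto_slope_line hA v) ?_
      refine tendsto_const_nhds.congr' ?_
      have hlt : ∀ᶠ s : ℝ in 𝓝[>] 0, s < 1 :=
        (eventually_lt_nhds one_pos).filter_mono nhdsWithin_le_nhds
      filter_upwards [self_mem_nhdsWithin, hlt] with s hs hs1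
      have hs : 0 < s := hs
      rw [hconst s hs, ← hxdef, sub_self, smul_zero]
      intro h0
      have : ‖s • v‖ = ‖u‖ := by rw [eq_neg_of_add_eq_zero_right h0, norm_neg]
      rw [norm_smul, hv, hu, Real.norm_eq_abs, abs_of_pos hs] at this
      linarith
    have hw : ⟪u, v - ⟪u, v⟫ • u⟫ = 0 := by
      rw [inner_sub_right, inner_smul_right, real_inner_self_eq_norm_sq, hu]
      ring
    have h2 := hAw _ hw
    rw [map_sub, map_smul, hK.deriv_self hu0 hA, hA0, smul_zero, sub_zero] at h2
    have h3 : v = ⟪u, v⟫ • u := sub_eq_zero.1 h2.symm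
    have h4 : |⟪u, v⟫| = 1 := by
      have := congrArg norm h3
      rw [norm_smul, hu, hv, mul_one, Real.norm_eq_abs] at this
      exact this.symm
    rcases eq_or_eq_neg_of_abs_eq h4 with h5 | h5
    · rw [h5, one_smul] at h3
      exact hvu h3
    · rw [h5, neg_one_smul] at h3
      exact hvn h3
  have hupper : ∀ᶠ z in boundaryApproach (planarSection K x u t) x t,
      circleRadius x u z ≤ 1 := by
    filter_upwards [mem_of_boundaryApproach] with z hz
    have hne : z ≠ x := fun h => by simp [h] at hz
    have hl := hK.inner_sub_neg hu hz.1.1 hne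
    rw [circleRadius_eq hu hl, ENNReal.ofReal_le_one, div_le_one (by linarith)]
    exact hK.norm_sq_le hx hu hxu hz.1.1
  have hlower : ∀ η : ℝ, 0 < η → η < 1 / 2 →
      ∀ᶠ z in boundaryApproach (planarSection K x u t) x t,
        ENNReal.ofReal (1 - 2 * η) ≤ circleRadius x u z := by
    intro η hη hη2
    obtain ⟨s0, hs0, htay⟩ := taylor_of_gradient
      (by filter_upwards [isOpen_ne.mem_nhds hu0] with y hy; exact hK.hasFDerivAt_supportFun hy)
      hA (hK.deriv_symm hu0 hA) hη
    obtain ⟨τ, hτ, hτv⟩ : ∃ τ > 0, ∀ v ∈ Metric.ball u τ, 0 < ⟪v, u⟫ ∧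
        ⟪v, u⟫⁻¹ • v ∈ Metric.ball u s0 := by
      have huu : ⟪u, u⟫ = 1 := by rw [real_inner_self_eq_norm_sq, hu]; norm_num
      have hc1 : ContinuousAt (fun v : E n => ⟪v, u⟫) u := by fun_prop
      have hc2 : ContinuousAt (fun v : E n => ⟪v, u⟫⁻¹ • v) u :=
        (hc1.inv₀ (by rw [huu]; exact one_ne_zero)).smul continuousAt_id
      have e1 : ∀ᶠ v in 𝓝 u, 0 < ⟪v, u⟫ :=
        hc1.eventually (lt_mem_nhds (by simp only [huu]; exact one_pos))
      have e2 : ∀ᶠ v in 𝓝 u, ⟪v, u⟫⁻¹ • v ∈ Metric.ball u s0 := by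
        refine hc2.eventually (p := fun w => w ∈ Metric.ball u s0) ?_
        simp only [huu, inv_one, one_smul]
        exact Metric.ball_mem_nhds u hs0
      exact Metric.eventually_nhds_iff_ball.1 (e1.and e2)
    -- Away from u the support inequality at x has a uniform gap, so a boundary point within m of x
    -- only has outer normals close to u.
    obtain ⟨m, hm, hmv⟩ : ∃ m > 0, ∀ v : E n, ‖v‖ = 1 → v ∉ Metric.ball u τ →
        ⟪x, v⟫ + m ≤ supportFun K v := by
      have hcomp : IsCompact (Metric.sphere (0 : E n) 1 ∩ (Metric.ball u τ)ᶜ) :=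
        (isCompact_sphere 0 1).inter_right Metric.isOpen_ball.isClosed_compl
      rcases (Metric.sphere (0 : E n) 1 ∩ (Metric.ball u τ)ᶜ).eq_empty_or_nonempty with he | hne
      · refine ⟨1, one_pos, fun v hv hvb => ?_⟩
        have : v ∈ Metric.sphere (0 : E n) 1 ∩ (Metric.ball u τ)ᶜ :=
          ⟨mem_sphere_zero_iff_norm.2 hv, hvb⟩
        rw [he] at this
        exact this.elim
      · obtain ⟨v0, hv0, hmin⟩ := hcomp.exists_isMinOn hne
          ((hK.continuousOn_supportFun.mono inter_subset_left).sub
            (by fun_prop : ContinuousOn (fun v : E n => ⟪x, v⟫) _))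
        refine ⟨supportFun K v0 - ⟪x, v0⟫, sub_pos.2 (hnormal v0
          (mem_sphere_zero_iff_norm.1 hv0.1) ?_), fun v hv hvb => ?_⟩
        · rintro rfl
          exact hv0.2 (Metric.mem_ball_self hτ)
        have : supportFun K v0 - ⟪x, v0⟫ ≤ supportFun K v - ⟪x, v⟫ :=
          hmin ⟨mem_sphere_zero_iff_norm.2 hv, hvb⟩
        linarith
    filter_upwards [mem_of_boundaryApproach, norm_lt_of_boundaryApproach hm] with z hz hzm
    obtain ⟨hzC, hzi, hμ⟩ := hz
    have hzK : z ∈ K := hzC.1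
    have hne : z ≠ x := fun h => by simp [h] at hμ
    have hl := hK.inner_sub_neg hu hzK hne
    obtain ⟨v, hv, hzv⟩ : ∃ v : E n, ‖v‖ = 1 ∧ supportFun K v ≤ ⟪z, v⟫ := by
      by_contra hcon
      push Not at hcon
      exact hzi (hK.mem_interior hcon)
    have hvb : v ∈ Metric.ball u τ := by
      by_contra hvb
      have h1 := hmv v hv hvb
      have h2 := real_inner_le_norm (z - x) v
      rw [hv, mul_one, inner_sub_left] at h2
      linarith
    obtain ⟨hc, hVb⟩ := hτv v hvb
    set c := ⟪v, u⟫ with hcdef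
    -- The normal at z is rescaled to u + w with w ⟂ u, where the Taylor form of h is exactly
    -- ‖w‖²/2. The normal v need not lie in the section plane.
    set w := c⁻¹ • v - u with hw
    have hVw : c⁻¹ • v = u + w := by rw [hw]; abel
    have huw : ⟪u, w⟫ = 0 := by
      rw [hw, inner_sub_right, inner_smul_right, real_inner_comm, ← hcdef,
        real_inner_self_eq_norm_sq, hu, inv_mul_cancel₀ hc.ne']
      norm_num
    have hzV : supportFun K (u + w) ≤ ⟪z, u + w⟫ := by
      rw [← hVw, supportFun_smul K (by positivity), inner_smul_right]
      exact mul_le_mul_of_nonneg_left hzv (by positivity)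
    rw [hVw] at hVb
    have h1 := (abs_le.1 (htay (u + w) hVb).2).1
    rw [add_sub_cancel_left, hAw w huw, real_inner_self_eq_norm_sq] at h1
    have h3 : ⟪z, u + w⟫ = ⟪z - x, u⟫ + ⟪z - x, w⟫ + ⟪x, u⟫ + ⟪x, w⟫ := by
      rw [inner_add_right, inner_sub_left, inner_sub_left]
      ring
    have h4 := real_inner_le_norm (z - x) w
    rw [circleRadius_eq hu hl]
    apply ENNReal.ofReal_le_ofReal
    rw [le_div_iff₀ (by linarith)]
    have h5 : (1 / 2 - η) * ‖w‖ ^ 2 - ⟪z - x, u⟫ ≤ ‖z - x‖ * ‖w‖ + 0 := by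
      rw [h3] at hzV
      linarith
    have h6 : (1 - 2 * η) * ((1 / 2 - η) * ‖w‖ ^ 2 - ⟪z - x, u⟫) ≤
        (1 - 2 * η) * (‖z - x‖ * ‖w‖ + 0) := mul_le_mul_of_nonneg_left h5 (by linarith)
    -- By the arithmetic-geometric mean inequality the ‖w‖² terms cancel, leaving (1 - 2η)·(-2⟨z -
    -- x, u⟩) ≤ ‖z - x‖².
    nlinarith [sq_nonneg (‖z - x‖ - (1 - 2 * η) * ‖w‖)]
  refine tendsto_order.2 ⟨fun a ha => ?_, fun b hb => hupper.mono fun z hz => hz.trans_lt hb⟩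
  have hat : a ≠ ⊤ := ne_top_of_lt ha
  have ha1 : a.toReal < 1 := by
    rw [← ENNReal.toReal_one]
    exact (ENNReal.toReal_lt_toReal hat ENNReal.one_ne_top).2 ha
  have ha0 : 0 ≤ a.toReal := ENNReal.toReal_nonneg
  filter_upwards [hlower ((1 - a.toReal) / 4) (by linarith) (by linarith)] with z hz
  refine lt_of_lt_of_le ?_ hz
  rw [ENNReal.lt_ofReal_iff_toReal_lt hat]
  linarith

/-- The curvature alternative at a normal vector where the support point map is differentiable and
its derivative attains the bound of firm nonexpansiveness. -/
theorem IsOfConstantWidth.curvature_alternative (hK : IsOfConstantWidth K 1) (hu : ‖u‖ = 1)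
    {A : E n →L[ℝ] E n} (hA : HasFDerivAt (supportPoint K) A u)
    (hq : ∀ z, ⟪A z, z⟫ = ‖A z‖ ^ 2) :
    (∀ t : E n, ‖t‖ = 1 → ⟪u, t⟫ = 0 → HasRadiusOfCurvature K u t 1) ∨
      ∃ t : E n, ‖t‖ = 1 ∧ ⟪u, t⟫ = 0 ∧ HasRadiusOfCurvature K u t 0 := by
  have hu0 : u ≠ 0 := norm_pos_iff.1 (by rw [hu]; exact one_pos)
  have hs := hK.deriv_symm hu0 hA
  -- Polarization of the quadratic identity, with symmetry, gives A² = A.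
  have hidem : ∀ z, A (A z) = A z := by
    intro z
    have hpol : ∀ a b, ⟪A a, b⟫ = ⟪A a, A b⟫ := fun a b => by
      have h1 := hq (a + b)
      have h2 := hq a
      have h3 := hq b
      have e : ⟪A b, a⟫ = ⟪A a, b⟫ := by rw [hs, real_inner_comm]
      rw [map_add, norm_add_sq_real, inner_add_left, inner_add_right, inner_add_right, e] at h1
      linarith
    have : ∀ b, ⟪A (A z) - A z, b⟫ = 0 := fun b => by
      rw [inner_sub_left, hs, hpol z b, sub_self]
    exact sub_eq_zero.1 (inner_self_eq_zero.1 (this (A (A z) - A z)))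
  by_cases h : ∀ w, ⟪u, w⟫ = 0 → A w = w
  · exact Or.inl fun t ht hut => hK.hasRadiusOfCurvature_one hu hA h ht hut
  · push Not at h
    obtain ⟨w, huw, hAw⟩ := h
    -- For an idempotent A the vector w - Aw lies in the kernel; it is also orthogonal to u.
    have hne : w - A w ≠ 0 := sub_ne_zero.2 (Ne.symm hAw)
    have h1 : ⟪u, w - A w⟫ = 0 := by
      rw [inner_sub_right, huw, real_inner_comm, hK.inner_deriv_eq hu0 hA, sub_zero]
    refine Or.inr ⟨‖w - A w‖⁻¹ • (w - A w), norm_inv_smul_self hne, by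
      rw [inner_smul_right, h1, mul_zero], hK.hasRadiusOfCurvature_zero hu hA
      (norm_inv_smul_self hne) (by rw [inner_smul_right, h1, mul_zero]) ?_⟩
    rw [map_smul, map_sub, hidem, sub_self, smul_zero]

end Curvature

end

end ConstWidth

namespace ConstWidth

noncomputable section

/-! ### Bodies with a ball as a summand -/

section Rounded

variable {n : ℕ}

/-- `h(K, ·) - ε ‖·‖` is sublinear, that is, the ball of radius `ε` is a summand of `K`. -/
def IsRounded (K : ConvexBody (E n)) (ε : ℝ) : Prop :=
  ∀ x y : E n, supportFun K (x + y) - ε * ‖x + y‖ ≤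
    (supportFun K x - ε * ‖x‖) + (supportFun K y - ε * ‖y‖)

theorem IsRounded.mono {K : ConvexBody (E n)} {ε ε' : ℝ} (h : IsRounded K ε) (hε : ε' ≤ ε) :
    IsRounded K ε' := fun x y => by
  have h1 := h x y
  have h2 := norm_add_le x y
  nlinarith

theorem convexOn_of_sublinear {k : E n → ℝ} {s : Set (E n)} (hs : Convex ℝ s)
    (hcone : ∀ c : ℝ, 0 ≤ c → ∀ x ∈ s, c • x ∈ s)
    (hk : ∀ c : ℝ, 0 ≤ c → ∀ x, k (c • x) = c * k x)
    (ha : ∀ x ∈ s, ∀ y ∈ s, k (x + y) ≤ k x + k y) : ConvexOn ℝ s k := by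
  refine ⟨hs, fun a ha' b hb p q hp hq _ => ?_⟩
  refine (ha _ (hcone p hp a ha') _ (hcone q hq b hb)).trans_eq ?_
  rw [hk p hp, hk q hq, smul_eq_mul, smul_eq_mul]

theorem hasFDerivAt_norm_of_ne {v : E n} (hv : v ≠ 0) :
    HasFDerivAt (fun x : E n => ‖x‖) (innerSL ℝ (‖v‖⁻¹ • v)) v := by
  have hn : ‖v‖ ≠ 0 := norm_ne_zero_iff.2 hv
  have h1 : HasFDerivAt (fun w : E n => ‖w‖ ^ 2) (2 • innerSL ℝ v) v :=
    (hasStrictFDerivAt_norm_sq v).hasFDerivAt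
  have h2 := h1.sqrt (by positivity)
  have h3 : HasFDerivAt (fun w : E n => ‖w‖)
      ((1 / (2 * √(‖v‖ ^ 2))) • (2 • innerSL ℝ v)) v := by
    simpa [Real.sqrt_sq (norm_nonneg _)] using h2
  refine h3.congr_fderiv ?_
  ext z
  simp only [smul_apply, innerSL_apply_apply, Real.sqrt_sq (norm_nonneg v), smul_eq_mul,
    nsmul_eq_mul, inner_smul_left, RCLike.conj_to_real]
  field_simp
  simp

theorem hasFDerivAt_sub_const_mul_norm {K : ConvexBody (E n)} (hK : IsOfConstantWidth K 1)
    (ε : ℝ) {v : E n} (hv : v ≠ 0) :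
    HasFDerivAt (fun x => supportFun K x - ε * ‖x‖)
      (innerSL ℝ (supportPoint K v - ε • ‖v‖⁻¹ • v)) v := by
  rw [map_sub]
  refine (hK.hasFDerivAt_supportFun hv).sub ?_
  refine ((hasFDerivAt_norm_of_ne hv).const_mul ε).congr_fderiv ?_
  ext z
  simp

theorem IsRounded.le_inner {K : ConvexBody (E n)} {ε : ℝ} (h : IsRounded K ε)
    (hK : IsOfConstantWidth K 1) {v w : E n} (hv : v ≠ 0) (hw : w ≠ 0) :
    ε * ⟪‖v‖⁻¹ • v - ‖w‖⁻¹ • w, v - w⟫ ≤ ⟪supportPoint K v - supportPoint K w, v - w⟫ := by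
  have hc : ConvexOn ℝ univ fun x => supportFun K x - ε * ‖x‖ :=
    convexOn_of_sublinear convex_univ (fun _ _ _ _ => mem_univ _)
      (fun c hc x => by
        rw [supportFun_smul K hc, norm_smul, Real.norm_eq_abs, abs_of_nonneg hc]
        ring) (fun x _ y _ => h x y)
  have := ConvexOn.inner_gradient_sub_nonneg hc (mem_univ v) (mem_univ w)
    (hasFDerivAt_sub_const_mul_norm hK ε hv) (hasFDerivAt_sub_const_mul_norm hK ε hw)
  have e : supportPoint K v - ε • ‖v‖⁻¹ • v - (supportPoint K w - ε • ‖w‖⁻¹ • w) =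
      (supportPoint K v - supportPoint K w) - ε • (‖v‖⁻¹ • v - ‖w‖⁻¹ • w) := by
    rw [smul_sub]
    abel
  rw [e, inner_sub_left, inner_smul_left, RCLike.conj_to_real] at this
  linarith

theorem IsOfConstantWidth.supportPoint_neg {K : ConvexBody (E n)} (hK : IsOfConstantWidth K 1)
    {v : E n} (hv : v ≠ 0) : supportPoint K (-v) = supportPoint K v - ‖v‖⁻¹ • v := by
  have hu := norm_inv_smul_self hv
  have hmem := hK.sub_mem (supportPoint_mem K v) hu (inner_inv_norm_smul_supportPoint K v)
  refine (hK.eq_supportPoint (neg_ne_zero.2 hv) hmem ?_).symm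
  have h1 := hK.add_neg v
  rw [inner_neg_right, inner_sub_left, inner_supportPoint, inner_smul_left,
    real_inner_self_eq_norm_sq]
  have hn : ‖v‖ ≠ 0 := norm_ne_zero_iff.2 hv
  simp only [RCLike.conj_to_real]
  field_simp
  linarith

/-- Passing to antipodes replaces x(v) by x(v) - v/‖v‖, which turns the lower bound into the upper
one. One-sided roundness is thus two-sided in constant width. -/
theorem IsRounded.inner_le {K : ConvexBody (E n)} {ε : ℝ} (h : IsRounded K ε)
    (hK : IsOfConstantWidth K 1) {v w : E n} (hv : v ≠ 0) (hw : w ≠ 0) :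
    ⟪supportPoint K v - supportPoint K w, v - w⟫ ≤
      (1 - ε) * ⟪‖v‖⁻¹ • v - ‖w‖⁻¹ • w, v - w⟫ := by
  have := h.le_inner hK (neg_ne_zero.2 hv) (neg_ne_zero.2 hw)
  rw [hK.supportPoint_neg hv, hK.supportPoint_neg hw, norm_neg, norm_neg] at this
  have e1 : ‖v‖⁻¹ • -v - ‖w‖⁻¹ • -w = -(‖v‖⁻¹ • v - ‖w‖⁻¹ • w) := by
    rw [smul_neg, smul_neg]; abel
  have e2 : -v - -w = -(v - w) := by abel
  have e3 : supportPoint K v - ‖v‖⁻¹ • v - (supportPoint K w - ‖w‖⁻¹ • w) =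
    (supportPoint K v - supportPoint K w) - (‖v‖⁻¹ • v - ‖w‖⁻¹ • w) := by abel
  rw [e1, e2, e3, inner_neg_neg, inner_neg_right,
    inner_sub_left (supportPoint K v - supportPoint K w)] at this
  linarith

theorem inner_normalize_sub {a b : E n} (ha : a ≠ 0) (hb : b ≠ 0) :
    ⟪‖a‖⁻¹ • a - ‖b‖⁻¹ • b, a - b⟫ =
      (‖a‖ + ‖b‖) / 2 * ‖‖a‖⁻¹ • a - ‖b‖⁻¹ • b‖ ^ 2 := by
  have h1 : ‖a‖ ≠ 0 := norm_ne_zero_iff.2 ha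
  have h2 : ‖b‖ ≠ 0 := norm_ne_zero_iff.2 hb
  rw [norm_sub_sq_real, norm_inv_smul_self ha, norm_inv_smul_self hb]
  simp only [inner_sub_left, inner_sub_right, inner_smul_left, inner_smul_right,
    RCLike.conj_to_real, real_inner_self_eq_norm_sq, real_inner_comm a b]
  field_simp
  ring

/-- On the hyperplane ⟨e, ·⟩ = 1 the e-component of a/‖a‖ is 1/‖a‖. The normalized difference thus
controls the lengths as well as the directions. -/
theorem norm_sub_le_of_normalize {e a b : E n} {L : ℝ} (he : ‖e‖ = 1) (ha : ⟪e, a⟫ = 1)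
    (hb : ⟪e, b⟫ = 1) (haL : ‖a‖ ≤ L) (hbL : ‖b‖ ≤ L) (hL : 1 ≤ L) :
    ‖a - b‖ ≤ 2 * L ^ 2 * ‖‖a‖⁻¹ • a - ‖b‖⁻¹ • b‖ := by
  have ha0 : a ≠ 0 := by rintro rfl; simp at ha
  have hb0 : b ≠ 0 := by rintro rfl; simp at hb
  have h1 : 0 < ‖a‖ := norm_pos_iff.2 ha0
  have h2 : 0 < ‖b‖ := norm_pos_iff.2 hb0
  set D := ‖‖a‖⁻¹ • a - ‖b‖⁻¹ • b‖ with hD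
  have h3 : |‖a‖⁻¹ - ‖b‖⁻¹| ≤ D := by
    have := abs_real_inner_le_norm e (‖a‖⁻¹ • a - ‖b‖⁻¹ • b)
    rwa [inner_sub_right, inner_smul_right, inner_smul_right, ha, hb, mul_one, mul_one, he,
      one_mul] at this
  have e1 : a - b = ‖a‖ • (‖a‖⁻¹ • a - ‖b‖⁻¹ • b) + (‖a‖ * (‖b‖⁻¹ - ‖a‖⁻¹)) • b := by
    rw [smul_sub, smul_smul, smul_smul, mul_sub, sub_smul, mul_inv_cancel₀ h1.ne', one_smul,
      one_smul]
    abel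
  have h4 : ‖a - b‖ ≤ ‖a‖ * D + ‖a‖ * D * ‖b‖ := by
    rw [e1]
    refine (norm_add_le _ _).trans ?_
    rw [norm_smul, norm_smul, norm_norm, norm_mul, norm_norm, Real.norm_eq_abs, abs_sub_comm]
    gcongr
  have hD0 : 0 ≤ D := norm_nonneg _
  calc ‖a - b‖ ≤ ‖a‖ * D + ‖a‖ * D * ‖b‖ := h4
    _ ≤ L * D + L * D * L := by gcongr
    _ ≤ 2 * L ^ 2 * D := by 
        have : 0 ≤ (L - 1) * (L * D) := mul_nonneg (by linarith) (by positivity)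
        linarith

/-- Bodies with a ball as a summand are dense among bodies of constant width. -/
theorem exists_isRounded_dist_lt (K : ConstantWidthBody n) {δ : ℝ} (hδ : 0 < δ) :
    ∃ (L : ConstantWidthBody n) (ε : ℝ), 0 < ε ∧ ε < 1 / 2 ∧ IsRounded L.1 ε ∧ dist L K < δ := by
  obtain ⟨C, hC⟩ := isBounded_iff_forall_norm_le.1 K.1.isBounded
  have hC0 : 0 ≤ C := by
    obtain ⟨x, hx⟩ := K.1.nonempty
    exact (norm_nonneg x).trans (hC x hx)
  have hh : ∀ u : E n, ‖u‖ = 1 → |supportFun K.1 u| ≤ C := fun u hu => by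
    rw [← inner_supportPoint]
    refine (abs_real_inner_le_norm _ _).trans ?_
    rw [hu, mul_one]
    exact hC _ (supportPoint_mem K.1 u)
  set ε := min (1 / 4) (δ / (2 * (2 * C + 1))) with hε
  have hεp : 0 < ε := by positivity
  have hε4 : ε ≤ 1 / 4 := min_le_left _ _
  have hεδ : ε * (2 * C + 1) ≤ δ / 2 := by
    calc ε * (2 * C + 1) ≤ δ / (2 * (2 * C + 1)) * (2 * C + 1) := by
          gcongr
          exact min_le_right _ _
      _ = δ / 2 := by field_simp
  -- The body (1 - 2ε)K + εB, with B the unit ball, has width (1 - 2ε) + 2ε = 1.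
  obtain ⟨L, hL⟩ := exists_convexBody_of_sublinear
    (h := fun x : E n => (1 - 2 * ε) * supportFun K.1 x + ε * ‖x‖)
    (fun c hc x => by
      rw [supportFun_smul K.1 hc.le, norm_smul, Real.norm_eq_abs, abs_of_pos hc]
      ring)
    (fun x y => by
      have h1 := mul_le_mul_of_nonneg_left (supportFun_add_le K.1 x y)
        (by linarith : 0 ≤ 1 - 2 * ε)
      have h2 := mul_le_mul_of_nonneg_left (norm_add_le x y) hεp.le
      linarith)
  have hLx : ∀ x, supportFun L x = (1 - 2 * ε) * supportFun K.1 x + ε * ‖x‖ := congrFun hL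
  have hLw : IsOfConstantWidth L 1 := fun u hu => by
    rw [hLx, hLx, norm_neg, hu]
    have := K.2 u hu
    linear_combination (1 - 2 * ε) * this
  refine ⟨⟨L, hLw⟩, ε, hεp, by linarith, fun x y => ?_, ?_⟩
  · have h1 := mul_le_mul_of_nonneg_left (supportFun_add_le K.1 x y)
      (by linarith : 0 ≤ 1 - 2 * ε)
    rw [hLx, hLx, hLx]
    linarith
  · show dist L K.1 < δ
    refine lt_of_le_of_lt (dist_le_of_supportFun (c := ε * (2 * C + 1)) (by positivity)
      fun u hu => ?_) (hεδ.trans_lt (half_lt_self hδ))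
    rw [hLx, hu]
    have e : (1 - 2 * ε) * supportFun K.1 u + ε * 1 - supportFun K.1 u =
      ε * (-2 * supportFun K.1 u + 1) := by ring
    rw [e, abs_mul, abs_of_pos hεp]
    gcongr
    have := abs_le.1 (hh u hu)
    rw [abs_le]
    constructor <;> linarith [this.1, this.2]

end Rounded

/-! ### Sublinearity across a hyperplane -/

section Glue

variable {n : ℕ}

/-- Let p = b + ca be where the ray from b in direction a meets the hyperplane, so that a + b = (1 -
c)a + p stays in the half-space. A supporting functional G at p gives k(p) = G(b) + cG(a) ≤ k(b) +
ck(a). If p = 0, then b = -ca and `hsum` suffices. -/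
theorem add_le_of_halfspaces_aux {k : E n → ℝ} {e : E n}
    (hk : ∀ c : ℝ, 0 ≤ c → ∀ x, k (c • x) = c * k x)
    (hpos : ∀ x y, 0 ≤ ⟪e, x⟫ → 0 ≤ ⟪e, y⟫ → k (x + y) ≤ k x + k y)
    (hsupp : ∀ p, p ≠ 0 → ⟪e, p⟫ = 0 → ∃ G : E n, ⟪G, p⟫ = k p ∧ ∀ x, ⟪G, x⟫ ≤ k x)
    (hsum : ∀ x, 0 ≤ k x + k (-x)) {a b : E n} (ha : 0 < ⟪e, a⟫) (hb : ⟪e, b⟫ < 0)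
    (hab : 0 ≤ ⟪e, a + b⟫) : k (a + b) ≤ k a + k b := by
  set c := -⟪e, b⟫ / ⟪e, a⟫ with hc
  have hc0 : 0 < c := div_pos (by linarith) ha
  have hc1 : c ≤ 1 := by
    rw [hc, div_le_one ha]
    rw [inner_add_right] at hab
    linarith
  have hcea : c * ⟪e, a⟫ = -⟪e, b⟫ := by rw [hc]; field_simp
  set p := b + c • a with hp
  have hpe : ⟪e, p⟫ = 0 := by
    rw [hp, inner_add_right, inner_smul_right, hcea]
    ring
  have e1 : a + b = (1 - c) • a + p := by
    rw [hp, sub_smul, one_smul]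
    abel
  by_cases hp0 : p = 0
  · have hb' : b = c • (-a) := by
      rw [smul_neg]
      exact eq_neg_of_add_eq_zero_left (hp ▸ hp0)
    rw [e1, hp0, add_zero, hk _ (by linarith), hb', hk c hc0.le]
    nlinarith [hsum a]
  · obtain ⟨G, hG, hGx⟩ := hsupp p hp0 hpe
    have h1 := hpos ((1 - c) • a) p (by
      rw [inner_smul_right]
      exact mul_nonneg (by linarith) ha.le) hpe.ge
    rw [← e1, hk _ (by linarith), ← hG, hp, inner_add_right, inner_smul_right] at h1
    have h2 := hGx b
    have h3 := mul_le_mul_of_nonneg_left (hGx a) hc0.le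
    linarith

/-- A positively homogeneous function that is sublinear on two complementary half-spaces and has
supporting functionals along the common boundary is sublinear. -/
theorem add_le_of_halfspaces {k : E n → ℝ} {e : E n}
    (hk : ∀ c : ℝ, 0 ≤ c → ∀ x, k (c • x) = c * k x)
    (hpos : ∀ x y, 0 ≤ ⟪e, x⟫ → 0 ≤ ⟪e, y⟫ → k (x + y) ≤ k x + k y)
    (hneg : ∀ x y, ⟪e, x⟫ ≤ 0 → ⟪e, y⟫ ≤ 0 → k (x + y) ≤ k x + k y)
    (hsupp : ∀ p, p ≠ 0 → ⟪e, p⟫ = 0 → ∃ G : E n, ⟪G, p⟫ = k p ∧ ∀ x, ⟪G, x⟫ ≤ k x)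
    (hsum : ∀ x, 0 ≤ k x + k (-x)) (a b : E n) : k (a + b) ≤ k a + k b := by
  have key : ∀ a b, 0 < ⟪e, a⟫ → ⟪e, b⟫ < 0 → k (a + b) ≤ k a + k b := by
    intro a b ha hb
    rcases le_total 0 ⟪e, a + b⟫ with h | h
    · exact add_le_of_halfspaces_aux hk hpos hsupp hsum ha hb h
    · have := add_le_of_halfspaces_aux (e := -e) (a := b) (b := a) hk
        (fun x y hx hy => hneg x y (by rw [inner_neg_left] at hx; linarith)
          (by rw [inner_neg_left] at hy; linarith))
        (fun p hp0 hp => hsupp p hp0 (by rw [inner_neg_left] at hp; linarith)) hsum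
        (by rw [inner_neg_left]; linarith) (by rw [inner_neg_left]; linarith)
        (by rw [inner_neg_left, add_comm b a]; linarith)
      rw [add_comm a b]
      linarith
  rcases le_or_gt 0 ⟪e, a⟫ with ha | ha
  · rcases le_or_gt 0 ⟪e, b⟫ with hb | hb
    · exact hpos a b ha hb
    · rcases ha.eq_or_lt with ha' | ha'
      · exact hneg a b ha'.symm.le hb.le
      · exact key a b ha' hb
  · rcases le_or_gt ⟪e, b⟫ 0 with hb | hb
    · exact hneg a b ha.le hb
    · rw [add_comm a b, add_comm (k a)]
      exact key b a hb ha

end Glue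

end

end ConstWidth

/-! ### Gnomonic charts -/

namespace ConstWidth

noncomputable section

/-- A gnomonic chart: `F` is identified with the orthogonal complement of the unit vector `e`. -/
structure Chart (n : ℕ) (F : Type*) [NormedAddCommGroup F] [InnerProductSpace ℝ F] where
  e : E n
  norm_e : ‖e‖ = 1
  ι : F →ₗᵢ[ℝ] E n
  π : E n →L[ℝ] F
  inner_e_ι : ∀ y, ⟪e, ι y⟫ = 0
  inner_π : ∀ x y, ⟪π x, y⟫ = ⟪x, ι y⟫
  decomp : ∀ x, ⟪e, x⟫ • e + ι (π x) = x

namespace Chart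

section Basic

variable {n : ℕ} {F : Type*} [NormedAddCommGroup F] [InnerProductSpace ℝ F] (c : Chart n F)

/-- The point `e + y` of the affine hyperplane of the chart. -/
def pt (y : F) : E n := c.e + c.ι y

theorem inner_e_pt (y : F) : ⟪c.e, c.pt y⟫ = 1 := by
  rw [pt, inner_add_right, c.inner_e_ι, real_inner_self_eq_norm_sq, c.norm_e]
  norm_num

theorem one_le_norm_pt (y : F) : 1 ≤ ‖c.pt y‖ := by
  have := real_inner_le_norm c.e (c.pt y)
  rwa [c.inner_e_pt, c.norm_e, one_mul] at this

theorem pt_ne_zero (y : F) : c.pt y ≠ 0 :=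
  norm_pos_iff.1 (by linarith [c.one_le_norm_pt y])

theorem pt_sub_pt (v w : F) : c.pt v - c.pt w = c.ι (v - w) := by
  rw [pt, pt, map_sub]
  abel

theorem norm_pt_le (y : F) : ‖c.pt y‖ ≤ 1 + ‖y‖ := by
  refine (norm_add_le _ _).trans ?_
  rw [c.norm_e, LinearIsometry.norm_map]

theorem continuous_pt : Continuous c.pt := continuous_const.add c.ι.continuous

theorem π_e : c.π c.e = 0 := by
  have : ⟪c.π c.e, c.π c.e⟫ = 0 := by rw [c.inner_π, c.inner_e_ι]
  exact inner_self_eq_zero.1 this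

theorem π_ι (y : F) : c.π (c.ι y) = y := by
  have : ∀ w, ⟪c.π (c.ι y) - y, w⟫ = 0 := fun w => by
    rw [inner_sub_left, c.inner_π, LinearIsometry.inner_map_map, sub_self]
  exact sub_eq_zero.1 (inner_self_eq_zero.1 (this _))

theorem π_pt (y : F) : c.π (c.pt y) = y := by
  rw [pt, map_add, c.π_e, c.π_ι, zero_add]

theorem smul_pt {x : E n} (hx : ⟪c.e, x⟫ ≠ 0) :
    ⟪c.e, x⟫ • c.pt (⟪c.e, x⟫⁻¹ • c.π x) = x := by
  conv_rhs => rw [← c.decomp x]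
  rw [pt, smul_add, map_smul, smul_smul, mul_inv_cancel₀ hx, one_smul]

theorem hasFDerivAt_pt (y : F) : HasFDerivAt c.pt c.ι.toContinuousLinearMap y :=
  (c.ι.toContinuousLinearMap.hasFDerivAt (x := y)).const_add c.e

theorem hasFDerivAt_comp_pt {h : E n → ℝ} {g : E n} {y : F}
    (hh : HasFDerivAt h (innerSL ℝ g) (c.pt y)) :
    HasFDerivAt (fun y => h (c.pt y)) (innerSL ℝ (c.π g)) y := by
  refine (hh.comp y (c.hasFDerivAt_pt y)).congr_fderiv ?_
  ext d
  simp [innerSL_apply_apply, c.inner_π]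

end Basic

/-! ### Homogeneous extension of chart perturbations -/

section Perturbation

variable {n : ℕ} {F : Type*} [NormedAddCommGroup F] [InnerProductSpace ℝ F] (c : Chart n F)

/-- The homogeneous extension of degree one of a function on the chart. -/
def persp (φ : F → ℝ) (x : E n) : ℝ := ⟪c.e, x⟫ * φ (⟪c.e, x⟫⁻¹ • c.π x)

variable {φ : F → ℝ}

theorem persp_smul (a : ℝ) (x : E n) : c.persp φ (a • x) = a * c.persp φ x := by
  by_cases ha : a = 0
  · simp [persp, ha]
  · rw [persp, persp, inner_smul_right, map_smul, smul_smul, mul_inv, mul_assoc]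
    congr 4
    field_simp

/-- Oddness is what leaves the width h(u) + h(-u) unchanged. -/
theorem persp_neg (x : E n) : c.persp φ (-x) = -c.persp φ x := by
  rw [← neg_one_smul ℝ x, persp_smul]
  ring

theorem persp_pt (y : F) : c.persp φ (c.pt y) = φ y := by
  rw [persp, c.inner_e_pt, c.π_pt]
  simp

theorem abs_persp_le {σ : ℝ} (hφ : ∀ y, |φ y| ≤ σ) (x : E n) :
    |c.persp φ x| ≤ σ * |⟪c.e, x⟫| := by
  rw [persp, abs_mul, mul_comm]
  gcongr
  exact hφ _

theorem continuous_persp {σ : ℝ} (hc : Continuous φ) (hφ : ∀ y, |φ y| ≤ σ) :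
    Continuous (c.persp φ) := by
  rw [continuous_iff_continuousAt]
  intro x
  by_cases hx : ⟪c.e, x⟫ = 0
  · have h0 : c.persp φ x = 0 := by rw [persp, hx, zero_mul]
    rw [ContinuousAt, h0, tendsto_zero_iff_abs_tendsto_zero]
    have hlim : Tendsto (fun x => σ * |⟪c.e, x⟫|) (𝓝 x) (𝓝 0) := by
      have hcont : Continuous fun x => σ * |⟪c.e, x⟫| := by fun_prop
      have := hcont.tendsto x
      rwa [hx, abs_zero, mul_zero] at this
    exact tendsto_of_tendsto_of_tendsto_of_le_of_le tendsto_const_nhds hlim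
      (fun _ => abs_nonneg _) (c.abs_persp_le hφ)
  · have h1 : ContinuousAt (fun x => ⟪c.e, x⟫) x := by fun_prop
    have h2 : ContinuousAt (fun x => ⟪c.e, x⟫⁻¹ • c.π x) x :=
      (h1.inv₀ hx).smul c.π.continuous.continuousAt
    exact h1.mul (hc.continuousAt.comp h2)

/-- Near a nonzero point of the hyperplane the chart coordinate is large, outside the support of φ.
The perturbed function therefore agrees there with the original smooth one. -/
theorem persp_eventually_eq_zero {R : ℝ} (hR : ∀ y, R ≤ ‖y‖ → φ y = 0) {p : E n} (hp : p ≠ 0)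
    (hpe : ⟪c.e, p⟫ = 0) : ∀ᶠ x in 𝓝 p, c.persp φ x = 0 := by
  have hπ : 0 < ‖c.π p‖ := by
    rw [norm_pos_iff]
    intro h0
    have := c.decomp p
    rw [hpe, h0, zero_smul, map_zero, add_zero] at this
    exact hp this.symm
  have hcont : Continuous fun x => ‖c.π x‖ - R * |⟪c.e, x⟫| := by fun_prop
  have hev : ∀ᶠ x in 𝓝 p, 0 < ‖c.π x‖ - R * |⟪c.e, x⟫| := by
    apply hcont.continuousAt.eventually
    apply lt_mem_nhds
    simpa [hpe] using hπ
  filter_upwards [hev] with x hx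
  by_cases hxe : ⟪c.e, x⟫ = 0
  · rw [persp, hxe, zero_mul]
  · rw [persp, hR, mul_zero]
    rw [norm_smul, norm_inv, Real.norm_eq_abs, le_inv_mul_iff₀ (abs_pos.2 hxe)]
    linarith

/-- The perspective of a convex function is subadditive on the open half-space. -/
theorem add_le_of_perspective {f : F → ℝ} (hf : ConvexOn ℝ univ f) {k : E n → ℝ}
    (hk : ∀ x, 0 < ⟪c.e, x⟫ → k x = ⟪c.e, x⟫ * f (⟪c.e, x⟫⁻¹ • c.π x)) {x y : E n}
    (hx : 0 < ⟪c.e, x⟫) (hy : 0 < ⟪c.e, y⟫) : k (x + y) ≤ k x + k y := by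
  have hxy : 0 < ⟪c.e, x + y⟫ := by rw [inner_add_right]; linarith
  rw [hk _ hx, hk _ hy, hk _ hxy]
  set s := ⟪c.e, x⟫
  set s' := ⟪c.e, y⟫
  have e0 : ⟪c.e, x + y⟫ = s + s' := inner_add_right _ _ _
  rw [e0]
  have hss : 0 < s + s' := by linarith
  have h1 := hf.2 (mem_univ (s⁻¹ • c.π x)) (mem_univ (s'⁻¹ • c.π y))
    (div_nonneg hx.le hss.le) (div_nonneg hy.le hss.le) (by field_simp)
  have e1 : (s / (s + s')) • s⁻¹ • c.π x + (s' / (s + s')) • s'⁻¹ • c.π y =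
      (s + s')⁻¹ • c.π (x + y) := by
    rw [smul_smul, smul_smul, map_add, smul_add]
    congr 2 <;> field_simp
  rw [e1, smul_eq_mul, smul_eq_mul] at h1
  have h2 := mul_le_mul_of_nonneg_left h1 hss.le
  refine h2.trans_eq ?_
  field_simp

/-- Both arguments are shifted into the open half-space by sw, and s tends to 0. -/
theorem add_le_closed_of_open {k : E n → ℝ} (hc : Continuous k) {e w : E n} (he : 0 < ⟪e, w⟫)
    (h : ∀ x y, 0 < ⟪e, x⟫ → 0 < ⟪e, y⟫ → k (x + y) ≤ k x + k y) (x y : E n)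
    (hx : 0 ≤ ⟪e, x⟫) (hy : 0 ≤ ⟪e, y⟫) : k (x + y) ≤ k x + k y := by
  have h1 : Tendsto (fun s : ℝ => k ((x + s • w) + (y + s • w))) (𝓝[>] 0) (𝓝 (k (x + y))) := by
    have hcont : Continuous fun s : ℝ => k ((x + s • w) + (y + s • w)) := by fun_prop
    have := hcont.tendsto 0
    simp only [zero_smul, add_zero] at this
    exact this.mono_left nhdsWithin_le_nhds
  have h2 : Tendsto (fun s : ℝ => k (x + s • w) + k (y + s • w)) (𝓝[>] 0) (𝓝 (k x + k y)) := by
    have hcont : Continuous fun s : ℝ => k (x + s • w) + k (y + s • w) := by fun_prop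
    have := hcont.tendsto 0
    simp only [zero_smul, add_zero] at this
    exact this.mono_left nhdsWithin_le_nhds
  refine le_of_tendsto_of_tendsto h1 h2 ?_
  filter_upwards [self_mem_nhdsWithin] with s hs
  have hs : 0 < s := hs
  apply h
  · rw [inner_add_right, inner_smul_right]
    have := mul_pos hs he
    linarith
  · rw [inner_add_right, inner_smul_right]
    have := mul_pos hs he
    linarith

/-- A compactly supported perturbation of the support function in a chart that keeps the two-sided
convexity bounds defines a body of constant width. -/
theorem exists_body_of_perturbation (K : ConstantWidthBody n) {ε σ R : ℝ} (hε : 0 ≤ ε)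
    (hε2 : ε ≤ 1 / 2) (hc : Continuous φ) (hσ : 0 ≤ σ)
    (hφ : ∀ y, |φ y| ≤ σ) (hR : ∀ y, R ≤ ‖y‖ → φ y = 0)
    (hlow : ConvexOn ℝ univ fun y => supportFun K.1 (c.pt y) + φ y - ε * ‖c.pt y‖)
    (hup : ConvexOn ℝ univ fun y => (1 - ε) * ‖c.pt y‖ - (supportFun K.1 (c.pt y) + φ y)) :
    ∃ L : ConstantWidthBody n, IsRounded L.1 ε ∧ dist L K ≤ σ ∧
      ∀ y, supportFun L.1 (c.pt y) = supportFun K.1 (c.pt y) + φ y := by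
  set k : E n → ℝ := fun x => supportFun K.1 x + c.persp φ x - ε * ‖x‖ with hkdef
  have hwidth : ∀ x, k x + k (-x) = (1 - 2 * ε) * ‖x‖ := fun x => by
    have := K.2.add_neg x
    simp only [hkdef, persp_neg, norm_neg]
    linarith
  have hhom : ∀ a : ℝ, 0 ≤ a → ∀ x, k (a • x) = a * k x := fun a ha x => by
    simp only [hkdef, supportFun_smul K.1 ha, persp_smul, norm_smul, Real.norm_eq_abs,
      abs_of_nonneg ha]
    ring
  have hsc : Continuous (supportFun K.1) := by
    refine LipschitzWith.continuous (K := Real.toNNReal (sSup (norm '' (K.1 : Set (E n))))) ?_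
    refine LipschitzWith.of_le_add_mul _ fun x y => ?_
    have hb : BddAbove (norm '' (K.1 : Set (E n))) :=
      (K.1.isCompact.image continuous_norm).bddAbove
    have hn : ∀ p ∈ K.1, ‖p‖ ≤ sSup (norm '' (K.1 : Set (E n))) := fun p hp =>
      le_csSup hb ⟨p, hp, rfl⟩
    have h1 := inner_le_supportFun (supportPoint_mem K.1 x) y
    have h2 := real_inner_le_norm (supportPoint K.1 x) (x - y)
    rw [inner_sub_right, inner_supportPoint] at h2
    rw [Real.coe_toNNReal _ ((norm_nonneg _).trans (hn _ (supportPoint_mem K.1 x))), dist_eq_norm]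
    have h3 := mul_le_mul_of_nonneg_right (hn _ (supportPoint_mem K.1 x)) (norm_nonneg (x - y))
    linarith
  have hkc : Continuous k := by
    have := c.continuous_persp hc hφ
    fun_prop
  have hkpos : ∀ x, 0 < ⟪c.e, x⟫ → k x = ⟪c.e, x⟫ *
      (supportFun K.1 (c.pt (⟪c.e, x⟫⁻¹ • c.π x)) + φ (⟪c.e, x⟫⁻¹ • c.π x)
        - ε * ‖c.pt (⟪c.e, x⟫⁻¹ • c.π x)‖) := fun x hx => by
    have h1 := hhom _ hx.le (c.pt (⟪c.e, x⟫⁻¹ • c.π x))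
    rw [c.smul_pt hx.ne'] at h1
    rw [h1]
    simp only [hkdef, c.persp_pt]
  have hee : ⟪c.e, c.e⟫ = 1 := by rw [real_inner_self_eq_norm_sq, c.norm_e]; norm_num
  have hpos : ∀ x y, 0 ≤ ⟪c.e, x⟫ → 0 ≤ ⟪c.e, y⟫ → k (x + y) ≤ k x + k y :=
    add_le_closed_of_open hkc (by rw [hee]; exact one_pos)
      fun x y hx hy => c.add_le_of_perspective hlow hkpos hx hy
  -- By constant width, k on the lower half-space is the perspective of (1 - ε)‖·‖ minus the
  -- perturbed function. This is where the upper convexity bound enters.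
  have hkneg : ∀ x, 0 < ⟪c.e, x⟫ → k (-x) = ⟪c.e, x⟫ *
      ((1 - ε) * ‖c.pt (⟪c.e, x⟫⁻¹ • c.π x)‖ - (supportFun K.1 (c.pt (⟪c.e, x⟫⁻¹ • c.π x))
        + φ (⟪c.e, x⟫⁻¹ • c.π x))) := fun x hx => by
    have h1 := hwidth x
    have h2 : ‖x‖ = ⟪c.e, x⟫ * ‖c.pt (⟪c.e, x⟫⁻¹ • c.π x)‖ := by
      conv_lhs => rw [← c.smul_pt hx.ne', norm_smul, Real.norm_eq_abs, abs_of_pos hx]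
    rw [hkpos x hx, h2] at h1
    linarith
  have hneg' : ∀ x y, 0 ≤ ⟪c.e, x⟫ → 0 ≤ ⟪c.e, y⟫ → k (-(x + y)) ≤ k (-x) + k (-y) :=
    add_le_closed_of_open (k := fun x => k (-x)) (by fun_prop) (by rw [hee]; exact one_pos)
      fun x y hx hy => c.add_le_of_perspective (k := fun x => k (-x)) hup hkneg hx hy
  have hneg : ∀ x y, ⟪c.e, x⟫ ≤ 0 → ⟪c.e, y⟫ ≤ 0 → k (x + y) ≤ k x + k y := fun x y hx hy => by
    have := hneg' (-x) (-y) (by rw [inner_neg_right]; linarith) (by rw [inner_neg_right]; linarith)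
    rwa [← neg_add, neg_neg, neg_neg, neg_neg] at this
  -- At p the perturbation vanishes nearby, so k is differentiable with gradient G. Convexity on
  -- each closed half-space, with p on its boundary, makes G a support there.
  have hsupp : ∀ p, p ≠ 0 → ⟪c.e, p⟫ = 0 → ∃ G : E n, ⟪G, p⟫ = k p ∧ ∀ x, ⟪G, x⟫ ≤ k x := by
    intro p hp hpe
    set G := supportPoint K.1 p - ε • ‖p‖⁻¹ • p with hG
    have hev := c.persp_eventually_eq_zero hR hp hpe
    have hd : HasFDerivAt k (innerSL ℝ G) p := by
      refine (hasFDerivAt_sub_const_mul_norm K.2 ε hp).congr_of_eventuallyEq ?_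
      filter_upwards [hev] with x hx
      simp only [hkdef, hx, add_zero]
    have hGp : ⟪G, p⟫ = k p := by
      have hn : ‖p‖ ≠ 0 := norm_ne_zero_iff.2 hp
      rw [hG, inner_sub_left, inner_supportPoint, inner_smul_left, inner_smul_left,
        real_inner_self_eq_norm_sq]
      simp only [hkdef, hev.self_of_nhds, RCLike.conj_to_real, add_zero]
      field_simp
    have hcp : ConvexOn ℝ {x | 0 ≤ ⟪c.e, x⟫} k :=
      convexOn_of_sublinear (convex_halfSpace_ge (innerSL ℝ c.e).isLinear 0)
        (fun a ha x hx => by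
          show 0 ≤ ⟪c.e, a • x⟫
          rw [inner_smul_right]
          exact mul_nonneg ha hx) hhom (fun x hx y hy => hpos x y hx hy)
    have hcn : ConvexOn ℝ {x | ⟪c.e, x⟫ ≤ 0} k :=
      convexOn_of_sublinear (convex_halfSpace_le (innerSL ℝ c.e).isLinear 0)
        (fun a ha x hx => by
          show ⟪c.e, a • x⟫ ≤ 0
          rw [inner_smul_right]
          exact mul_nonpos_of_nonneg_of_nonpos ha hx) hhom (fun x hx y hy => hneg x y hx hy)
    refine ⟨G, hGp, fun x => ?_⟩
    rcases le_total 0 ⟪c.e, x⟫ with hx | hx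
    · have := ConvexOn.add_inner_gradient_le hcp (v := p) (w := x) hpe.ge hx hd
      rw [inner_sub_right] at this
      linarith
    · have := ConvexOn.add_inner_gradient_le hcn (v := p) (w := x) hpe.le hx hd
      rw [inner_sub_right] at this
      linarith
  have hsub : ∀ a b, k (a + b) ≤ k a + k b := by
    refine add_le_of_halfspaces hhom hpos hneg hsupp fun x => ?_
    rw [hwidth]
    exact mul_nonneg (by linarith) (norm_nonneg x)
  obtain ⟨L, hL⟩ := exists_convexBody_of_sublinear
    (h := fun x : E n => supportFun K.1 x + c.persp φ x)
    (fun a ha x => by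
      rw [supportFun_smul K.1 ha.le, persp_smul]
      ring)
    (fun x y => by
      have h1 := hsub x y
      have h2 := mul_le_mul_of_nonneg_left (norm_add_le x y) hε
      simp only [hkdef] at h1
      linarith)
  have hLx : ∀ x, supportFun L x = supportFun K.1 x + c.persp φ x := congrFun hL
  have hLw : IsOfConstantWidth L 1 := fun u hu => by
    rw [hLx, hLx, persp_neg]
    have := K.2 u hu
    linarith
  refine ⟨⟨L, hLw⟩, fun x y => ?_, ?_, fun y => ?_⟩
  · have := hsub x y
    simpa only [hkdef, hLx] using this
  · show dist L K.1 ≤ σ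
    refine dist_le_of_supportFun hσ fun u hu => ?_
    rw [hLx, add_sub_cancel_left]
    refine (c.abs_persp_le hφ u).trans (mul_le_of_le_one_right hσ ?_)
    have := abs_real_inner_le_norm c.e u
    rwa [c.norm_e, hu, one_mul] at this
  · rw [hLx, c.persp_pt]

end Perturbation

end Chart

end

end ConstWidth

namespace ConstWidth

noncomputable section

namespace Chart

/-! ### First and second derivatives in a chart -/

section Analysis

variable {n : ℕ} {F : Type*} [NormedAddCommGroup F] [InnerProductSpace ℝ F] (c : Chart n F)
  (K : ConvexBody (E n))

/-- The support point map in a chart. -/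
def spt (y : F) : E n := supportPoint K (c.pt y)

/-- The gradient of the support function in a chart. -/
def grad (y : F) : F := c.π (c.spt K y)

/-- The gradient of the norm in a chart. -/
def normGrad (y : F) : F := c.π (‖c.pt y‖⁻¹ • c.pt y)

/-- The second derivative of the support function in a chart in direction `z`. -/
def secondDeriv (z y : F) : ℝ := lineDeriv ℝ (fun y => ⟪c.spt K y, c.ι z⟫) y z

/-- The defect of equality in the derivative form of firm nonexpansiveness. -/
def defect (z y : F) : ℝ :=
  ⟪lineDeriv ℝ (c.spt K) y z, c.ι z⟫ - ‖c.pt y‖ * ‖lineDeriv ℝ (c.spt K) y z‖ ^ 2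

variable {K}

theorem lipschitzWith_spt (hK : IsOfConstantWidth K 1) : LipschitzWith 1 (c.spt K) := by
  refine LipschitzWith.of_dist_le_mul fun v w => ?_
  rw [dist_eq_norm, dist_eq_norm, NNReal.coe_one, one_mul]
  refine (hK.norm_supportPoint_sub_le (c.pt_ne_zero v) (c.pt_ne_zero w)).trans ?_
  refine (norm_inv_norm_smul_sub_le (c.one_le_norm_pt v) (c.one_le_norm_pt w)).trans_eq ?_
  rw [c.pt_sub_pt, LinearIsometry.norm_map]

theorem continuous_grad (hK : IsOfConstantWidth K 1) : Continuous (c.grad K) :=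
  c.π.continuous.comp (c.lipschitzWith_spt hK).continuous

theorem continuous_normGrad : Continuous c.normGrad := by
  have h : Continuous fun y => ‖c.pt y‖⁻¹ :=
    c.continuous_pt.norm.inv₀ fun y => norm_ne_zero_iff.2 (c.pt_ne_zero y)
  exact c.π.continuous.comp (h.smul c.continuous_pt)

theorem hasFDerivAt_supportFun_pt (hK : IsOfConstantWidth K 1) (y : F) :
    HasFDerivAt (fun y => supportFun K (c.pt y)) (innerSL ℝ (c.grad K y)) y :=
  c.hasFDerivAt_comp_pt (hK.hasFDerivAt_supportFun (c.pt_ne_zero y))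

theorem hasFDerivAt_norm_pt (y : F) :
    HasFDerivAt (fun y => ‖c.pt y‖) (innerSL ℝ (c.normGrad y)) y :=
  c.hasFDerivAt_comp_pt (hasFDerivAt_norm_of_ne (c.pt_ne_zero y))

theorem inner_grad (y z : F) : ⟪c.grad K y, z⟫ = ⟪c.spt K y, c.ι z⟫ := c.inner_π _ _

theorem inner_grad_sub (v w : F) :
    ⟪c.grad K v - c.grad K w, v - w⟫ =
      ⟪supportPoint K (c.pt v) - supportPoint K (c.pt w), c.pt v - c.pt w⟫ := by
  rw [c.pt_sub_pt, grad, grad, ← map_sub, c.inner_π]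
  rfl

theorem inner_normGrad_sub (v w : F) :
    ⟪c.normGrad v - c.normGrad w, v - w⟫ =
      ⟪‖c.pt v‖⁻¹ • c.pt v - ‖c.pt w‖⁻¹ • c.pt w, c.pt v - c.pt w⟫ := by
  rw [c.pt_sub_pt, normGrad, normGrad, ← map_sub, c.inner_π]

theorem inner_normGrad_sub_nonneg (v w : F) : 0 ≤ ⟪c.normGrad v - c.normGrad w, v - w⟫ := by
  rw [inner_normGrad_sub, inner_normalize_sub (c.pt_ne_zero v) (c.pt_ne_zero w)]
  positivity

/-- Supplies the `lam` of `exists_local_perturbation`: gluing errors of order ‖v - w‖² can be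
absorbed into the increment of the norm gradient. -/
theorem normGrad_strongly_monotone (y0 : F) : ∃ lam > 0, ∀ v ∈ Metric.ball y0 1,
    ∀ w ∈ Metric.ball y0 1, lam * ‖v - w‖ ^ 2 ≤ ⟪c.normGrad v - c.normGrad w, v - w⟫ := by
  set L := 2 + ‖y0‖ with hL
  have hL1 : 1 ≤ L := by linarith [norm_nonneg y0]
  have hb : ∀ v ∈ Metric.ball y0 1, ‖c.pt v‖ ≤ L := fun v hv => by
    have h1 : ‖v‖ ≤ ‖y0‖ + ‖v - y0‖ := by
      calc ‖v‖ = ‖y0 + (v - y0)‖ := by congr 1; abel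
        _ ≤ _ := norm_add_le _ _
    have h2 := mem_ball_iff_norm.1 hv
    linarith [c.norm_pt_le v]
  refine ⟨1 / (2 * L ^ 2) ^ 2, by positivity, fun v hv w hw => ?_⟩
  have h1 := norm_sub_le_of_normalize c.norm_e (c.inner_e_pt v) (c.inner_e_pt w) (hb v hv)
    (hb w hw) hL1
  rw [inner_normGrad_sub, inner_normalize_sub (c.pt_ne_zero v) (c.pt_ne_zero w)]
  rw [c.pt_sub_pt, LinearIsometry.norm_map] at h1
  set D := ‖‖c.pt v‖⁻¹ • c.pt v - ‖c.pt w‖⁻¹ • c.pt w‖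
  have h2 : ‖v - w‖ ^ 2 ≤ (2 * L ^ 2 * D) ^ 2 := by gcongr
  have h3 : 1 ≤ (‖c.pt v‖ + ‖c.pt w‖) / 2 := by
    linarith [c.one_le_norm_pt v, c.one_le_norm_pt w]
  calc 1 / (2 * L ^ 2) ^ 2 * ‖v - w‖ ^ 2 ≤ 1 / (2 * L ^ 2) ^ 2 * (2 * L ^ 2 * D) ^ 2 := by gcongr
    _ = 1 * D ^ 2 := by field_simp
    _ ≤ _ := by gcongr

theorem hasStrictFDerivAt_normGrad (y : F) :
    HasStrictFDerivAt c.normGrad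
      (c.π.comp ((normalizeDeriv (c.pt y)).comp c.ι.toContinuousLinearMap)) y := by
  have h1 : HasStrictFDerivAt c.pt c.ι.toContinuousLinearMap y :=
    (c.ι.toContinuousLinearMap.hasStrictFDerivAt (x := y)).const_add c.e
  have h2 := (hasStrictFDerivAt_normalize (c.pt_ne_zero y)).comp y h1
  exact c.π.hasStrictFDerivAt.comp y h2

/-- Differentiability of the support point map in a chart implies differentiability in space. -/
theorem exists_hasFDerivAt_supportPoint (hK : IsOfConstantWidth K 1) {y : F}
    (hd : DifferentiableAt ℝ (c.spt K) y) :
    ∃ A : E n →L[ℝ] E n, HasFDerivAt (supportPoint K) A (c.pt y) := by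
  have h1 : DifferentiableAt ℝ (fun x => ⟪c.e, x⟫⁻¹ • c.π x) (c.pt y) := by
    have h2 : DifferentiableAt ℝ (fun x => ⟪c.e, x⟫) (c.pt y) :=
      (innerSL ℝ c.e).differentiableAt
    exact (h2.inv (by rw [c.inner_e_pt]; exact one_ne_zero)).smul c.π.differentiableAt
  have hy : ⟪c.e, c.pt y⟫⁻¹ • c.π (c.pt y) = y := by rw [c.inner_e_pt, c.π_pt, inv_one, one_smul]
  have h2 : DifferentiableAt ℝ (fun x => c.spt K (⟪c.e, x⟫⁻¹ • c.π x)) (c.pt y) :=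
    DifferentiableAt.comp (g := c.spt K) (c.pt y) (by rw [hy]; exact hd) h1
  have hev : ∀ᶠ x in 𝓝 (c.pt y), 0 < ⟪c.e, x⟫ := by
    have hc : Continuous fun x => ⟪c.e, x⟫ := by fun_prop
    apply hc.continuousAt.eventually
    apply lt_mem_nhds
    simp only [c.inner_e_pt]
    exact one_pos
  refine ⟨_, (h2.congr_of_eventuallyEq ?_).hasFDerivAt⟩
  filter_upwards [hev] with x hx
  have := hK.supportPoint_smul hx (c.pt_ne_zero (⟪c.e, x⟫⁻¹ • c.π x))
  rw [c.smul_pt hx.ne'] at this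
  rw [this]
  rfl

theorem hasFDerivAt_spt {A : E n →L[ℝ] E n} {y : F}
    (hA : HasFDerivAt (supportPoint K) A (c.pt y)) :
    HasFDerivAt (c.spt K) (A.comp c.ι.toContinuousLinearMap) y :=
  hA.comp y (c.hasFDerivAt_pt y)

theorem lineDeriv_spt {A : E n →L[ℝ] E n} {y : F}
    (hA : HasFDerivAt (supportPoint K) A (c.pt y)) (z : F) :
    lineDeriv ℝ (c.spt K) y z = A (c.ι z) :=
  ((c.hasFDerivAt_spt hA).hasLineDerivAt z).lineDeriv

theorem secondDeriv_eq {A : E n →L[ℝ] E n} {y : F}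
    (hA : HasFDerivAt (supportPoint K) A (c.pt y)) (z : F) :
    c.secondDeriv K z y = ⟪A (c.ι z), c.ι z⟫ := by
  have h1 : HasFDerivAt (fun y => ⟪c.spt K y, c.ι z⟫)
      ((innerSL ℝ (c.ι z)).comp (A.comp c.ι.toContinuousLinearMap)) y := by
    have := (innerSL ℝ (c.ι z)).hasFDerivAt.comp y (c.hasFDerivAt_spt hA)
    refine this.congr_of_eventuallyEq (Eventually.of_forall fun w => ?_)
    simp [real_inner_comm]
  have h2 := (h1.hasLineDerivAt z).lineDeriv
  rw [secondDeriv, h2]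
  simp [innerSL_apply_apply, real_inner_comm]

theorem defect_eq {A : E n →L[ℝ] E n} {y : F}
    (hA : HasFDerivAt (supportPoint K) A (c.pt y)) (z : F) :
    c.defect K z y = ⟪A (c.ι z), c.ι z⟫ - ‖c.pt y‖ * ‖A (c.ι z)‖ ^ 2 := by
  rw [defect, c.lineDeriv_spt hA]

end Analysis

/-! ### A local perturbation that raises the energy -/

section Bump

variable {n : ℕ} {F : Type*} [NormedAddCommGroup F] [InnerProductSpace ℝ F]

/-- A perturbation supported in the ball around `y0` of radius `ρ` that keeps two-sided gradient
bounds. -/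
structure IsLocalPerturbation (g ν : F → F) (ε σ : ℝ) (y0 : F) (ρ : ℝ) (φ : F → ℝ)
    (γ : F → F) : Prop where
  continuous : Continuous γ
  hasFDerivAt : ∀ y, HasFDerivAt φ (innerSL ℝ (γ y)) y
  abs_le : ∀ y, |φ y| ≤ σ
  supp : ∃ r < ρ, ∀ y, r ≤ ‖y - y0‖ → φ y = 0 ∧ γ y = 0
  bounds : ∀ v ∈ Metric.ball y0 ρ, ∀ w ∈ Metric.ball y0 ρ,
    ε * ⟪ν v - ν w, v - w⟫ ≤ ⟪(g v + γ v) - (g w + γ w), v - w⟫ ∧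
    ⟪(g v + γ v) - (g w + γ w), v - w⟫ ≤ (1 - ε) * ⟪ν v - ν w, v - w⟫

theorem lineDeriv_ridge (g0 y0 t y z : F) (H : F →L[ℝ] F) {k α : ℝ} (hk : 0 < k) :
    lineDeriv ℝ (fun y => ⟪g0 + H (y - y0)
      + (1 / (2 * k) * Real.sin (k * ⟪t, y - y0⟫ + α)) • t, z⟫) y z =
      ⟪H z, z⟫ + 1 / 2 * ⟪t, z⟫ ^ 2 * Real.cos (k * ⟪t, y - y0⟫ + α) := by
  have h1 : HasFDerivAt (fun y => ⟪t, y - y0⟫) (innerSL ℝ t) y := by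
    exact (innerSL ℝ t).hasFDerivAt (x := y - y0) |>.comp y ((hasFDerivAt_id y).sub_const y0)
  have h2 := (((h1.const_mul k).add_const α).sin).const_mul (1 / (2 * k))
  have h3 : HasFDerivAt (fun y => H (y - y0)) H y := by
    exact H.hasFDerivAt (x := y - y0) |>.comp y ((hasFDerivAt_id y).sub_const y0)
  have h4 := ((h3.const_add g0).add (h2.smul_const t)).inner ℝ (hasFDerivAt_const z y)
  have h5 := (h4.hasLineDerivAt z).lineDeriv
  refine h5.trans ?_
  simp only [ContinuousLinearMap.comp_apply, ContinuousLinearMap.prod_apply,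
    fderivInnerCLM_apply, zero_apply, inner_zero_right, zero_add, add_apply, smul_apply,
    ContinuousLinearMap.smulRight_apply, innerSL_apply_apply, inner_add_left, inner_smul_left,
    RCLike.conj_to_real, smul_eq_mul]
  field_simp

variable [FiniteDimensional ℝ F] [MeasurableSpace F] [BorelSpace F] (μ : Measure F)
  [μ.IsAddHaarMeasure]

/-- The four phases 0, π/2, π, 3π/2 average the square to exactly a0² + κ²/2 at every point, so one
of them does at least as well in the integral. No asymptotics in the frequency are needed. -/
theorem exists_phase (a0 κ r : ℝ) (y0 : F) {s : F → ℝ} (hs : Continuous s) :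
    ∃ α : ℝ, (a0 ^ 2 + κ ^ 2 / 2) * μ.real (Metric.ball y0 r) ≤
      ∫ y in Metric.ball y0 r, (a0 + κ * Real.cos (s y + α)) ^ 2 ∂μ := by
  by_contra! hcon
  have hint : ∀ α : ℝ, IntegrableOn (fun y => (a0 + κ * Real.cos (s y + α)) ^ 2)
      (Metric.ball y0 r) μ := fun α => by
    have hc : Continuous fun y => (a0 + κ * Real.cos (s y + α)) ^ 2 := by fun_prop
    exact (hc.continuousOn.integrableOn_compact (isCompact_closedBall y0 r)).mono_set
      Metric.ball_subset_closedBall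
  have hsum : (∫ y in Metric.ball y0 r, (a0 + κ * Real.cos (s y + 0)) ^ 2 ∂μ)
      + (∫ y in Metric.ball y0 r, (a0 + κ * Real.cos (s y + Real.pi / 2)) ^ 2 ∂μ)
      + ((∫ y in Metric.ball y0 r, (a0 + κ * Real.cos (s y + Real.pi)) ^ 2 ∂μ)
      + (∫ y in Metric.ball y0 r, (a0 + κ * Real.cos (s y + (Real.pi / 2 + Real.pi))) ^ 2 ∂μ))
      = (4 * a0 ^ 2 + 2 * κ ^ 2) * μ.real (Metric.ball y0 r) := by
    rw [← integral_add (hint _) (hint _), ← integral_add (hint _) (hint _)]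
    erw [← integral_add ((hint _).add (hint _)) ((hint _).add (hint _))]
    have : ∀ y, (a0 + κ * Real.cos (s y + 0)) ^ 2 + (a0 + κ * Real.cos (s y + Real.pi / 2)) ^ 2
        + ((a0 + κ * Real.cos (s y + Real.pi)) ^ 2
        + (a0 + κ * Real.cos (s y + (Real.pi / 2 + Real.pi))) ^ 2) = 4 * a0 ^ 2 + 2 * κ ^ 2 := by
      intro y
      rw [← add_assoc (s y), Real.cos_add_pi, Real.cos_add_pi, Real.cos_add_pi_div_two, add_zero]
      linear_combination 2 * κ ^ 2 * Real.sin_sq_add_cos_sq (s y)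
    refine (integral_congr_ae (Eventually.of_forall this)).trans ?_
    rw [setIntegral_const, smul_eq_mul, mul_comm]
  have h1 := hcon 0
  have h2 := hcon (Real.pi / 2)
  have h3 := hcon Real.pi
  have h4 := hcon (Real.pi / 2 + Real.pi)
  linarith

/-- The oscillation is exact only on the ball of radius (1 - θ)ρ; a small θ keeps the loss of volume
below κ²/8. -/
theorem exists_shrink (m : ℕ) {a κ : ℝ} (hκ : 0 < κ) :
    ∃ θ : ℝ, 0 < θ ∧ θ < 1 ∧ a ^ 2 + 3 * κ ^ 2 / 8 ≤ (1 - θ) ^ m * (a ^ 2 + κ ^ 2 / 2) := by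
  have hc : Continuous fun θ : ℝ => (1 - θ) ^ m * (a ^ 2 + κ ^ 2 / 2) := by fun_prop
  have h0 : ∀ᶠ θ in 𝓝 (0 : ℝ), a ^ 2 + 3 * κ ^ 2 / 8 < (1 - θ) ^ m * (a ^ 2 + κ ^ 2 / 2) := by
    apply hc.continuousAt.eventually
    apply lt_mem_nhds
    simp only [sub_zero, one_pow, one_mul]
    have : 0 < κ ^ 2 := by positivity
    linarith
  obtain ⟨θ, ⟨h1, h2⟩, h3⟩ := (((h0.and (eventually_lt_nhds one_pos)).filter_mono
    nhdsWithin_le_nhds).and (self_mem_nhdsWithin : Ioi (0 : ℝ) ∈ 𝓝[>] 0)).exists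
  exact ⟨θ, h3, h2, h1.le⟩

variable (c : Chart n F) {K : ConvexBody (E n)}

/-- At almost every point with positive defect there are local perturbations that increase the
integral of the squared second derivative. -/
theorem exists_isLocalPerturbation (hK : IsOfConstantWidth K 1) {ε σ c0 : ℝ} (hε : 0 < ε)
    (hε2 : ε < 1 / 2) (hKε : IsRounded K ε) (hσ : 0 < σ) (hc0 : 0 < c0) {z y0 : F} (hz : ‖z‖ ≤ 1)
    (hd : DifferentiableAt ℝ (c.spt K) y0) (hdef : c0 ≤ c.defect K z y0)
    (hleb : Tendsto (fun ρ => ⨍ y in Metric.closedBall y0 ρ, c.secondDeriv K z y ^ 2 ∂μ) (𝓝[>] 0)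
      (𝓝 (c.secondDeriv K z y0 ^ 2))) :
    ∃ ρ₀ > 0, ∀ ρ, 0 < ρ → ρ < ρ₀ → ∃ (φ : F → ℝ) (γ : F → F) (b : F → ℝ) (r : ℝ),
      IsLocalPerturbation (c.grad K) c.normGrad (ε / 4) σ y0 ρ φ γ ∧ r ≤ ρ ∧
      (∀ y ∈ Metric.ball y0 r, lineDeriv ℝ (fun y => ⟪c.grad K y + γ y, z⟫) y z = b y) ∧
      (∫ y in Metric.closedBall y0 ρ, c.secondDeriv K z y ^ 2 ∂μ)
        + c0 ^ 4 / 16 * μ.real (Metric.closedBall y0 ρ) ≤ ∫ y in Metric.ball y0 r, b y ^ 2 ∂μ := by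
  obtain ⟨A, hA⟩ := c.exists_hasFDerivAt_supportPoint hK hd
  have hp0 := c.pt_ne_zero y0
  have hp1 := c.one_le_norm_pt y0
  have hιz : ‖c.ι z‖ ≤ 1 := by rwa [LinearIsometry.norm_map]
  set H : F →L[ℝ] F := c.π.comp (A.comp c.ι.toContinuousLinearMap) with hH
  set M : F →L[ℝ] F := c.π.comp ((normalizeDeriv (c.pt y0)).comp c.ι.toContinuousLinearMap)
    with hM
  have hHi : ∀ a b, ⟪H a, b⟫ = ⟪A (c.ι a), c.ι b⟫ := fun a b => c.inner_π _ _
  have hMi : ∀ a b, ⟪M a, b⟫ = ⟪normalizeDeriv (c.pt y0) (c.ι a), c.ι b⟫ := fun a b =>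
    c.inner_π _ _
  have hsymA := hK.deriv_symm hp0 hA
  have hsym : ∀ a b, ⟪H a, b⟫ = ⟪a, H b⟫ := fun a b => by
    rw [hHi, hsymA, real_inner_comm (H b), hHi, real_inner_comm]
  have hgH : HasFDerivAt (c.grad K) H y0 := c.π.hasFDerivAt.comp y0 (c.hasFDerivAt_spt hA)
  -- The direction of oscillation: its pairing with ι z is exactly the defect.
  set T := A (c.ι z) - ‖c.pt y0‖ • A (A (c.ι z)) with hT
  set t := c.π T with ht
  have hti : ∀ d, ⟪t, d⟫ = ⟪T, c.ι d⟫ := fun d => c.inner_π _ _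
  have ht1 : ∀ d, ⟪t, d⟫ ^ 2 ≤ ⟪H d, d⟫ := fun d => by
    rw [hti, hHi]
    exact hK.rankOne_le hp1 hA hιz _
  have ht2 : ∀ d, ⟪t, d⟫ ^ 2 ≤ ⟪M d, d⟫ - ⟪H d, d⟫ := fun d => by
    rw [hti, hHi, hMi]
    exact hK.rankOne_le_compl hp1 hA hιz _
  have htz : c0 ≤ ⟪t, z⟫ := by
    refine hdef.trans_eq ?_
    rw [c.defect_eq hA, hti, hT, inner_sub_left, inner_smul_left, RCLike.conj_to_real,
      hsymA (A (c.ι z)), real_inner_self_eq_norm_sq]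
  set a0 := c.secondDeriv K z y0 with ha0
  have ha0H : a0 = ⟪H z, z⟫ := by rw [hHi, ha0, c.secondDeriv_eq hA]
  set κ := 1 / 2 * ⟪t, z⟫ ^ 2 with hκ
  have htz0 : 0 < ⟪t, z⟫ := by linarith
  have hκ0 : 0 < κ := by positivity
  obtain ⟨θ, hθ, hθ1, hθa⟩ := exists_shrink (Module.finrank ℝ F) (a := a0) hκ0
  obtain ⟨lam, hlam, hmono⟩ := c.normGrad_strongly_monotone y0
  obtain ⟨ρ1, hρ1, hpert⟩ := exists_local_perturbation (ε := ε) (θ := θ) (σ := σ)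
    (c.hasFDerivAt_supportFun_pt hK) (c.continuous_grad hK) hgH hsym hε (by linarith)
    (fun v w => by
      rw [inner_grad_sub, inner_normGrad_sub]
      exact hKε.le_inner hK (c.pt_ne_zero v) (c.pt_ne_zero w))
    (fun v w => by
      rw [inner_grad_sub, inner_normGrad_sub]
      exact hKε.inner_le hK (c.pt_ne_zero v) (c.pt_ne_zero w))
    (c.hasStrictFDerivAt_normGrad y0) hlam one_pos hmono ht1 ht2 hθ hθ1 hσ
  -- At a Lebesgue point the old energy density exceeds a0² by less than κ²/8 on small balls.
  have hlt : ∀ᶠ ρ in 𝓝[>] (0 : ℝ),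
      ⨍ y in Metric.closedBall y0 ρ, c.secondDeriv K z y ^ 2 ∂μ < a0 ^ 2 + κ ^ 2 / 8 :=
    hleb.eventually (gt_mem_nhds (by
      have : 0 < κ ^ 2 := by positivity
      linarith))
  obtain ⟨ρ2, hρ2, hav⟩ := mem_nhdsGT_iff_exists_Ioo_subset.1 hlt
  refine ⟨min ρ1 ρ2, lt_min hρ1 hρ2, fun ρ hρ hρlt => ?_⟩
  obtain ⟨hρa, hρb⟩ := lt_min_iff.1 hρlt
  obtain ⟨k, hk, hpk⟩ := hpert ρ hρ hρa
  obtain ⟨α, hα⟩ := exists_phase μ a0 κ ((1 - θ) * ρ) y0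
    (s := fun y => k * ⟪t, y - y0⟫) (by fun_prop)
  obtain ⟨φ, γ, h1, h2, h3, h4, h5, h6⟩ := hpk α
  refine ⟨φ, γ, fun y => a0 + κ * Real.cos (k * ⟪t, y - y0⟫ + α), (1 - θ) * ρ,
    ⟨h1, h2, h3, h4, h5⟩, by nlinarith, fun y hy => ?_, ?_⟩
  · have hev : (fun y => ⟪c.grad K y + γ y, z⟫) =ᶠ[𝓝 y] fun y => ⟪c.grad K y0 + H (y - y0)
        + (1 / (2 * k) * Real.sin (k * ⟪t, y - y0⟫ + α)) • t, z⟫ := by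
      filter_upwards [Metric.isOpen_ball.mem_nhds hy] with w hw
      rw [h6 w hw]
    rw [Filter.EventuallyEq.lineDeriv_eq hev, lineDeriv_ridge _ _ _ _ _ _ hk, ha0H]
  · refine le_trans ?_ hα
    set V := μ.real (Metric.closedBall y0 ρ) with hV
    have hV0 : 0 < V := by
      rw [hV, measureReal_def]
      exact ENNReal.toReal_pos (Metric.measure_closedBall_pos μ y0 hρ).ne'
        measure_closedBall_lt_top.ne
    have hVr : μ.real (Metric.ball y0 ((1 - θ) * ρ)) = (1 - θ) ^ Module.finrank ℝ F * V := by
      have hθρ : 0 < (1 - θ) * ρ := mul_pos (by linarith) hρ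
      rw [hV, measureReal_def, measureReal_def, Measure.addHaar_ball_of_pos μ y0 hθρ,
        Measure.addHaar_closedBall μ y0 hρ.le, ENNReal.toReal_mul, ENNReal.toReal_mul,
        ENNReal.toReal_ofReal (by positivity), ENNReal.toReal_ofReal (by positivity), mul_pow,
        mul_assoc]
    have hint : ∫ y in Metric.closedBall y0 ρ, c.secondDeriv K z y ^ 2 ∂μ ≤
        (a0 ^ 2 + κ ^ 2 / 8) * V := by
      have h := hav ⟨hρ, hρb⟩
      simp only [mem_ofPred_eq] at h
      rw [setAverage_eq, smul_eq_mul, inv_mul_lt_iff₀ hV0] at h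
      linarith
    -- Of the gain κ²/2, the shrinking and the Lebesgue average cost κ²/8 each. The remaining κ²/4 =
    -- ⟨t, z⟩⁴/16 is at least c0⁴/16.
    have hκc : c0 ^ 4 / 16 ≤ κ ^ 2 / 4 := by
      have : c0 ^ 4 ≤ ⟪t, z⟫ ^ 4 := by gcongr
      rw [hκ]
      nlinarith
    rw [hVr]
    have h7 := mul_le_mul_of_nonneg_right hθa hV0.le
    have h8 := mul_le_mul_of_nonneg_right hκc hV0.le
    nlinarith

end Bump

end Chart

end

end ConstWidth

/-! ### Finitely many disjoint perturbations -/

namespace ConstWidth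

noncomputable section

/-- A countable disjoint cover has a finite part of at least half the measure. -/
theorem exists_finset_of_covering {α : Type*} [MeasurableSpace α] (μ : Measure α) {Y : Set α}
    {B : α → Set α} {t : Set α} (ht : t.Countable)
    (hB : ∀ x ∈ t, MeasurableSet (B x)) (hd : t.PairwiseDisjoint B)
    (hcov : μ (Y \ ⋃ x ∈ t, B x) = 0) (hfin : ∀ x ∈ t, μ (B x) ≠ ∞) (hY : μ Y ≠ ∞)
    (hY0 : μ Y ≠ 0) :
    ∃ s : Finset α, (s : Set α) ⊆ t ∧ μ.real Y / 2 ≤ ∑ x ∈ s, μ.real (B x) := by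
  have h1 : μ Y ≤ ∑' x : t, μ (B x) := by
    rw [← measure_biUnion ht hd hB]
    calc μ Y ≤ μ ((⋃ x ∈ t, B x) ∪ (Y \ ⋃ x ∈ t, B x)) := measure_mono fun y hy => by
            by_cases h : y ∈ ⋃ x ∈ t, B x
            · exact Or.inl h
            · exact Or.inr ⟨hy, h⟩
      _ ≤ μ (⋃ x ∈ t, B x) + μ (Y \ ⋃ x ∈ t, B x) := measure_union_le _ _
      _ = _ := by rw [hcov, add_zero]
  have h2 : μ Y / 2 < ∑' x : t, μ (B x) := (ENNReal.half_lt_self hY0 hY).trans_le h1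
  rw [ENNReal.tsum_eq_iSup_sum, lt_iSup_iff] at h2
  obtain ⟨s, hs⟩ := h2
  refine ⟨s.map (Function.Embedding.subtype _), fun x hx => ?_, ?_⟩
  · simp only [Finset.coe_map, mem_image] at hx
    obtain ⟨x', -, rfl⟩ := hx
    exact x'.2
  · rw [Finset.sum_map]
    simp only [Function.Embedding.subtype_apply, measureReal_def]
    have hfin' : ∀ x ∈ s, μ (B (x : α)) ≠ ∞ := fun x _ => hfin x x.2
    rw [← ENNReal.toReal_sum hfin']
    have h3 := ENNReal.toReal_mono (ENNReal.sum_ne_top.2 hfin') hs.le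
    rwa [ENNReal.toReal_div, ENNReal.toReal_ofNat] at h3

namespace Chart

section FinitePerturbation

variable {n : ℕ} {F : Type*} [NormedAddCommGroup F] [InnerProductSpace ℝ F]

theorem IsLocalPerturbation.eq_zero {g ν : F → F} {ε σ ρ : ℝ} {y0 : F} {φ : F → ℝ} {γ : F → F}
    (h : IsLocalPerturbation g ν ε σ y0 ρ φ γ) {y : F} (hy : y ∉ Metric.ball y0 ρ) :
    φ y = 0 ∧ γ y = 0 := by
  obtain ⟨r, hr, hz⟩ := h.supp
  rw [mem_ball_iff_norm, not_lt] at hy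
  exact hz y (hr.le.trans hy)

variable {g ν : F → F} {ε σ : ℝ} {t : Finset F} {ρ : F → ℝ} {φ : F → F → ℝ} {γ : F → F → F}

theorem sum_perturbation_eq (h : ∀ j ∈ t, IsLocalPerturbation g ν ε σ j (ρ j) (φ j) (γ j))
    (hdisj : (t : Set F).PairwiseDisjoint fun j => Metric.closedBall j (ρ j)) {j y : F} (hj : j ∈ t)
    (hy : y ∈ Metric.closedBall j (ρ j)) :
    ∑ i ∈ t, φ i y = φ j y ∧ ∑ i ∈ t, γ i y = γ j y := by
  have hne : ∀ i ∈ t, i ≠ j → φ i y = 0 ∧ γ i y = 0 := fun i hi hij => by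
    refine (h i hi).eq_zero fun hyi => ?_
    exact Set.disjoint_left.1 (hdisj hi hj hij) (Metric.ball_subset_closedBall hyi) hy
  exact ⟨Finset.sum_eq_single_of_mem j hj fun i hi hij => (hne i hi hij).1,
    Finset.sum_eq_single_of_mem j hj fun i hi hij => (hne i hi hij).2⟩

theorem sum_perturbation_eq_zero (h : ∀ j ∈ t, IsLocalPerturbation g ν ε σ j (ρ j) (φ j) (γ j))
    {y : F} (hy : ∀ j ∈ t, y ∉ Metric.ball j (ρ j)) :
    ∑ i ∈ t, φ i y = 0 ∧ ∑ i ∈ t, γ i y = 0 :=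
  ⟨Finset.sum_eq_zero fun i hi => ((h i hi).eq_zero (hy i hi)).1,
    Finset.sum_eq_zero fun i hi => ((h i hi).eq_zero (hy i hi)).2⟩

/-- Each perturbation vanishes outside a radius strictly below ρ, so points on the bounding spheres
also have an unperturbed neighbourhood. -/
theorem eventually_sum_perturbation_eq_zero
    (h : ∀ j ∈ t, IsLocalPerturbation g ν ε σ j (ρ j) (φ j) (γ j))
    {y : F} (hy : ∀ j ∈ t, y ∉ Metric.ball j (ρ j)) :
    ∀ᶠ w in 𝓝 y, ∑ i ∈ t, γ i w = 0 := by
  have hev : ∀ᶠ w in 𝓝 y, ∀ i ∈ t, γ i w = 0 := by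
    rw [Filter.eventually_all_finset]
    intro i hi
    obtain ⟨r, hr, hz⟩ := (h i hi).supp
    have hyi := hy i hi
    rw [mem_ball_iff_norm, not_lt] at hyi
    have hc : Continuous fun w => ‖w - i‖ := by fun_prop
    have : ∀ᶠ w in 𝓝 y, r < ‖w - i‖ :=
      hc.continuousAt.eventually (lt_mem_nhds (hr.trans_le hyi))
    filter_upwards [this] with w hw
    exact (hz w hw.le).2
  filter_upwards [hev] with w hw
  exact Finset.sum_eq_zero hw

/-- Finitely many local perturbations with disjoint supports can be carried out simultaneously. -/
theorem exists_body_of_finite_perturbations (c : Chart n F) (K : ConstantWidthBody n)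
    (hε : 0 < ε) (hε2 : ε < 1 / 2) (hKε : IsRounded K.1 ε) (hσ : 0 ≤ σ)
    (h : ∀ j ∈ t, IsLocalPerturbation (c.grad K.1) c.normGrad (ε / 4) σ j (ρ j) (φ j) (γ j))
    (hdisj : (t : Set F).PairwiseDisjoint fun j => Metric.closedBall j (ρ j)) :
    ∃ L : ConstantWidthBody n, IsRounded L.1 (ε / 4) ∧ dist L K ≤ σ ∧
      ∀ y, c.grad L.1 y = c.grad K.1 y + ∑ j ∈ t, γ j y := by
  set Φ : F → ℝ := fun y => ∑ j ∈ t, φ j y with hΦ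
  set Γ : F → F := fun y => ∑ j ∈ t, γ j y with hΓ
  have hΓc : Continuous Γ := continuous_finsetSum _ fun j hj => (h j hj).continuous
  have hΦΓ : ∀ y, HasFDerivAt Φ (innerSL ℝ (Γ y)) y := fun y => by
    simp only [hΓ, map_sum]
    exact HasFDerivAt.fun_sum fun j hj => (h j hj).hasFDerivAt y
  -- Gradient monotonicity is needed only near each point. Inside a ball a single perturbation acts;
  -- elsewhere the body is locally unperturbed and its ε-bounds imply those for ε/4.
  have hloc : ∀ y, ∃ r > 0, ∀ w ∈ Metric.ball y r,
      ε / 4 * ⟪c.normGrad w - c.normGrad y, w - y⟫ ≤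
        ⟪(c.grad K.1 w + Γ w) - (c.grad K.1 y + Γ y), w - y⟫ ∧
      ⟪(c.grad K.1 w + Γ w) - (c.grad K.1 y + Γ y), w - y⟫ ≤
        (1 - ε / 4) * ⟪c.normGrad w - c.normGrad y, w - y⟫ := by
    intro y
    by_cases hy : ∃ j ∈ t, y ∈ Metric.ball j (ρ j)
    · obtain ⟨j, hj, hyj⟩ := hy
      obtain ⟨r, hr, hsub⟩ := Metric.isOpen_iff.1 Metric.isOpen_ball y hyj
      refine ⟨r, hr, fun w hw => ?_⟩
      have e1 := (sum_perturbation_eq h hdisj hj (Metric.ball_subset_closedBall hyj)).2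
      have e2 := (sum_perturbation_eq h hdisj hj (Metric.ball_subset_closedBall (hsub hw))).2
      simp only [hΓ, e1, e2]
      exact (h j hj).bounds w (hsub hw) y hyj
    · push Not at hy
      obtain ⟨r, hr, hz⟩ := Metric.eventually_nhds_iff_ball.1
        (eventually_sum_perturbation_eq_zero h hy)
      refine ⟨r, hr, fun w hw => ?_⟩
      have e1 := hz y (Metric.mem_ball_self hr)
      have e2 := hz w hw
      simp only [hΓ, e1, e2, add_zero]
      have l1 := hKε.le_inner K.2 (c.pt_ne_zero w) (c.pt_ne_zero y)
      have l2 := hKε.inner_le K.2 (c.pt_ne_zero w) (c.pt_ne_zero y)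
      rw [← inner_grad_sub, ← inner_normGrad_sub] at l1 l2
      have l3 := c.inner_normGrad_sub_nonneg w y
      constructor <;> nlinarith
  have hν := c.continuous_normGrad
  have hg := c.continuous_grad K.2
  obtain ⟨L, hL1, hL2, hL3⟩ := c.exists_body_of_perturbation (φ := Φ) K (ε := ε / 4) (σ := σ)
    (R := ∑ j ∈ t, (‖j‖ + |ρ j|)) (by linarith) (by linarith)
    (continuous_iff_continuousAt.2 fun y => (hΦΓ y).continuousAt) hσ
    (fun y => by
      by_cases hy : ∃ j ∈ t, y ∈ Metric.ball j (ρ j)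
      · obtain ⟨j, hj, hyj⟩ := hy
        simp only [hΦ, (sum_perturbation_eq h hdisj hj (Metric.ball_subset_closedBall hyj)).1]
        exact (h j hj).abs_le y
      · push Not at hy
        simp only [hΦ, (sum_perturbation_eq_zero h hy).1, abs_zero]
        exact hσ)
    (fun y hy => by
      refine (sum_perturbation_eq_zero h fun j hj hyj => ?_).1
      have h1 : ‖j‖ + |ρ j| ≤ ∑ j ∈ t, (‖j‖ + |ρ j|) :=
        Finset.single_le_sum (f := fun j => ‖j‖ + |ρ j|) (fun i _ => by positivity) hj
      have h2 := mem_ball_iff_norm.1 hyj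
      have h3 := norm_sub_norm_le y j
      linarith [le_abs_self (ρ j)])
    (by
      refine convexOn_univ_of_gradient
        (G := fun y => c.grad K.1 y + Γ y - (ε / 4) • c.normGrad y) (fun y => ?_) (by fun_prop)
        fun y => ?_
      · rw [map_sub, map_add]
        refine ((c.hasFDerivAt_supportFun_pt K.2 y).add (hΦΓ y)).sub ?_
        refine ((c.hasFDerivAt_norm_pt y).const_mul (ε / 4)).congr_fderiv ?_
        ext d
        simp
      · obtain ⟨r, hr, hb⟩ := hloc y
        refine ⟨r, hr, fun w hw => ?_⟩
        have := (hb w hw).1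
        have e : c.grad K.1 w + Γ w - (ε / 4) • c.normGrad w -
            (c.grad K.1 y + Γ y - (ε / 4) • c.normGrad y) =
            (c.grad K.1 w + Γ w) - (c.grad K.1 y + Γ y)
              - (ε / 4) • (c.normGrad w - c.normGrad y) := by
          rw [smul_sub]
          abel
        rw [e, inner_sub_left _ ((ε / 4) • (c.normGrad w - c.normGrad y)), inner_smul_left,
          RCLike.conj_to_real]
        linarith)
    (by
      refine convexOn_univ_of_gradient
        (G := fun y => (1 - ε / 4) • c.normGrad y - (c.grad K.1 y + Γ y)) (fun y => ?_)
        (by fun_prop) fun y => ?_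
      · rw [map_sub, map_add]
        refine HasFDerivAt.sub ?_ ((c.hasFDerivAt_supportFun_pt K.2 y).add (hΦΓ y))
        refine ((c.hasFDerivAt_norm_pt y).const_mul (1 - ε / 4)).congr_fderiv ?_
        ext d
        simp
      · obtain ⟨r, hr, hb⟩ := hloc y
        refine ⟨r, hr, fun w hw => ?_⟩
        have := (hb w hw).2
        have e : (1 - ε / 4) • c.normGrad w - (c.grad K.1 w + Γ w) -
            ((1 - ε / 4) • c.normGrad y - (c.grad K.1 y + Γ y)) =
            (1 - ε / 4) • (c.normGrad w - c.normGrad y)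
              - ((c.grad K.1 w + Γ w) - (c.grad K.1 y + Γ y)) := by
          rw [smul_sub]
          abel
        rw [e, inner_sub_left ((1 - ε / 4) • (c.normGrad w - c.normGrad y)), inner_smul_left,
          RCLike.conj_to_real]
        linarith)
  refine ⟨L, hL1, hL2, fun y => ?_⟩
  have h1 := c.hasFDerivAt_supportFun_pt L.2 y
  have h2 : HasFDerivAt (fun y => supportFun L.1 (c.pt y)) (innerSL ℝ (c.grad K.1 y + Γ y)) y := by
    rw [map_add]
    exact ((c.hasFDerivAt_supportFun_pt K.2 y).add (hΦΓ y)).congr_of_eventuallyEq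
      (Eventually.of_forall hL3)
  have h3 := h1.unique h2
  have h4 : ∀ d, ⟪c.grad L.1 y, d⟫ = ⟪c.grad K.1 y + Γ y, d⟫ := fun d => by
    simpa only [innerSL_apply_apply] using DFunLike.congr_fun h3 d
  exact ext_inner_right ℝ h4

end FinitePerturbation

/-! ### Bounds and measurability of energy and defect -/

section Energy

variable {n : ℕ} {F : Type*} [NormedAddCommGroup F] [InnerProductSpace ℝ F] (c : Chart n F)
  {K : ConvexBody (E n)} {z : F}

theorem abs_secondDeriv_le (hK : IsOfConstantWidth K 1) (hz : ‖z‖ ≤ 1) (y : F) :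
    |c.secondDeriv K z y| ≤ 1 := by
  have hl : LipschitzWith 1 fun y => ⟪c.spt K y, c.ι z⟫ := by
    refine LipschitzWith.of_dist_le_mul fun v w => ?_
    rw [Real.dist_eq, ← inner_sub_left, NNReal.coe_one, one_mul]
    refine (abs_real_inner_le_norm _ _).trans ?_
    have h1 := (c.lipschitzWith_spt hK).dist_le_mul v w
    rw [dist_eq_norm, NNReal.coe_one, one_mul] at h1
    rw [LinearIsometry.norm_map]
    calc _ ≤ dist v w * 1 := by gcongr
      _ = _ := mul_one _
  have := norm_lineDeriv_le_of_lipschitz ℝ hl (x₀ := y) (v := z)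
  rw [NNReal.coe_one, one_mul, Real.norm_eq_abs] at this
  exact this.trans hz

theorem norm_lineDeriv_spt_le (hK : IsOfConstantWidth K 1) (hz : ‖z‖ ≤ 1) (y : F) :
    ‖lineDeriv ℝ (c.spt K) y z‖ ≤ 1 := by
  have := norm_lineDeriv_le_of_lipschitz ℝ (c.lipschitzWith_spt hK) (x₀ := y) (v := z)
  rw [NNReal.coe_one, one_mul] at this
  exact this.trans hz

/-- Stated for an arbitrary vector D so as to serve both the defect and its difference-quotient
version. -/
theorem abs_inner_sub_le {D : E n} (hD : ‖D‖ ≤ 1) (hz : ‖z‖ ≤ 1) {R : ℝ} {y : F} (hy : ‖y‖ ≤ R) :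
    |⟪D, c.ι z⟫ - ‖c.pt y‖ * ‖D‖ ^ 2| ≤ 2 + R := by
  have hR : 0 ≤ R := (norm_nonneg y).trans hy
  have h1 : |⟪D, c.ι z⟫| ≤ 1 := by
    refine (abs_real_inner_le_norm _ _).trans ?_
    rw [LinearIsometry.norm_map]
    exact mul_le_one₀ hD (norm_nonneg _) hz
  have h2 : ‖c.pt y‖ * ‖D‖ ^ 2 ≤ (1 + R) * 1 := by
    have h3 : ‖D‖ ^ 2 ≤ 1 := pow_le_one₀ (norm_nonneg _) hD
    have h4 := c.norm_pt_le y
    gcongr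
    linarith
  have h3 : 0 ≤ ‖c.pt y‖ * ‖D‖ ^ 2 := by positivity
  rw [abs_le] at h1 ⊢
  constructor <;> linarith [h1.1, h1.2]

theorem abs_defect_le (hK : IsOfConstantWidth K 1) (hz : ‖z‖ ≤ 1) {R : ℝ} {y : F}
    (hy : ‖y‖ ≤ R) : |c.defect K z y| ≤ 2 + R :=
  c.abs_inner_sub_le (c.norm_lineDeriv_spt_le hK hz y) hz hy

variable [MeasurableSpace F] [BorelSpace F]

theorem measurable_secondDeriv (hK : IsOfConstantWidth K 1) :
    Measurable (c.secondDeriv K z) := by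
  have := (c.lipschitzWith_spt hK).continuous
  exact measurable_lineDeriv (by fun_prop)

theorem measurable_defect (hK : IsOfConstantWidth K 1) : Measurable (c.defect K z) := by
  have h1 : Measurable fun y => lineDeriv ℝ (c.spt K) y z :=
    measurable_lineDeriv (c.lipschitzWith_spt hK).continuous
  have h2 : Measurable fun y => ‖c.pt y‖ := c.continuous_pt.norm.measurable
  exact (h1.inner_const).sub (h2.mul (h1.norm.pow_const 2))

variable [FiniteDimensional ℝ F] (μ : Measure F) [μ.IsAddHaarMeasure]

theorem ae_differentiableAt_spt (hK : IsOfConstantWidth K 1) :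
    ∀ᵐ y ∂μ, DifferentiableAt ℝ (c.spt K) y :=
  (c.lipschitzWith_spt hK).ae_differentiableAt

theorem locallyIntegrable_secondDeriv_sq (hK : IsOfConstantWidth K 1) (hz : ‖z‖ ≤ 1) :
    LocallyIntegrable (fun y => c.secondDeriv K z y ^ 2) μ := by
  refine (locallyIntegrable_const (1 : ℝ)).mono
    ((c.measurable_secondDeriv hK).pow_const 2).aestronglyMeasurable
    (Eventually.of_forall fun y => ?_)
  rw [norm_pow, Real.norm_eq_abs, norm_one]
  exact pow_le_one₀ (abs_nonneg _) (c.abs_secondDeriv_le hK hz y)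

theorem integrableOn_secondDeriv_sq (hK : IsOfConstantWidth K 1) (hz : ‖z‖ ≤ 1) {s : Set F}
    {R : ℝ} (hs : s ⊆ Metric.closedBall 0 R) :
    IntegrableOn (fun y => c.secondDeriv K z y ^ 2) s μ :=
  ((c.locallyIntegrable_secondDeriv_sq μ hK hz).integrableOn_isCompact
    (isCompact_closedBall 0 R)).mono_set hs

theorem ae_tendsto_average_secondDeriv_sq (hK : IsOfConstantWidth K 1) (hz : ‖z‖ ≤ 1) :
    ∀ᵐ y0 ∂μ, Tendsto (fun ρ => ⨍ y in Metric.closedBall y0 ρ, c.secondDeriv K z y ^ 2 ∂μ) (𝓝[>] 0)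
      (𝓝 (c.secondDeriv K z y0 ^ 2)) := by
  have h := IsUnifLocDoublingMeasure.ae_tendsto_average μ
    (c.locallyIntegrable_secondDeriv_sq μ hK hz) 1
  filter_upwards [h] with y0 h0
  refine h0 (fun _ => y0) id tendsto_id ?_
  filter_upwards [self_mem_nhdsWithin] with ρ hρ
  have hρ : 0 < ρ := hρ
  exact Metric.mem_closedBall_self (by simpa using hρ.le)

end Energy

end Chart

end

end ConstWidth

/-! ### Energy gain and density of small defect -/

namespace ConstWidth

noncomputable section

namespace Chart

variable {n : ℕ} {F : Type*} [NormedAddCommGroup F] [InnerProductSpace ℝ F] (c : Chart n F)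
  {z : F}

theorem secondDeriv_congr {K : ConvexBody (E n)} {g : F → F} {y : F} (h : c.grad K =ᶠ[𝓝 y] g) :
    c.secondDeriv K z y = lineDeriv ℝ (fun y => ⟪g y, z⟫) y z := by
  refine Filter.EventuallyEq.lineDeriv_eq ?_
  filter_upwards [h] with w hw
  rw [← c.inner_grad, hw]

variable [FiniteDimensional ℝ F] [MeasurableSpace F] [BorelSpace F] (μ : Measure F)
  [μ.IsAddHaarMeasure]

/-- The energy of a rounded body can be increased by an amount controlled by the measure of the
set of points with large defect. -/
theorem exists_energy_gain (K : ConstantWidthBody n) {ε σ c0 R : ℝ} (hε : 0 < ε)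
    (hε2 : ε < 1 / 2) (hKε : IsRounded K.1 ε) (hσ : 0 < σ) (hc0 : 0 < c0) (hz : ‖z‖ ≤ 1) :
    ∃ L : ConstantWidthBody n, IsRounded L.1 (ε / 4) ∧ dist L K ≤ σ ∧
      (∫ y in Metric.ball 0 R, c.secondDeriv K.1 z y ^ 2 ∂μ)
        + c0 ^ 4 / 32 * μ.real {y ∈ Metric.ball 0 R | c0 ≤ c.defect K.1 z y} ≤
      ∫ y in Metric.ball 0 R, c.secondDeriv L.1 z y ^ 2 ∂μ := by
  set Y₀ : Set F := {y ∈ Metric.ball 0 R | c0 ≤ c.defect K.1 z y} with hY₀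
  set G : Set F := {y0 | DifferentiableAt ℝ (c.spt K.1) y0 ∧
    Tendsto (fun ρ => ⨍ y in Metric.closedBall y0 ρ, c.secondDeriv K.1 z y ^ 2 ∂μ) (𝓝[>] 0)
      (𝓝 (c.secondDeriv K.1 z y0 ^ 2))} with hG
  have hGae : μ Gᶜ = 0 :=
    mem_ae_iff.1 ((c.ae_differentiableAt_spt μ K.2).and
      (c.ae_tendsto_average_secondDeriv_sq μ K.2 hz))
  set Y := Y₀ ∩ G with hYdef
  have hYm : μ Y = μ Y₀ := measure_inter_conull hGae
  have hYr : μ.real Y₀ = μ.real Y := by rw [measureReal_def, measureReal_def, hYm]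
  have hYball : Y ⊆ Metric.ball 0 R := fun y hy => hy.1.1
  have hYfin : μ Y ≠ ∞ := ((measure_mono hYball).trans_lt measure_ball_lt_top).ne
  rcases eq_or_ne (μ Y) 0 with h0 | h0
  · refine ⟨K, hKε.mono (by linarith), by rw [dist_self]; exact hσ.le, ?_⟩
    rw [hYr, measureReal_def, h0, ENNReal.toReal_zero, mul_zero, add_zero]
  have hloc : ∀ y ∈ Y, ∃ ρ₀ > 0, ∀ ρ, 0 < ρ → ρ < ρ₀ →
      ∃ (φ : F → ℝ) (γ : F → F) (b : F → ℝ) (r : ℝ),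
      IsLocalPerturbation (c.grad K.1) c.normGrad (ε / 4) σ y ρ φ γ ∧ r ≤ ρ ∧
      (∀ w ∈ Metric.ball y r, lineDeriv ℝ (fun y => ⟪c.grad K.1 y + γ y, z⟫) w z = b w) ∧
      (∫ w in Metric.closedBall y ρ, c.secondDeriv K.1 z w ^ 2 ∂μ)
        + c0 ^ 4 / 16 * μ.real (Metric.closedBall y ρ) ≤ ∫ w in Metric.ball y r, b w ^ 2 ∂μ :=
    fun y hy => c.exists_isLocalPerturbation μ K.2 hε hε2 hKε hσ hc0 hz hy.2.1 hy.1.2 hy.2.2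
  choose! ρ₀ hρ₀ hloc using hloc
  -- Besicovitch covering by disjoint balls. The cap R - ‖x‖ on the radii keeps the balls inside the
  -- domain of integration.
  obtain ⟨t, ρ, htc, htY, htρ, hcov, hdisj⟩ := Besicovitch.exists_disjoint_closedBall_covering_ae μ
    (fun _ => univ) Y (fun x _ δ hδ => ⟨δ / 2, mem_univ _, by constructor <;> linarith⟩)
    (fun x => min (ρ₀ x) (R - ‖x‖)) fun x hx =>
      lt_min (hρ₀ x hx) (by linarith [mem_ball_zero_iff.1 (hYball hx)])
  obtain ⟨s, hst, hs⟩ := exists_finset_of_covering μ htc (fun x _ => measurableSet_closedBall)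
    hdisj hcov (fun x _ => (isCompact_closedBall x (ρ x)).measure_lt_top.ne) hYfin h0
  have hex : ∀ j ∈ s, ∃ (φ : F → ℝ) (γ : F → F) (b : F → ℝ) (r : ℝ),
      IsLocalPerturbation (c.grad K.1) c.normGrad (ε / 4) σ j (ρ j) φ γ ∧ r ≤ ρ j ∧
      (∀ w ∈ Metric.ball j r, lineDeriv ℝ (fun y => ⟪c.grad K.1 y + γ y, z⟫) w z = b w) ∧
      (∫ w in Metric.closedBall j (ρ j), c.secondDeriv K.1 z w ^ 2 ∂μ)
        + c0 ^ 4 / 16 * μ.real (Metric.closedBall j (ρ j)) ≤ ∫ w in Metric.ball j r, b w ^ 2 ∂μ :=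
    fun j hj => hloc j (htY (hst hj)) (ρ j) (htρ j (hst hj)).2.1
      ((htρ j (hst hj)).2.2.trans_le (min_le_left _ _))
  choose! φ γ b r hφ hr hb hgain using hex
  have hsdisj : (s : Set F).PairwiseDisjoint fun j => Metric.closedBall j (ρ j) :=
    hdisj.subset hst
  obtain ⟨L, hL1, hL2, hL3⟩ := c.exists_body_of_finite_perturbations K hε hε2 hKε hσ.le hφ hsdisj
  refine ⟨L, hL1, hL2, ?_⟩
  have hcb : ∀ j ∈ s, Metric.closedBall j (ρ j) ⊆ Metric.ball 0 R := fun j hj w hw => by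
    have h1 := (htρ j (hst hj)).2.2.trans_le (min_le_right _ _)
    rw [mem_closedBall_iff_norm] at hw
    rw [mem_ball_zero_iff]
    linarith [norm_sub_norm_le w j]
  set U : Set F := ⋃ j ∈ s, Metric.closedBall j (ρ j) with hU
  have hUm : MeasurableSet U := s.measurableSet_biUnion fun j _ => measurableSet_closedBall
  have hUR : U ⊆ Metric.ball 0 R := iUnion₂_subset hcb
  have hint : ∀ (M : ConstantWidthBody n) {S : Set F}, S ⊆ Metric.ball 0 R →
      IntegrableOn (fun y => c.secondDeriv M.1 z y ^ 2) S μ := fun M S hS =>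
    c.integrableOn_secondDeriv_sq μ M.2 hz (hS.trans Metric.ball_subset_closedBall)
  have hsplit : ∀ M : ConstantWidthBody n,
      ∫ y in Metric.ball 0 R, c.secondDeriv M.1 z y ^ 2 ∂μ =
        ∑ j ∈ s, (∫ y in Metric.closedBall j (ρ j), c.secondDeriv M.1 z y ^ 2 ∂μ) +
          ∫ y in Metric.ball 0 R \ U, c.secondDeriv M.1 z y ^ 2 ∂μ := fun M => by
    rw [← integral_biUnion_finset s (fun j _ => measurableSet_closedBall) hsdisj
      fun j hj => hint M (hcb j hj), ← setIntegral_union disjoint_sdiff_right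
      (measurableSet_ball.diff hUm) (hint M hUR) (hint M sdiff_subset), union_sdiff_cancel hUR]
  have hout : ∫ y in Metric.ball 0 R \ U, c.secondDeriv L.1 z y ^ 2 ∂μ =
      ∫ y in Metric.ball 0 R \ U, c.secondDeriv K.1 z y ^ 2 ∂μ := by
    refine setIntegral_congr_fun (measurableSet_ball.diff hUm) fun y hy => ?_
    have h1 : ∀ j ∈ s, y ∉ Metric.ball j (ρ j) := fun j hj hyj =>
      hy.2 (mem_biUnion hj (Metric.ball_subset_closedBall hyj))
    have h2 : c.secondDeriv L.1 z y = lineDeriv ℝ (fun y => ⟪c.grad K.1 y, z⟫) y z := by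
      refine c.secondDeriv_congr ?_
      filter_upwards [eventually_sum_perturbation_eq_zero hφ h1] with w hw
      rw [hL3, hw, add_zero]
    simp only [h2, c.secondDeriv_congr (K := K.1) (EventuallyEq.refl _ _)]
  have hin : ∀ j ∈ s, (∫ y in Metric.closedBall j (ρ j), c.secondDeriv K.1 z y ^ 2 ∂μ)
        + c0 ^ 4 / 16 * μ.real (Metric.closedBall j (ρ j)) ≤
      ∫ y in Metric.closedBall j (ρ j), c.secondDeriv L.1 z y ^ 2 ∂μ := fun j hj => by
    have hsub : Metric.ball j (r j) ⊆ Metric.closedBall j (ρ j) :=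
      Metric.ball_subset_closedBall.trans (Metric.closedBall_subset_closedBall (hr j hj))
    refine (hgain j hj).trans ?_
    have h1 : ∫ y in Metric.ball j (r j), b j y ^ 2 ∂μ =
        ∫ y in Metric.ball j (r j), c.secondDeriv L.1 z y ^ 2 ∂μ := by
      refine setIntegral_congr_fun measurableSet_ball fun y hy => ?_
      have h2 : c.secondDeriv L.1 z y =
          lineDeriv ℝ (fun y => ⟪c.grad K.1 y + γ j y, z⟫) y z := by
        refine c.secondDeriv_congr ?_
        filter_upwards [Metric.isOpen_ball.mem_nhds hy] with w hw
        rw [hL3, (sum_perturbation_eq hφ hsdisj hj (hsub hw)).2]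
      simp only [h2, hb j hj y hy]
    rw [h1]
    exact setIntegral_mono_set (hint L (hcb j hj)) (Eventually.of_forall fun y => sq_nonneg _)
      hsub.eventuallyLE
  have hsum := Finset.sum_le_sum hin
  rw [Finset.sum_add_distrib, ← Finset.mul_sum] at hsum
  rw [hsplit K, hsplit L, hout, hYr]
  -- The finite subfamily retains half of the measure, which turns 1/16 into 1/32.
  have h5 : c0 ^ 4 / 16 * (μ.real Y / 2) ≤
      c0 ^ 4 / 16 * ∑ j ∈ s, μ.real (Metric.closedBall j (ρ j)) := by gcongr
  linarith

theorem integral_secondDeriv_sq_le (K : ConstantWidthBody n) (hz : ‖z‖ ≤ 1) (R : ℝ) :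
    ∫ y in Metric.ball 0 R, c.secondDeriv K.1 z y ^ 2 ∂μ ≤ μ.real (Metric.ball (0 : F) R) := by
  have h : ∫ y in Metric.ball 0 R, c.secondDeriv K.1 z y ^ 2 ∂μ ≤
      ∫ y in Metric.ball (0 : F) R, (1 : ℝ) ∂μ := by
    refine setIntegral_mono_on (c.integrableOn_secondDeriv_sq μ K.2 hz
      Metric.ball_subset_closedBall) (integrableOn_const measure_ball_lt_top.ne)
      measurableSet_ball fun y _ => ?_
    rw [← sq_abs]
    exact pow_le_one₀ (abs_nonneg _) (c.abs_secondDeriv_le K.2 hz y)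
  simpa using h

theorem integrableOn_defect (K : ConstantWidthBody n) (hz : ‖z‖ ≤ 1) (R : ℝ) :
    IntegrableOn (c.defect K.1 z) (Metric.ball 0 R) μ := by
  refine Measure.integrableOn_of_bounded (M := 2 + R) measure_ball_lt_top.ne
    (c.measurable_defect K.2).aestronglyMeasurable ?_
  filter_upwards [ae_restrict_mem measurableSet_ball] with y hy
  exact c.abs_defect_le K.2 hz (mem_ball_zero_iff.1 hy).le

/-- The defect is at most c0 off the bad set and at most 2 + R on it. -/
theorem integral_defect_le (K : ConstantWidthBody n) (hz : ‖z‖ ≤ 1) {R c0 : ℝ}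
    (hc0 : 0 ≤ c0) :
    ∫ y in Metric.ball 0 R, c.defect K.1 z y ∂μ ≤ c0 * μ.real (Metric.ball (0 : F) R) +
      (2 + R) * μ.real {y ∈ Metric.ball 0 R | c0 ≤ c.defect K.1 z y} := by
  set S : Set F := {y | c0 ≤ c.defect K.1 z y} with hS
  have hSm : MeasurableSet S := measurableSet_le measurable_const (c.measurable_defect K.2)
  have hfin : μ (Metric.ball (0 : F) R) ≠ ∞ := measure_ball_lt_top.ne
  have hi : IntegrableOn (S.indicator fun _ => 2 + R) (Metric.ball 0 R) μ :=
    (integrableOn_const hfin).indicator hSm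
  have hle : ∫ y in Metric.ball 0 R, c.defect K.1 z y ∂μ ≤
      ∫ y in Metric.ball (0 : F) R, (c0 + S.indicator (fun _ => 2 + R) y) ∂μ := by
    refine setIntegral_mono_on (c.integrableOn_defect μ K hz R)
      ((integrableOn_const hfin).add hi) measurableSet_ball fun y hy => ?_
    by_cases h : y ∈ S
    · rw [indicator_of_mem h]
      have := (le_abs_self _).trans (c.abs_defect_le K.2 hz (mem_ball_zero_iff.1 hy).le)
      linarith
    · rw [indicator_of_notMem h, add_zero]
      exact (not_le.1 h).le
  refine hle.trans_eq ?_
  have hc : Integrable (fun _ : F => c0) (μ.restrict (Metric.ball 0 R)) := integrableOn_const hfin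
  rw [integral_add hc hi, integral_indicator hSm,
    Measure.restrict_restrict hSm, setIntegral_const, setIntegral_const, smul_eq_mul, smul_eq_mul,
    mul_comm, mul_comm (μ.real (S ∩ _)), inter_comm]
  rfl

/-- Bodies with small total defect are dense. -/
theorem exists_integral_defect_lt (K₀ : ConstantWidthBody n) (hz : ‖z‖ ≤ 1) {R δ η : ℝ}
    (hR : 0 ≤ R) (hδ : 0 < δ) (hη : 0 < η) :
    ∃ K : ConstantWidthBody n, dist K K₀ < δ ∧
      ∫ y in Metric.ball 0 R, c.defect K.1 z y ∂μ < η := by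
  by_contra! hcon
  set V := μ.real (Metric.ball (0 : F) R) with hV
  have hV0 : 0 ≤ V := measureReal_nonneg
  set c0 := η / (2 * (V + 1)) with hc0
  have hc0p : 0 < c0 := by positivity
  have hc0V : c0 * V ≤ η / 2 := by
    rw [hc0, div_mul_eq_mul_div, div_le_div_iff₀ (by positivity) (by positivity)]
    nlinarith
  set J : ConstantWidthBody n → ℝ := fun K => ∫ y in Metric.ball 0 R, c.secondDeriv K.1 z y ^ 2 ∂μ
    with hJ
  -- The rounding ε is not fixed, since a perturbation divides it by 4. The supremum argument still
  -- closes because the gain a below does not involve ε.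
  set 𝒮 : Set (ConstantWidthBody n) :=
    {K | dist K K₀ < δ ∧ ∃ ε, 0 < ε ∧ ε < 1 / 2 ∧ IsRounded K.1 ε} with h𝒮
  have hne : (J '' 𝒮).Nonempty := by
    obtain ⟨L, ε, h1, h2, h3, h4⟩ := exists_isRounded_dist_lt K₀ hδ
    exact ⟨_, L, ⟨h4, ε, h1, h2, h3⟩, rfl⟩
  have hbdd : BddAbove (J '' 𝒮) := by
    refine ⟨V, ?_⟩
    rintro _ ⟨K, -, rfl⟩
    exact c.integral_secondDeriv_sq_le μ K hz R
  set a := c0 ^ 4 / 32 * (η / 2 / (2 + R)) with ha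
  have hap : 0 < a := by positivity
  obtain ⟨_, ⟨K, hK, rfl⟩, hlt⟩ := exists_lt_of_lt_csSup hne (sub_lt_self (sSup (J '' 𝒮)) hap)
  obtain ⟨hKd, ε, hε, hε2, hKε⟩ := hK
  obtain ⟨L, hL1, hL2, hL3⟩ := c.exists_energy_gain μ K (σ := (δ - dist K K₀) / 2) (R := R) hε hε2
    hKε (by linarith) hc0p hz
  have hL : L ∈ 𝒮 := by
    refine ⟨?_, ε / 4, by positivity, by linarith, hL1⟩
    linarith [dist_triangle L K K₀]
  have h1 : J L ≤ sSup (J '' 𝒮) := le_csSup hbdd ⟨L, hL, rfl⟩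
  have h2 := (hcon K hKd).trans (c.integral_defect_le μ K hz hc0p.le)
  have h3 : η / 2 / (2 + R) ≤ μ.real {y ∈ Metric.ball 0 R | c0 ≤ c.defect K.1 z y} := by
    rw [div_le_iff₀ (by positivity)]
    linarith
  have h4 : a ≤ c0 ^ 4 / 32 * μ.real {y ∈ Metric.ball 0 R | c0 ≤ c.defect K.1 z y} := by
    rw [ha]
    gcongr
  linarith

end Chart

end

end ConstWidth

namespace ConstWidth

noncomputable section

namespace Chart

/-! ### The category argument -/

section Residual

variable {n : ℕ} {F : Type*} [NormedAddCommGroup F] [InnerProductSpace ℝ F] (c : Chart n F)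
  {z : F}

/-- The difference quotient of the support point map in direction `z`. -/
def diffQuot (K : ConvexBody (E n)) (z : F) (δ : ℝ) (y : F) : E n :=
  δ⁻¹ • (c.spt K (y + δ • z) - c.spt K y)

/-- The defect, with the derivative replaced by a difference quotient. -/
def quotDefect (K : ConvexBody (E n)) (z : F) (δ : ℝ) (y : F) : ℝ :=
  ⟪c.diffQuot K z δ y, c.ι z⟫ - ‖c.pt y‖ * ‖c.diffQuot K z δ y‖ ^ 2

theorem norm_diffQuot_le {K : ConvexBody (E n)} (hK : IsOfConstantWidth K 1) (hz : ‖z‖ ≤ 1)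
    {δ : ℝ} (hδ : 0 < δ) (y : F) : ‖c.diffQuot K z δ y‖ ≤ 1 := by
  have h := (c.lipschitzWith_spt hK).dist_le_mul (y + δ • z) y
  rw [dist_eq_norm, dist_eq_norm, add_sub_cancel_left, NNReal.coe_one, one_mul, norm_smul,
    Real.norm_of_nonneg hδ.le] at h
  rw [diffQuot, norm_smul, norm_inv, Real.norm_of_nonneg hδ.le, inv_mul_le_iff₀ hδ]
  exact h.trans (by gcongr)

theorem continuous_quotDefect {K : ConvexBody (E n)} (hK : IsOfConstantWidth K 1) (δ : ℝ) :
    Continuous (c.quotDefect K z δ) := by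
  have h1 := (c.lipschitzWith_spt hK).continuous
  have h2 := c.continuous_pt
  unfold quotDefect diffQuot
  fun_prop

theorem continuous_quotDefect_body (δ : ℝ) (y : F) :
    Continuous fun K : ConstantWidthBody n => c.quotDefect K.1 z δ y := by
  have h1 : ∀ y, Continuous fun K : ConstantWidthBody n => c.spt K.1 y := fun y =>
    continuous_supportPoint_body (c.pt_ne_zero y)
  have h2 := h1 y
  have h3 := h1 (y + δ • z)
  unfold quotDefect diffQuot
  fun_prop

theorem tendsto_quotDefect {K : ConvexBody (E n)} {y : F}
    (hd : DifferentiableAt ℝ (c.spt K) y) :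
    Tendsto (fun k : ℕ => c.quotDefect K z (1 / ((k : ℝ) + 1)) y) atTop (𝓝 (c.defect K z y)) := by
  have h1 : Tendsto (fun k : ℕ => 1 / ((k : ℝ) + 1)) atTop (𝓝[≠] 0) := by
    refine tendsto_nhdsWithin_iff.2 ⟨tendsto_one_div_add_atTop_nhds_zero_nat,
      Eventually.of_forall fun k => ?_⟩
    have : 0 < 1 / ((k : ℝ) + 1) := by positivity
    exact this.ne'
  have h2 : Tendsto (fun k : ℕ => c.diffQuot K z (1 / ((k : ℝ) + 1)) y) atTop
      (𝓝 (lineDeriv ℝ (c.spt K) y z)) :=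
    (hd.lineDifferentiableAt.hasLineDerivAt.tendsto_slope_zero).comp h1
  exact (h2.inner tendsto_const_nhds).sub (tendsto_const_nhds.mul (h2.norm.pow 2))

theorem defect_nonneg {K : ConvexBody (E n)} (hK : IsOfConstantWidth K 1) {y : F}
    (hd : DifferentiableAt ℝ (c.spt K) y) : 0 ≤ c.defect K z y := by
  obtain ⟨A, hA⟩ := c.exists_hasFDerivAt_supportPoint hK hd
  rw [c.defect_eq hA]
  linarith [hK.deriv_firm (c.pt_ne_zero y) hA (c.ι z)]

variable [MeasurableSpace F] [BorelSpace F] (μ : Measure F)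

theorem ae_abs_quotDefect_le (K : ConstantWidthBody n) (hz : ‖z‖ ≤ 1) (R : ℝ) {δ : ℝ}
    (hδ : 0 < δ) : ∀ᵐ y ∂μ.restrict (Metric.ball 0 R), ‖c.quotDefect K.1 z δ y‖ ≤ 2 + R := by
  filter_upwards [ae_restrict_mem measurableSet_ball] with y hy
  exact c.abs_inner_sub_le (c.norm_diffQuot_le K.2 hz hδ y) hz (mem_ball_zero_iff.1 hy).le

variable [FiniteDimensional ℝ F] [μ.IsAddHaarMeasure]

theorem continuous_integral_quotDefect (hz : ‖z‖ ≤ 1) (R : ℝ) {δ : ℝ} (hδ : 0 < δ) :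
    Continuous fun K : ConstantWidthBody n => ∫ y in Metric.ball 0 R, c.quotDefect K.1 z δ y ∂μ :=
  continuous_of_dominated (bound := fun _ => 2 + R)
    (fun K => (c.continuous_quotDefect K.2 δ).aestronglyMeasurable)
    (fun K => c.ae_abs_quotDefect_le μ K hz R hδ)
    (integrableOn_const measure_ball_lt_top.ne)
    (Eventually.of_forall fun y => c.continuous_quotDefect_body δ y)

theorem tendsto_integral_quotDefect (K : ConstantWidthBody n) (hz : ‖z‖ ≤ 1) (R : ℝ) :
    Tendsto (fun k : ℕ => ∫ y in Metric.ball 0 R, c.quotDefect K.1 z (1 / ((k : ℝ) + 1)) y ∂μ) atTop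
      (𝓝 (∫ y in Metric.ball 0 R, c.defect K.1 z y ∂μ)) := by
  refine tendsto_integral_of_dominated_convergence (fun _ => 2 + R)
    (fun k => (c.continuous_quotDefect K.2 _).aestronglyMeasurable)
    (integrableOn_const measure_ball_lt_top.ne)
    (fun k => c.ae_abs_quotDefect_le μ K hz R (by positivity)) ?_
  filter_upwards [ae_restrict_of_ae (c.ae_differentiableAt_spt μ K.2)] with y hy
  exact c.tendsto_quotDefect hy

/-- The defect integral need not be continuous in K, but its difference-quotient versions Φ k are,
and they converge to it. Hence each O m is open, and dense because bodies with small defect are. A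
body in all O m has arbitrarily small Φ k for arbitrarily large k, so the limit is at most 0. -/
theorem eventually_integral_defect_le_zero (hz : ‖z‖ ≤ 1) {R : ℝ} (hR : 0 ≤ R) :
    ∀ᶠ K : ConstantWidthBody n in residual (ConstantWidthBody n),
      ∫ y in Metric.ball 0 R, c.defect K.1 z y ∂μ ≤ 0 := by
  set Φ : ℕ → ConstantWidthBody n → ℝ := fun k K =>
    ∫ y in Metric.ball 0 R, c.quotDefect K.1 z (1 / ((k : ℝ) + 1)) y ∂μ with hΦ
  set O : ℕ → Set (ConstantWidthBody n) := fun m => ⋃ k ≥ m, {K | Φ k K < 1 / ((m : ℝ) + 1)}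
    with hO
  have hopen : ∀ m, IsOpen (O m) := fun m => isOpen_biUnion fun k _ =>
    isOpen_lt (c.continuous_integral_quotDefect μ hz R (by positivity)) continuous_const
  have hdense : ∀ m, Dense (O m) := fun m => Metric.dense_iff.2 fun K₀ r hr => by
    obtain ⟨K, h1, h2⟩ := c.exists_integral_defect_lt μ K₀ hz hR hr
      (η := 1 / ((m : ℝ) + 1)) (by positivity)
    obtain ⟨k, h3, h4⟩ := (((c.tendsto_integral_quotDefect μ K hz R).eventually
      (gt_mem_nhds h2)).and (eventually_ge_atTop m)).exists
    exact ⟨K, h1, mem_iUnion₂.2 ⟨k, h4, h3⟩⟩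
  have hall : ∀ᶠ K in residual (ConstantWidthBody n), ∀ m, K ∈ O m :=
    eventually_countable_forall.2 fun m => residual_of_dense_open (hopen m) (hdense m)
  filter_upwards [hall] with K hK
  by_contra! hpos
  set I := ∫ y in Metric.ball 0 R, c.defect K.1 z y ∂μ with hI
  obtain ⟨N, hN⟩ := eventually_atTop.1 ((c.tendsto_integral_quotDefect μ K hz R).eventually
    (lt_mem_nhds (half_lt_self hpos)))
  obtain ⟨M, hM⟩ := exists_nat_one_div_lt (half_pos hpos)
  obtain ⟨k, hk, hlt⟩ := mem_iUnion₂.1 (hK (max N M))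
  have h1 := hN k ((le_max_left _ _).trans hk)
  have h2 : 1 / (((max N M : ℕ) : ℝ) + 1) ≤ 1 / ((M : ℝ) + 1) := by
    have : (M : ℝ) ≤ ((max N M : ℕ) : ℝ) := by exact_mod_cast le_max_right _ _
    gcongr
  have h3 : Φ k K < 1 / (((max N M : ℕ) : ℝ) + 1) := hlt
  have h4 : I / 2 < Φ k K := h1
  linarith

/-- For a typical body, the defect in a given direction vanishes almost everywhere. -/
theorem eventually_ae_defect_eq_zero (hz : ‖z‖ ≤ 1) :
    ∀ᶠ K : ConstantWidthBody n in residual (ConstantWidthBody n),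
      ∀ᵐ y ∂μ, c.defect K.1 z y = 0 := by
  have hall : ∀ᶠ K : ConstantWidthBody n in residual (ConstantWidthBody n), ∀ R : ℕ,
      ∫ y in Metric.ball 0 (R : ℝ), c.defect K.1 z y ∂μ ≤ 0 :=
    eventually_countable_forall.2 fun R => c.eventually_integral_defect_le_zero μ hz R.cast_nonneg
  filter_upwards [hall] with K hK
  have hnn : ∀ᵐ y ∂μ, 0 ≤ c.defect K.1 z y := by
    filter_upwards [c.ae_differentiableAt_spt μ K.2] with y hy
    exact c.defect_nonneg K.2 hy
  have hR : ∀ R : ℕ, ∀ᵐ y ∂μ, y ∈ Metric.ball 0 (R : ℝ) → c.defect K.1 z y = 0 := fun R => by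
    refine (ae_restrict_iff' measurableSet_ball).1 ?_
    exact (setIntegral_eq_zero_iff_of_nonneg_ae (ae_restrict_of_ae hnn)
      (c.integrableOn_defect μ K hz R)).1 (le_antisymm (hK R)
      (integral_nonneg_of_ae (ae_restrict_of_ae hnn)))
  filter_upwards [ae_all_iff.2 hR] with y hy
  obtain ⟨R, hR⟩ := exists_nat_gt ‖y‖
  exact hy R (mem_ball_zero_iff.2 hR)

end Residual

/-! ### From the chart to unit normals -/

section Pointwise

variable {n : ℕ} {F : Type*} [NormedAddCommGroup F] [InnerProductSpace ℝ F] (c : Chart n F)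
  {K : ConvexBody (E n)} {A : E n →L[ℝ] E n} {y : F}

/-- If the defect vanishes in a dense set of directions, then the derivative of the support point
map satisfies the projection identity in all directions of space. -/
theorem inner_deriv_eq_of_dense (hK : IsOfConstantWidth K 1)
    (hA : HasFDerivAt (supportPoint K) A (c.pt y)) {ι' : Type*} {d : ι' → F} (hd : DenseRange d)
    (h : ∀ i, c.defect K ((1 + ‖d i‖)⁻¹ • d i) y = 0) (x : E n) :
    ⟪A x, x⟫ = ‖c.pt y‖ * ‖A x‖ ^ 2 := by
  have h1 : ∀ z : F, ⟪A (c.ι z), c.ι z⟫ = ‖c.pt y‖ * ‖A (c.ι z)‖ ^ 2 := fun z => by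
    refine hd.induction_on z ?_ fun i => ?_
    · exact isClosed_eq (by fun_prop) (by fun_prop)
    · have h2 := h i
      have hpos : 0 < (1 + ‖d i‖)⁻¹ := by positivity
      rw [c.defect_eq hA, map_smul, map_smul, real_inner_smul_left, real_inner_smul_right,
        norm_smul, Real.norm_of_nonneg hpos.le, mul_pow] at h2
      have h3 : (1 + ‖d i‖)⁻¹ ^ 2 *
          (⟪A (c.ι (d i)), c.ι (d i)⟫ - ‖c.pt y‖ * ‖A (c.ι (d i))‖ ^ 2) = 0 := by
        rw [← h2]
        ring
      exact sub_eq_zero.1 ((mul_eq_zero.1 h3).resolve_left (by positivity))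
  -- Every x is a multiple of the normal plus a chart direction, and A kills the normal and has
  -- range orthogonal to it.
  have hx : x = ⟪c.e, x⟫ • c.pt y + c.ι (c.π x - ⟪c.e, x⟫ • y) := by
    conv_lhs => rw [← c.decomp x]
    rw [pt, map_sub, map_smul, smul_add]
    abel
  set a := ⟪c.e, x⟫
  set w := c.π x - a • y
  have hAx : A x = A (c.ι w) := by
    rw [hx, map_add, map_smul, hK.deriv_self (c.pt_ne_zero y) hA, smul_zero, zero_add]
  rw [hAx, ← h1 w]
  conv_lhs => rw [hx]
  rw [inner_add_right, real_inner_smul_right, hK.inner_deriv_eq (c.pt_ne_zero y) hA, mul_zero,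
    zero_add]

/-- The map is homogeneous of degree 0, so its derivative scales by ‖v‖. This removes the factor ‖v‖
from the defect identity. -/
theorem hasFDerivAt_supportPoint_normalize (hK : IsOfConstantWidth K 1) {v : E n} (hv : v ≠ 0)
    (hA : HasFDerivAt (supportPoint K) A v) :
    HasFDerivAt (supportPoint K) (‖v‖ • A) (‖v‖⁻¹ • v) := by
  have hv0 : 0 < ‖v‖ := norm_pos_iff.2 hv
  have h1 : HasFDerivAt (fun w : E n => ‖v‖ • w) (‖v‖ • ContinuousLinearMap.id ℝ (E n))
      (‖v‖⁻¹ • v) := (hasFDerivAt_id _).const_smul ‖v‖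
  have h2 : HasFDerivAt (supportPoint K) A (‖v‖ • ‖v‖⁻¹ • v) := by
    rwa [smul_inv_smul₀ hv0.ne']
  have h3 := h2.comp (‖v‖⁻¹ • v) h1
  have h4 : A.comp (‖v‖ • ContinuousLinearMap.id ℝ (E n)) = ‖v‖ • A := by
    ext w
    simp
  rw [h4] at h3
  refine h3.congr_of_eventuallyEq ?_
  filter_upwards [isOpen_ne.mem_nhds (smul_ne_zero (inv_ne_zero hv0.ne') hv)] with w hw
  exact (hK.supportPoint_smul hv0 hw).symm

end Pointwise

/-! ### Transfer of null sets to the sphere -/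

section Sphere

variable {n : ℕ} {F : Type*} [NormedAddCommGroup F] [InnerProductSpace ℝ F] (c : Chart n F)

theorem lipschitzWith_normalize_pt : LipschitzWith 1 fun y => ‖c.pt y‖⁻¹ • c.pt y := by
  refine LipschitzWith.of_dist_le_mul fun v w => ?_
  rw [dist_eq_norm, dist_eq_norm, NNReal.coe_one, one_mul]
  refine (norm_inv_norm_smul_sub_le (c.one_le_norm_pt v) (c.one_le_norm_pt w)).trans_eq ?_
  rw [c.pt_sub_pt, LinearIsometry.norm_map]

theorem exists_normalize_pt_eq {u : E n} (hu : ‖u‖ = 1) (h : 0 < ⟪c.e, u⟫) :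
    ∃ y, ‖c.pt y‖⁻¹ • c.pt y = u := by
  refine ⟨⟪c.e, u⟫⁻¹ • c.π u, ?_⟩
  have h1 : c.pt (⟪c.e, u⟫⁻¹ • c.π u) = ⟪c.e, u⟫⁻¹ • u := by
    rw [eq_inv_smul_iff₀ h.ne', c.smul_pt h.ne']
  rw [h1, norm_smul, hu, mul_one, norm_inv, Real.norm_of_nonneg h.le, inv_inv, smul_inv_smul₀ h.ne']

variable [FiniteDimensional ℝ F] [MeasurableSpace F] [BorelSpace F]

theorem eventually_ae_exists_deriv (μ : Measure F) [μ.IsAddHaarMeasure] :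
    ∀ᶠ K : ConstantWidthBody n in residual (ConstantWidthBody n), ∀ᵐ y ∂μ,
      ∃ A : E n →L[ℝ] E n, HasFDerivAt (supportPoint K.1) A (‖c.pt y‖⁻¹ • c.pt y) ∧
        ∀ x, ⟪A x, x⟫ = ‖A x‖ ^ 2 := by
  set d := TopologicalSpace.denseSeq F
  have hall : ∀ᶠ K : ConstantWidthBody n in residual (ConstantWidthBody n), ∀ i,
      ∀ᵐ y ∂μ, c.defect K.1 ((1 + ‖d i‖)⁻¹ • d i) y = 0 := by
    refine eventually_countable_forall.2 fun i => c.eventually_ae_defect_eq_zero μ ?_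
    rw [norm_smul, norm_inv, Real.norm_of_nonneg (by positivity), inv_mul_le_iff₀ (by positivity)]
    linarith
  filter_upwards [hall] with K hK
  filter_upwards [ae_all_iff.2 hK, c.ae_differentiableAt_spt μ K.2] with y hy hdiff
  obtain ⟨A, hA⟩ := c.exists_hasFDerivAt_supportPoint K.2 hdiff
  refine ⟨_, hasFDerivAt_supportPoint_normalize K.2 (c.pt_ne_zero y) hA, fun x => ?_⟩
  rw [smul_apply, real_inner_smul_left, norm_smul, norm_norm, c.inner_deriv_eq_of_dense K.2 hA
    (TopologicalSpace.denseRange_denseSeq F) hy]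
  ring

/-- Hausdorff measure in the dimension of F is a Haar measure there, and the 1-Lipschitz
parametrization of the open hemisphere maps null sets to null sets. -/
theorem eventually_ae_sphere {d : ℝ} (hd : (Module.finrank ℝ F : ℝ) = d) :
    ∀ᶠ K : ConstantWidthBody n in residual (ConstantWidthBody n), ∀ᵐ u ∂(μH[d] : Measure (E n)),
      ‖u‖ = 1 → 0 < ⟪c.e, u⟫ → ∃ A : E n →L[ℝ] E n, HasFDerivAt (supportPoint K.1) A u ∧
        ∀ x, ⟪A x, x⟫ = ‖A x‖ ^ 2 := by
  subst hd
  have := isAddHaarMeasure_hausdorffMeasure (E := F)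
  filter_upwards [c.eventually_ae_exists_deriv μH[(Module.finrank ℝ F : ℝ)]] with K hK
  rw [ae_iff] at hK ⊢
  set S : Set F := {y | ¬∃ A : E n →L[ℝ] E n,
    HasFDerivAt (supportPoint K.1) A (‖c.pt y‖⁻¹ • c.pt y) ∧
    ∀ x, ⟪A x, x⟫ = ‖A x‖ ^ 2}
  have h1 := c.lipschitzWith_normalize_pt.hausdorffMeasure_image_le
    (d := (Module.finrank ℝ F : ℝ)) (Nat.cast_nonneg _) S
  refine measure_mono_null ?_ (le_antisymm (h1.trans_eq (by rw [hK, mul_zero])) zero_le)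
  intro u hu
  rw [mem_ofPred_eq] at hu
  push Not at hu
  obtain ⟨hu1, hu2, hu3⟩ := hu
  obtain ⟨y, rfl⟩ := c.exists_normalize_pt_eq hu1 hu2
  exact ⟨y, fun ⟨A, hA, hq⟩ => (hu3 A hA).elim fun x hx => hx (hq x), rfl⟩

end Sphere

/-- The gnomonic chart centred at a unit vector. -/
def ofUnit {n : ℕ} (e : E n) (he : ‖e‖ = 1) : Chart n (Submodule.span ℝ {e})ᗮ where
  e := e
  norm_e := he
  ι := (Submodule.span ℝ {e})ᗮ.subtypeₗᵢ
  π := (Submodule.span ℝ {e})ᗮ.orthogonalProjectionOnto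
  inner_e_ι y := Submodule.mem_orthogonal_singleton_iff_inner_right.1 y.2
  inner_π x y := by
    rw [real_inner_comm, Submodule.inner_orthogonalProjectionOnto_eq_of_mem_left, real_inner_comm]
    rfl
  decomp x := by
    have h := Submodule.starProjection_add_starProjection_orthogonal
      (K := Submodule.span ℝ {e}) x
    rw [Submodule.starProjection_unit_singleton ℝ he] at h
    exact h

end Chart

theorem eventually_ae_sphere_of_unit {n : ℕ} (hn : 2 ≤ n) {e : E n} (he : ‖e‖ = 1) :
    ∀ᶠ K : ConstantWidthBody n in residual (ConstantWidthBody n),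
      ∀ᵐ u ∂(μH[(n : ℝ) - 1] : Measure (E n)),
      ‖u‖ = 1 → 0 < ⟪e, u⟫ → ∃ A : E n →L[ℝ] E n, HasFDerivAt (supportPoint K.1) A u ∧
        ∀ x, ⟪A x, x⟫ = ‖A x‖ ^ 2 := by
  obtain ⟨m, rfl⟩ : ∃ m, n = m + 1 := ⟨n - 1, by omega⟩
  have : Fact (Module.finrank ℝ (E (m + 1)) = m + 1) := ⟨finrank_euclideanSpace_fin⟩
  have hne : e ≠ 0 := norm_ne_zero_iff.1 (by rw [he]; exact one_ne_zero)
  refine (Chart.ofUnit e he).eventually_ae_sphere ?_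
  rw [Submodule.finrank_orthogonal_span_singleton (n := m) hne]
  push_cast
  ring

end

end ConstWidth

theorem mainTheorem2 (n : ℕ) (hn : 2 ≤ n) :
    ∀ᶠ K : ConstWidth.ConstantWidthBody n in residual (ConstWidth.ConstantWidthBody n),
      ∀ᵐ u ∂((μH[(n : ℝ) - 1] : Measure (ConstWidth.E n)).restrict (Metric.sphere 0 1)),
        (∀ t : ConstWidth.E n, ‖t‖ = 1 → ⟪u, t⟫ = 0 →
            ConstWidth.HasRadiusOfCurvature K.1 u t 1) ∨
        (∃ t : ConstWidth.E n, ‖t‖ = 1 ∧ ⟪u, t⟫ = 0 ∧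
            ConstWidth.HasRadiusOfCurvature K.1 u t 0) := by
  have hb : ∀ i : Fin n, ‖EuclideanSpace.single i (1 : ℝ)‖ = 1 := fun i => by simp
  -- The 2n open hemispheres centred at the coordinate vectors and their negatives cover the sphere,
  -- since a unit vector has a nonzero coordinate.
  have h1 := eventually_countable_forall.2 fun i : Fin n =>
    ConstWidth.eventually_ae_sphere_of_unit hn (hb i)
  have h2 := eventually_countable_forall.2 fun i : Fin n =>
    ConstWidth.eventually_ae_sphere_of_unit hn ((norm_neg _).trans (hb i))
  filter_upwards [h1, h2] with K hK1 hK2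
  rw [ae_restrict_iff' Metric.isClosed_sphere.measurableSet]
  filter_upwards [ae_all_iff.2 hK1, ae_all_iff.2 hK2] with u hu1 hu2 hu
  have hu : ‖u‖ = 1 := mem_sphere_zero_iff_norm.1 hu
  suffices h : ∃ A : ConstWidth.E n →L[ℝ] ConstWidth.E n,
      HasFDerivAt (ConstWidth.supportPoint K.1) A u ∧ ∀ x, ⟪A x, x⟫ = ‖A x‖ ^ 2 by
    obtain ⟨A, hA, hq⟩ := h
    exact K.2.curvature_alternative hu hA hq
  obtain ⟨i, hi⟩ : ∃ i, u i ≠ 0 := by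
    by_contra! hall
    have h0 : u = 0 := by
      ext i
      exact hall i
    rw [h0, norm_zero] at hu
    exact zero_ne_one hu
  have hinner : ⟪EuclideanSpace.single i (1 : ℝ), u⟫ = u i := by
    rw [EuclideanSpace.inner_single_left]
    simp
  rcases hi.lt_or_gt with hlt | hgt
  · exact hu2 i hu (by rw [inner_neg_left, hinner]; linarith)
  · exact hu1 i hu (by rw [hinner]; exact hgt)
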